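/- Let $(p_k)_{k\ge 1}$ be a probability distribution with $p_k>0$ for infinitely many $k$. Let $S_n=T_1+\dots+T_n$, $n\ge1$, where $T_1,T_2,\dots$ are independent exponential random variables of unit mean, and let $X_1,X_2,\dots$ be independent random variables with $P\{X_n=k\}=p_k$, independent of $(T_n)_{n\ge 1}$. Ball $n$ is thrown at time $S_n$ and hits box $X_n$. For $j\in\mathbb{N}=\{1,2,\dots\}$ and $t\ge 0$ let $K_j^*(t)$ be the number of boxes that contain exactly $j$ balls at time $t$, i.e. the number of $k$ with $\#\{n\ge1: S_n\le t,\ X_n=k\}=j$. Put $\rho(t)=\#\{k: p_k>0,\ 1/p_k\le t\}$ for $t>0$. Assume that, for some $\alpha\in(0,1)$ and some function $L$ slowly varying at $+\infty$, $\rho(t)\sim t^\alpha L(t)$ as $t\to\infty$. Then, for each $j\in\mathbb{N}$, the variables $K_j^*(t)$ are square integrable, $$\limsup_{t\to\infty}\frac{K^*_j(t)-\mathbb{E} K^*_j(t)}{\big(\operatorname{Var}K^*_j(t)\,\log\log \operatorname{Var}K^*_j(t)\big)^{1/2}}=2^{1/2}\quad\text{a.s.},\qquad \liminf_{t\to\infty}\frac{K^*_j(t)-\mathbb{E}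 K^*_j(t)}{\big(\operatorname{Var}K^*_j(t)\,\log\log \operatorname{Var}K^*_j(t)\big)^{1/2}}=-2^{1/2}\quad\text{a.s.},$$ and, as $t\to\infty$, $$\mathbb{E}K^*_j(t)\sim \alpha\,\frac{\Gamma(j-\alpha)}{j!}\,t^\alpha L(t),\qquad \operatorname{Var}K^*_j(t)\sim c_{j,\alpha}\,t^\alpha L(t),$$ where $\Gamma$ is the Euler gamma function and $$c_{j,\alpha}=\alpha\Big(\frac{\Gamma(j-\alpha)}{j!}-\frac{2^{\alpha}\,\Gamma(2j-\alpha)}{2^{2j}(j!)^2}\Big)>0.$$ -/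

import Mathlib

open MeasureTheory ProbabilityTheory Filter Topology Asymptotics
open scoped Nat

noncomputable section

namespace Karlin

/-- `L` is slowly varying at infinity: on some half-line `[A, ∞)` it is positive and measurable,
and `L (c t) / L t → 1` as `t → ∞`, for every `c > 0`. -/
def IsSlowlyVarying (L : ℝ → ℝ) : Prop :=
  (∃ A : ℝ, (∀ t, A ≤ t → 0 < L t) ∧ Measurable ((Set.Ici A).domRestrict L)) ∧
    ∀ c : ℝ, 0 < c → Tendsto (fun t => L (c * t) / L t) atTop (𝓝 1)

/-- `p` is a probability distribution on the boxes (labelled by `ℕ`) that gives positive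
probability to infinitely many boxes. -/
structure IsBoxDistribution (p : ℕ → ℝ) : Prop where
  nonneg : ∀ k, 0 ≤ p k
  hasSum_one : HasSum p 1
  infinite_pos : {k | 0 < p k}.Infinite

/-- `ρ(t) = #{k : 1 / p k ≤ t}`, where boxes with `p k = 0` have `1 / p k = ∞` and do not count.
For a probability distribution `p` the set is finite. -/
def rho (p : ℕ → ℝ) (t : ℝ) : ℝ :=
  ({k : ℕ | 0 < p k ∧ 1 / p k ≤ t}.ncard : ℝ)

variable {Ω : Type*} [MeasurableSpace Ω]

/-- The randomness of the Poissonized occupancy scheme: `T n` is the waiting time before the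
`n`-th ball is thrown (balls are numbered from `0`) and `X n` is the box which that ball hits.
The `T n` are independent, exponential of mean one, the `X n` are independent with
distribution `p`, and the two sequences are independent of each other. -/
structure IsPoissonizedScheme (p : ℕ → ℝ) (μ : Measure Ω) (T : ℕ → Ω → ℝ) (X : ℕ → Ω → ℕ) :
    Prop where
  measurable_T : ∀ n, Measurable (T n)
  measurable_X : ∀ n, Measurable (X n)
  law_T : ∀ n, μ.map (T n) = expMeasure 1
  law_X : ∀ n k, μ {ω | X n ω = k} = ENNReal.ofReal (p k)
  indep_T : iIndepFun T μ
  indep_X : iIndepFun X μ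
  indep_T_X : IndepFun (fun ω n => T n ω) (fun ω n => X n ω) μ

/-- The time at which ball `n` is thrown: the random walk with steps `T 0, T 1, …`. -/
def throwTime (T : ℕ → Ω → ℝ) (n : ℕ) (ω : Ω) : ℝ := ∑ i ∈ Finset.range (n + 1), T i ω

/-- The number of balls in box `k` at time `t`. -/
def ballCount (T : ℕ → Ω → ℝ) (X : ℕ → Ω → ℕ) (k : ℕ) (t : ℝ) (ω : Ω) : ℕ∞ :=
  {n : ℕ | throwTime T n ω ≤ t ∧ X n ω = k}.encard

/-- The small count `K*_j(t)`: the number of boxes that contain exactly `j` balls at time `t`.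
For `j ≥ 1` the set of these boxes is finite as soon as finitely many balls are thrown by
time `t`, hence almost surely for all `t`. -/
def smallCount (T : ℕ → Ω → ℝ) (X : ℕ → Ω → ℕ) (j : ℕ) (t : ℝ) (ω : Ω) : ℝ :=
  ({k : ℕ | ballCount T X k t ω = (j : ℕ∞)}.ncard : ℝ)

/-- `(K*_j(t) - E K*_j(t)) / (Var K*_j(t) · log log Var K*_j(t))^{1/2}`. -/
def normalizedCount (μ : Measure Ω) (T : ℕ → Ω → ℝ) (X : ℕ → Ω → ℕ) (j : ℕ) (t : ℝ) (ω : Ω) : ℝ :=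
  (smallCount T X j t ω - ∫ ω', smallCount T X j t ω' ∂μ) /
    √(variance (smallCount T X j t) μ * Real.log (Real.log (variance (smallCount T X j t) μ)))

/-- The constant `c_{j,α}` in the asymptotics of the variance. -/
def varConst (j : ℕ) (α : ℝ) : ℝ :=
  α * (Real.Gamma (j - α) / (j ! : ℝ) -
    (2 : ℝ) ^ α * Real.Gamma (2 * j - α) / (2 ^ (2 * j) * (j ! : ℝ) ^ 2))

end Karlin

end

/-!
# The law of the iterated logarithm for the small counts in Karlin's occupancy scheme

At a fixed time the Poissonized scheme is simple: by thinning, the numbers of balls in the different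
boxes are independent Poisson variables, so `K*_j(t)` is a sum of independent indicators with
success probabilities `q_j(p_k t)`, where `q_j(x) = e^{-x} x^j / j!`. Independence over boxes of the
counts at two times each (`IsPoissonizedScheme.iIndepFun_boxCount`) is all that is used of the
scheme. It is proved by computing the joint characteristic function, for which a product over the
balls is completed to a martingale (`integral_mul_survivalFactor`).

*Mean and variance.* These are `∑ q_j(p_k t)` and `∑ q_j(1 - q_j)(p_k t)`. Writing the summands as
integrals of their derivatives turns the sums into integrals against `ρ(t / z)`, and the regular
variation of `ρ` with a Potter bound gives their limits relative to `ρ(t)`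
(`tendsto_tsum_primitive_div_rho`). The limit of the variance is the integral of a positive
function, whence `c_{j,α} > 0`.

*Upper bound.* Along a geometric sequence `θ^n` Bernstein's inequality and the first Borel–Cantelli
lemma give the constant `√2` (`IsPoissonizedScheme.ae_eventually_geometric`). Increments of `K*_j`
are differences of numbers of boxes which receive their `j`-th, respectively `j + 1`-st, ball in an
interval `(s, t]` (`smallCount_sub_smallCount`). Such a number is again a sum of independent
indicators, with variance of the order of `ρ(s) (t - s) / s`, and is monotone in `t`. Bernstein's
inequality makes the increments negligible from `θ^n` to the times `exp (i^{1/3})` if `θ` is close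
to `1`, from these to the integers, and between consecutive integers. At each level the number of
intervals is small enough for the first Borel–Cantelli lemma.

*Lower bound.* At time `θ^n`, with `θ = a^2`, all but a small proportion of the variance comes from
the boxes with `a⁻¹ < p_k θ^n ≤ a`, if `a` is large (`exists_window`). For different `n` these sets
of boxes are disjoint, so the contributions are independent, and Kolmogorov's lower exponential
bound (`exists_exp_le_measure_sum`) with the second Borel–Cantelli lemma applies to them
(`ae_frequently_of_blocks`). The other boxes contribute little by the upper bound.
-/

/-! ### The martingale of a rate one Poisson process -/

namespace Karlin

theorem integral_expMeasure_one {E : Type*} [NormedAddCommGroup E] [NormedSpace ℝ E]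
    (f : ℝ → E) :
    ∫ v, f v ∂expMeasure 1 = ∫ v in Set.Ioi (0 : ℝ), Real.exp (-v) • f v := by
  have h1 : expMeasure 1 = volume.withDensity (fun v => gammaPDF 1 1 v) := rfl
  rw [h1, integral_withDensity_eq_integral_toReal_smul, ← integral_Ici_eq_integral_Ioi,
    ← integral_indicator measurableSet_Ici]
  · congr 1
    ext v
    by_cases hv : 0 ≤ v
    · simp [gammaPDF, gammaPDFReal, hv, Real.exp_nonneg]
    · simp [gammaPDF, gammaPDFReal, hv]
  · exact (measurable_gammaPDFReal 1 1).ennreal_ofReal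
  · exact ae_of_all _ fun v => by simp [gammaPDF]

/-- `exp (-∫ₓᴹ (1 - h))`, the mean of `∏ h(S)` over the arrival times `S > x` of a rate one Poisson
process, if `h = 1` beyond `M`. Multiplied by this factor at the last arrival time, the product of
`h` over the first `n` arrival times is a martingale in `n`. -/
noncomputable def survivalFactor (h : ℝ → ℂ) (M x : ℝ) : ℂ := Complex.exp (-∫ u in x..M, (1 - h u))

section survivalFactor

variable {h : ℝ → ℂ} {M : ℝ}

theorem intervalIntegrable_one_sub (hm : Measurable h) (hb : ∀ u, ‖h u‖ ≤ 1) (a b : ℝ) :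
    IntervalIntegrable (fun u => 1 - h u) volume a b := by
  have : IntervalIntegrable (fun _ : ℝ => (2 : ℝ)) volume a b := intervalIntegrable_const
  refine this.mono_fun (measurable_const.sub hm).aestronglyMeasurable (ae_of_all _ fun u => ?_)
  have := norm_sub_le (1 : ℂ) (h u)
  have := hb u
  simp only [norm_one, Real.norm_ofNat] at *
  linarith

theorem survivalFactor_of_le (hM : ∀ u, M < u → h u = 1) {x : ℝ} (hx : M ≤ x) :
    survivalFactor h M x = 1 := by
  have : ∫ u in x..M, (1 - h u) = 0 := by
    rw [intervalIntegral.integral_symm, intervalIntegral.integral_of_le hx,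
      setIntegral_congr_fun (g := fun _ => (0 : ℂ)) measurableSet_Ioc]
    · simp
    · intro u hu
      simp [hM u hu.1]
  simp [survivalFactor, this]

theorem norm_survivalFactor_le (hm : Measurable h) (hb : ∀ u, ‖h u‖ ≤ 1)
    (hM : ∀ u, M < u → h u = 1) (x : ℝ) : ‖survivalFactor h M x‖ ≤ 1 := by
  rcases le_total M x with hx | hx
  · simp [survivalFactor_of_le hM hx]
  · have hre : 0 ≤ (∫ u in x..M, (1 - h u)).re := by
      have := intervalIntegrable_one_sub hm hb x M
      rw [show (∫ u in x..M, (1 - h u)).re = ∫ u in x..M, (1 - h u).re from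
        (intervalIntegral.intervalIntegral_re (𝕜 := ℂ) this).symm]
      refine intervalIntegral.integral_nonneg hx fun u _ => ?_
      have h1 := (Complex.re_le_norm (h u)).trans (hb u)
      simpa using h1
    rw [survivalFactor, Complex.norm_exp]
    simpa using hre

theorem continuous_survivalFactor (hm : Measurable h) (hb : ∀ u, ‖h u‖ ≤ 1) :
    Continuous (survivalFactor h M) := by
  unfold survivalFactor
  refine Complex.continuous_exp.comp (Continuous.neg ?_)
  have h2 : (fun x => ∫ u in x..M, (1 - h u)) = fun x => -∫ u in M..x, (1 - h u) := by
    ext x; rw [intervalIntegral.integral_symm]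
  rw [h2]
  exact (intervalIntegral.continuous_primitive
    (fun a b => intervalIntegrable_one_sub hm hb a b) M).neg

theorem hasDerivAt_survivalFactor (hm : Measurable h) (hb : ∀ u, ‖h u‖ ≤ 1) {x : ℝ}
    (hx : ContinuousAt h x) :
    HasDerivAt (survivalFactor h M) ((1 - h x) * survivalFactor h M x) x := by
  have h1 : HasDerivAt (fun x => ∫ u in x..M, (1 - h u)) (-(1 - h x)) x :=
    intervalIntegral.integral_hasDerivAt_left (intervalIntegrable_one_sub hm hb x M)
      (measurable_const.sub hm).stronglyMeasurable.stronglyMeasurableAtFilter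
      (continuousAt_const.sub hx)
  have h2 := h1.neg.cexp
  exact h2.congr_deriv (by simp [survivalFactor, mul_comm])

/-- The one-step martingale identity. The integrand times the exponential density is the derivative
of `-exp (-v) * survivalFactor h M (x + v)`, off the countably many discontinuities of `h`. -/
theorem integral_mul_survivalFactor (hm : Measurable h) (hb : ∀ u, ‖h u‖ ≤ 1)
    (hM : ∀ u, M < u → h u = 1) {D : Set ℝ} (hD : D.Countable)
    (hc : ∀ u, u ∉ D → ContinuousAt h u) (x : ℝ) :
    ∫ v, h (x + v) * survivalFactor h M (x + v) ∂expMeasure 1 = survivalFactor h M x := by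
  rw [integral_expMeasure_one]
  set F := survivalFactor h M with hF
  have hFc : Continuous F := continuous_survivalFactor hm hb
  have hFb : ∀ x, ‖F x‖ ≤ 1 := norm_survivalFactor_le hm hb hM
  have hmeas : Measurable (fun v : ℝ => Real.exp (-v) • (h (x + v) * F (x + v))) :=
    (by fun_prop : Measurable fun v : ℝ => Real.exp (-v)).smul
      ((hm.comp (measurable_const_add x)).mul (hFc.measurable.comp (measurable_const_add x)))
  have hnorm : ∀ v : ℝ, ‖Real.exp (-v) • (h (x + v) * F (x + v))‖ ≤ Real.exp (-v) := by
    intro v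
    rw [norm_smul, norm_mul, Real.norm_of_nonneg (Real.exp_nonneg _)]
    exact mul_le_of_le_one_right (Real.exp_nonneg _)
      (mul_le_one₀ (hb _) (norm_nonneg _) (hFb _))
  have hint : IntegrableOn (fun v : ℝ => Real.exp (-v) • (h (x + v) * F (x + v)))
      (Set.Ioi 0) := by
    have h1 : IntegrableOn (fun v : ℝ => Real.exp (-v)) (Set.Ioi 0) := by
      simpa using integrableOn_exp_neg_Ioi (0 : ℝ)
    exact h1.mono' hmeas.aestronglyMeasurable (ae_of_all _ hnorm)
  have hlim := intervalIntegral_tendsto_integral_Ioi (0 : ℝ) hint tendsto_id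
  refine tendsto_nhds_unique hlim ?_
  have hcount : ((fun v => x + v) ⁻¹' D).Countable :=
    hD.preimage (add_right_injective x)
  have hval : ∀ R : ℝ, ∫ v in (0 : ℝ)..R, Real.exp (-v) • (h (x + v) * F (x + v)) =
      F x - Real.exp (-R) • F (x + R) := by
    intro R
    rw [integral_eq_of_hasDerivAt_off_countable (fun v => -(Real.exp (-v) • F (x + v))) _ hcount]
    · simp; ring
    · have := hFc.comp (continuous_const_add x)
      exact Continuous.continuousOn ((by fun_prop : Continuous fun v : ℝ => Real.exp (-v)).smul
        this).neg
    · intro v hv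
      have h1 : HasDerivAt (fun v : ℝ => Real.exp (-v)) (-Real.exp (-v)) v := by
        simpa using (hasDerivAt_neg v).exp
      have h2 : HasDerivAt (fun v => F (x + v)) ((1 - h (x + v)) * F (x + v)) v := by
        have := hasDerivAt_survivalFactor (M := M) hm hb (hc _ hv.2)
        exact HasDerivAt.comp_const_add x v this
      have h3 := (h1.smul h2).neg
      refine h3.congr_deriv ?_
      simp only [Complex.real_smul, neg_smul]
      ring
    · exact (Continuous.intervalIntegrable
        (by fun_prop : Continuous fun v : ℝ => Real.exp (-v)) 0 R).mono_fun
        hmeas.aestronglyMeasurable (ae_of_all _ fun v => by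
          simpa [abs_of_nonneg (Real.exp_nonneg _)] using hnorm v)
  simp only [id, hval]
  have : Tendsto (fun R : ℝ => Real.exp (-R) • F (x + R)) atTop (𝓝 0) := by
    refine squeeze_zero_norm (fun R => ?_)
      (Real.tendsto_exp_neg_atTop_nhds_zero)
    rw [norm_smul, Real.norm_of_nonneg (Real.exp_nonneg _)]
    exact mul_le_of_le_one_right (Real.exp_nonneg _) (hFb _)
  simpa using tendsto_const_nhds.sub this

end survivalFactor

end Karlin

/-! ### Box counts and the martingale of the marked process -/

namespace Karlin

/-- The number of balls in box `k` at time `t`, as a natural number (`0` if there are infinitely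
many, which almost surely never happens). -/
noncomputable def boxCount {Ω : Type*} (T : ℕ → Ω → ℝ) (X : ℕ → Ω → ℕ) (k : ℕ) (t : ℝ) (ω : Ω) :
    ℕ :=
  (ballCount T X k t ω).toNat

variable {Ω : Type*} [MeasurableSpace Ω] {μ : Measure Ω} {T : ℕ → Ω → ℝ} {X : ℕ → Ω → ℕ}

theorem measurable_throwTime (hT : ∀ n, Measurable (T n)) (n : ℕ) :
    Measurable (throwTime T n) :=
  Finset.measurable_fun_sum _ fun i _ => hT i

theorem measurable_boxCount (hT : ∀ n, Measurable (T n)) (hX : ∀ n, Measurable (X n)) (k : ℕ)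
    (t : ℝ) : Measurable (boxCount T X k t) := by
  have hset : ∀ n, MeasurableSet {ω | throwTime T n ω ≤ t ∧ X n ω = k} := fun n =>
    (measurableSet_le (measurable_throwTime hT n) measurable_const).inter
      (hX n (measurableSet_singleton k))
  have h1 : ∀ ω, (boxCount T X k t ω : ℝ) =
      (∑' n, Set.indicator {ω | throwTime T n ω ≤ t ∧ X n ω = k} (fun _ => (1 : ENNReal)) ω).toReal
      := by
    intro ω
    have h2 : ∑' n, Set.indicator {ω | throwTime T n ω ≤ t ∧ X n ω = k}
        (fun _ => (1 : ENNReal)) ω = (ballCount T X k t ω : ENNReal) := by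
      rw [ballCount, ← ENNReal.tsum_set_one, tsum_subtype _ (fun _ => (1 : ENNReal))]
      rfl
    rw [h2, boxCount]
    cases ballCount T X k t ω <;> simp
  have h3 : Measurable fun ω => (boxCount T X k t ω : ℝ) := by
    simp_rw [h1]
    exact (Measurable.tsum fun n => measurable_const.indicator (hset n)).ennreal_toReal
  refine measurable_to_countable' fun i => ?_
  have := h3 (measurableSet_singleton (i : ℝ))
  convert this using 1
  ext ω
  simp

/-- By the strong law of large numbers, `T 0 + ⋯ + T (n - 1) → ∞` almost surely. -/
theorem ae_tendsto_sum [IsProbabilityMeasure μ] (hT : ∀ n, Measurable (T n))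
    (hl : ∀ n, μ.map (T n) = expMeasure 1) (hi : iIndepFun T μ) :
    ∀ᵐ ω ∂μ, Tendsto (fun n => ∑ i ∈ Finset.range n, T i ω) atTop atTop := by
  have hint1 : IntegrableOn (fun v : ℝ => Real.exp (-v) * v) (Set.Ioi 0) := by
    have := Real.GammaIntegral_convergent (s := 2) (by norm_num)
    refine this.congr_fun (fun v hv => ?_) measurableSet_Ioi
    simp only []
    norm_num
  have hint2 : Integrable (fun v : ℝ => v) (expMeasure 1) := by
    have h1 : expMeasure 1 = volume.withDensity (fun v => gammaPDF 1 1 v) := rfl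
    rw [h1, integrable_withDensity_iff_integrable_smul' (f := fun v => gammaPDF 1 1 v)
      (measurable_gammaPDFReal 1 1).ennreal_ofReal
      (ae_of_all _ fun v => by simp [gammaPDF])]
    have h2 : IntegrableOn (fun v : ℝ => Real.exp (-v) * v) (Set.Ici 0) :=
      (integrableOn_Ici_iff_integrableOn_Ioi).2 hint1
    refine (integrable_indicator_iff measurableSet_Ici).2 h2 |>.congr (ae_of_all _ fun v => ?_)
    by_cases hv : 0 ≤ v
    · simp [gammaPDF, gammaPDFReal, hv, Real.exp_nonneg]
    · simp [gammaPDF, gammaPDFReal, hv]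
  have hint : Integrable (T 0) μ := by
    rw [← hl 0] at hint2
    exact (integrable_map_measure aestronglyMeasurable_id (hT 0).aemeasurable).1 hint2
  have hmean : ∫ ω, T 0 ω ∂μ = 1 := by
    have h1 : ∫ v, v ∂(μ.map (T 0)) = ∫ ω, T 0 ω ∂μ :=
      integral_map (hT 0).aemeasurable aestronglyMeasurable_id
    rw [← h1, hl 0, integral_expMeasure_one]
    have := Real.Gamma_eq_integral (s := 2) (by norm_num)
    rw [Real.Gamma_two] at this
    rw [this]
    refine setIntegral_congr_fun measurableSet_Ioi fun v hv => ?_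
    simp only [smul_eq_mul]
    norm_num
  have hlaw := strong_law_ae_real T hint (fun i j hij => hi.indepFun hij)
    (fun i => ⟨(hT i).aemeasurable, (hT 0).aemeasurable, by rw [hl, hl]⟩)
  filter_upwards [hlaw] with ω hω
  rw [hmean] at hω
  have h1 := hω.pos_mul_atTop one_pos tendsto_natCast_atTop_atTop
  refine h1.congr' ?_
  filter_upwards [eventually_gt_atTop 0] with n hn
  have : (n : ℝ) ≠ 0 := by positivity
  field_simp

/-- The martingale identity: the mean of `∏_{i < n} h (S_i)`, completed by the expected product
over the later arrivals, does not depend on `n`. -/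
theorem integral_survivalFactor_mul_prod [IsProbabilityMeasure μ] (hT : ∀ n, Measurable (T n))
    (hl : ∀ n, μ.map (T n) = expMeasure 1) (hi : iIndepFun T μ)
    {h : ℝ → ℂ} {M : ℝ} (hm : Measurable h) (hb : ∀ u, ‖h u‖ ≤ 1)
    (hM : ∀ u, M < u → h u = 1) {D : Set ℝ} (hD : D.Countable)
    (hc : ∀ u, u ∉ D → ContinuousAt h u) (n : ℕ) :
    ∫ ω, survivalFactor h M (∑ i ∈ Finset.range n, T i ω) *
      ∏ i ∈ Finset.range n, h (throwTime T i ω) ∂μ = survivalFactor h M 0 := by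
  have hFm : Measurable (survivalFactor h M) := (continuous_survivalFactor hm hb).measurable
  have hFb := norm_survivalFactor_le hm hb hM
  induction n with
  | zero => simp
  | succ n ih =>
    -- The first `n` arrival times are a function `ψ` of the first `n` waiting times, hence
    -- independent of the next one.
    let e : (Finset.range n → ℝ) → ℕ → ℝ := fun y i =>
      if hh : i ∈ Finset.range n then y ⟨i, hh⟩ else 0
    have he : ∀ i, Measurable fun y => e y i := by
      intro i
      by_cases hh : i ∈ Finset.range n
      · simp only [e, hh, dite_true]
        exact measurable_pi_apply _
      · simp only [e, hh, dite_false]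
        exact measurable_const
    let ψ : (Finset.range n → ℝ) → ℝ × ℂ := fun y =>
      (∑ i ∈ Finset.range n, e y i,
        ∏ i ∈ Finset.range n, h (∑ l ∈ Finset.range (i + 1), e y l))
    have hψ : Measurable ψ := by
      refine Measurable.prodMk (Finset.measurable_fun_sum _ fun i _ => he i) ?_
      exact Finset.measurable_fun_prod _ fun i _ =>
        hm.comp (Finset.measurable_fun_sum _ fun i _ => he i)
    have hψY : ∀ ω, ψ (fun i => T i ω) =
        (∑ i ∈ Finset.range n, T i ω, ∏ i ∈ Finset.range n, h (throwTime T i ω)) := by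
      intro ω
      refine Prod.ext ?_ ?_
      · change ∑ i ∈ Finset.range n, e (fun i => T i ω) i = ∑ i ∈ Finset.range n, T i ω
        exact Finset.sum_congr rfl fun i hin => by simp only [e, hin, dite_true]
      · change ∏ i ∈ Finset.range n, h (∑ l ∈ Finset.range (i + 1), e (fun i => T i ω) l) =
          ∏ i ∈ Finset.range n, h (throwTime T i ω)
        refine Finset.prod_congr rfl fun i hin => ?_
        rw [throwTime]
        congr 1
        refine Finset.sum_congr rfl fun l hln => ?_
        have : l ∈ Finset.range n := by simp at *; omega
        simp only [e, this, dite_true]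
    have hind : IndepFun (fun ω => (∑ i ∈ Finset.range n, T i ω,
        ∏ i ∈ Finset.range n, h (throwTime T i ω))) (T n) μ := by
      have h1 := hi.indepFun_finset (Finset.range n) {n} (by simp) hT
      have h2 := h1.comp hψ (measurable_pi_apply (⟨n, by simp⟩ : ({n} : Finset ℕ)))
      have h3 : (fun ω => (∑ i ∈ Finset.range n, T i ω,
          ∏ i ∈ Finset.range n, h (throwTime T i ω))) = ψ ∘ fun ω i => T i ω := by
        ext1 ω
        exact (hψY ω).symm
      rw [h3]
      exact h2
    have hZm : Measurable (fun ω => (∑ i ∈ Finset.range n, T i ω,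
        ∏ i ∈ Finset.range n, h (throwTime T i ω))) := by
      have : Measurable fun ω => ψ (fun i => T i ω) :=
        hψ.comp (measurable_pi_lambda _ fun i => hT i)
      simpa only [hψY] using this
    have hmap := (indepFun_iff_map_prod_eq_prod_map_map hZm.aemeasurable (hT n).aemeasurable).1 hind
    rw [hl n] at hmap
    set Z := (fun ω => (∑ i ∈ Finset.range n, T i ω,
        ∏ i ∈ Finset.range n, h (throwTime T i ω))) with hZ
    let f : (ℝ × ℂ) × ℝ → ℂ := fun q =>
      q.1.2 * (h (q.1.1 + q.2) * survivalFactor h M (q.1.1 + q.2))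
    have hf : Measurable f := by
      have h1 : Measurable fun q : (ℝ × ℂ) × ℝ => q.1.1 + q.2 := by fun_prop
      exact (by fun_prop : Measurable fun q : (ℝ × ℂ) × ℝ => q.1.2).mul
        ((hm.comp h1).mul (hFm.comp h1))
    have hPb : ∀ ω, ‖(Z ω).2‖ ≤ 1 := fun ω => by
      simp only [hZ, norm_prod]
      exact Finset.prod_le_one (fun _ _ => norm_nonneg _) fun _ _ => hb _
    have hfb : ∀ ω, ‖f (Z ω, T n ω)‖ ≤ 1 := fun ω => by
      simp only [f, norm_mul]
      exact mul_le_one₀ (hPb ω) (by positivity) (mul_le_one₀ (hb _) (norm_nonneg _) (hFb _))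
    have hfi : Integrable f ((μ.map Z).prod (expMeasure 1)) := by
      rw [← hmap, integrable_map_measure hf.aestronglyMeasurable (hZm.prodMk (hT n)).aemeasurable]
      refine Integrable.of_bound
        (hf.comp (hZm.prodMk (hT n))).aestronglyMeasurable 1 (ae_of_all _ hfb)
    have h1 : ∫ ω, survivalFactor h M (∑ i ∈ Finset.range (n + 1), T i ω) *
        ∏ i ∈ Finset.range (n + 1), h (throwTime T i ω) ∂μ = ∫ ω, f (Z ω, T n ω) ∂μ := by
      congr 1
      ext ω
      simp only [f, hZ, Finset.prod_range_succ, throwTime, Finset.sum_range_succ _ n]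
      ring
    have : IsProbabilityMeasure (expMeasure 1) := isProbabilityMeasure_expMeasure one_pos
    have : IsProbabilityMeasure (μ.map Z) := Measure.isProbabilityMeasure_map hZm.aemeasurable
    have h2 : ∫ q, f q ∂(μ.map fun ω => (Z ω, T n ω)) = ∫ ω, f (Z ω, T n ω) ∂μ :=
      integral_map (hZm.prodMk (hT n)).aemeasurable hf.aestronglyMeasurable
    rw [h1, ← h2, hmap, integral_prod _ hfi]
    simp only [f, integral_const_mul, integral_mul_survivalFactor hm hb hM hD hc]
    rw [integral_map hZm.aemeasurable]
    · rw [← ih]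
      simp only [hZ, mul_comm]
    · exact (by fun_prop : Measurable fun q : ℝ × ℂ => q.2).mul (hFm.comp measurable_fst)
        |>.aestronglyMeasurable

/-- The martingale identity for the marked process: averaging over the marks `X i` replaces
`g u ·` by its mean `∫ g u k dν(k)`. -/
theorem integral_survivalFactor_mul_prod_marks [IsProbabilityMeasure μ]
    (hT : ∀ n, Measurable (T n)) (hX : ∀ n, Measurable (X n))
    (hl : ∀ n, μ.map (T n) = expMeasure 1) (hi : iIndepFun T μ) (hiX : iIndepFun X μ)
    (hTX : IndepFun (fun ω n => T n ω) (fun ω n => X n ω) μ)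
    {ν : Measure ℕ} (hν : ∀ n, μ.map (X n) = ν)
    {g : ℝ → ℕ → ℂ} {M : ℝ} (hg : ∀ k, Measurable fun u => g u k) (hgb : ∀ u k, ‖g u k‖ ≤ 1)
    (hM : ∀ u k, M < u → g u k = 1) (hm : Measurable fun u => ∫ k, g u k ∂ν)
    {D : Set ℝ} (hD : D.Countable)
    (hc : ∀ u, u ∉ D → ContinuousAt (fun u => ∫ k, g u k ∂ν) u) (n : ℕ) :
    ∫ ω, survivalFactor (fun u => ∫ k, g u k ∂ν) M (∑ i ∈ Finset.range n, T i ω) *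
      ∏ i ∈ Finset.range n, g (throwTime T i ω) (X i ω) ∂μ =
      survivalFactor (fun u => ∫ k, g u k ∂ν) M 0 := by
  have hνp : IsProbabilityMeasure ν := by
    rw [← hν 0]; exact Measure.isProbabilityMeasure_map (hX 0).aemeasurable
  set h : ℝ → ℂ := fun u => ∫ k, g u k ∂ν with hh
  have hb : ∀ u, ‖h u‖ ≤ 1 := fun u => by
    have := norm_integral_le_of_norm_le_const (μ := ν) (ae_of_all _ (hgb u))
    simpa using this
  have hM' : ∀ u, M < u → h u = 1 := fun u hu => by simp [hh, hM u _ hu]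
  have hFm : Measurable (survivalFactor h M) := (continuous_survivalFactor hm hb).measurable
  have hFb := norm_survivalFactor_le hm hb hM'
  have hg2 : Measurable fun q : ℝ × ℕ => g q.1 q.2 := measurable_from_prod_countable_left hg
  have hTm : Measurable fun ω n => T n ω := measurable_pi_lambda _ hT
  have hXm : Measurable fun ω n => X n ω := measurable_pi_lambda _ hX
  have hmap := (indepFun_iff_map_prod_eq_prod_map_map hTm.aemeasurable hXm.aemeasurable).1 hTX
  let f : (ℕ → ℝ) × (ℕ → ℕ) → ℂ := fun q =>
    survivalFactor h M (∑ i ∈ Finset.range n, q.1 i) *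
      ∏ i ∈ Finset.range n, g (∑ l ∈ Finset.range (i + 1), q.1 l) (q.2 i)
  have hf : Measurable f := by
    refine (hFm.comp (by fun_prop)).mul (Finset.measurable_fun_prod _ fun i _ => ?_)
    have h1 : Measurable fun q : (ℕ → ℝ) × (ℕ → ℕ) =>
        ((∑ l ∈ Finset.range (i + 1), q.1 l, q.2 i) : ℝ × ℕ) :=
      Measurable.prodMk (Finset.measurable_fun_sum _ fun l _ => by fun_prop) (by fun_prop)
    exact hg2.comp h1
  have hfb : ∀ q, ‖f q‖ ≤ 1 := fun q => by
    simp only [f, norm_mul, norm_prod]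
    exact mul_le_one₀ (hFb _) (Finset.prod_nonneg fun _ _ => norm_nonneg _)
      (Finset.prod_le_one (fun _ _ => norm_nonneg _) fun _ _ => hgb _ _)
  have : IsProbabilityMeasure (μ.map fun ω n => T n ω) :=
    Measure.isProbabilityMeasure_map hTm.aemeasurable
  have : IsProbabilityMeasure (μ.map fun ω n => X n ω) :=
    Measure.isProbabilityMeasure_map hXm.aemeasurable
  have hinner : ∀ τ : ℕ → ℝ, ∫ x, f (τ, x) ∂(μ.map fun ω n => X n ω) =
      survivalFactor h M (∑ i ∈ Finset.range n, τ i) *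
        ∏ i ∈ Finset.range n, h (∑ l ∈ Finset.range (i + 1), τ l) := by
    intro τ
    rw [integral_map hXm.aemeasurable (f := fun x => f (τ, x))
      (hf.comp measurable_prodMk_left).aestronglyMeasurable]
    simp only [f]
    rw [integral_const_mul]
    congr 1
    have h1 : ∀ i : Fin n, Measurable fun k : ℕ => g (∑ l ∈ Finset.range ((i : ℕ) + 1), τ l) k :=
      fun i => measurable_from_top
    have h2 : iIndepFun
        (fun (i : Fin n) ω => g (∑ l ∈ Finset.range ((i : ℕ) + 1), τ l) (X i ω)) μ :=
      (hiX.precomp Fin.val_injective).comp _ h1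
    have h3 := h2.integral_fun_prod_eq_prod_integral
      (fun i => ((h1 i).comp (hX i)).aestronglyMeasurable)
    simp only [Finset.prod_range]
    rw [h3]
    refine Finset.prod_congr rfl fun i _ => ?_
    have h4 := integral_map (hX i).aemeasurable (h1 i).aestronglyMeasurable (μ := μ)
    rw [← h4, hν i]
  have h1 : ∫ ω, survivalFactor h M (∑ i ∈ Finset.range n, T i ω) *
      ∏ i ∈ Finset.range n, g (throwTime T i ω) (X i ω) ∂μ =
      ∫ q, f q ∂(μ.map fun ω => ((fun n => T n ω), fun n => X n ω)) := by
    rw [integral_map (hTm.prodMk hXm).aemeasurable hf.aestronglyMeasurable]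
    rfl
  rw [h1, hmap, integral_prod _ (Integrable.of_bound hf.aestronglyMeasurable 1 (ae_of_all _ hfb))]
  simp only [hinner]
  rw [integral_map hTm.aemeasurable]
  · exact integral_survivalFactor_mul_prod hT hl hi hm hb hM' hD hc n
  · refine Measurable.aestronglyMeasurable
      ((hFm.comp (by fun_prop)).mul (Finset.measurable_fun_prod _ fun i _ => ?_))
    exact hm.comp (Finset.measurable_fun_sum _ fun l _ => by fun_prop)

end Karlin

/-! ### Thinning: box counts are independent and Poisson -/

namespace Karlin

variable {Ω : Type*} [MeasurableSpace Ω] {μ : Measure Ω} {T : ℕ → Ω → ℝ} {X : ℕ → Ω → ℕ}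
  {p : ℕ → ℝ}

theorem ballSet_eq_filter {Ω : Type*} {T : ℕ → Ω → ℝ} {X : ℕ → Ω → ℕ}
    {k n : ℕ} {t : ℝ} {ω : Ω} (hn : ∀ i, n ≤ i → t < throwTime T i ω) :
    {i : ℕ | throwTime T i ω ≤ t ∧ X i ω = k} =
      ((Finset.range n).filter fun i => throwTime T i ω ≤ t ∧ X i ω = k : Finset ℕ) := by
  ext i
  simp only [Set.mem_ofPred_eq, Finset.coe_filter, Finset.mem_range]
  refine ⟨fun h => ⟨?_, h⟩, fun h => h.2⟩
  by_contra hin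
  exact absurd h.1 (not_le.2 (hn i (not_lt.1 hin)))

/-- Once no later ball is thrown by time `t`, the count is a finite one. -/
theorem boxCount_eq_card {Ω : Type*} {T : ℕ → Ω → ℝ} {X : ℕ → Ω → ℕ}
    {k n : ℕ} {t : ℝ} {ω : Ω} (hn : ∀ i, n ≤ i → t < throwTime T i ω) :
    boxCount T X k t ω =
      ((Finset.range n).filter fun i => throwTime T i ω ≤ t ∧ X i ω = k).card := by
  rw [boxCount, ballCount, ballSet_eq_filter hn, Set.encard_coe_eq_coe_finsetCard]
  simp

/-- The contribution `∑ₗ aₗ 1{u ≤ sₗ}` of a ball thrown at time `u` to `∑ₗ aₗ N(sₗ)`. -/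
noncomputable def phase (a s : Fin 2 → ℝ) (u : ℝ) : ℝ := ∑ l, a l * if u ≤ s l then 1 else 0

theorem measurable_phase (a s : Fin 2 → ℝ) : Measurable (phase a s) :=
  Finset.measurable_fun_sum _ fun _ _ => measurable_const.mul
    (Measurable.ite (measurableSet_le measurable_id measurable_const) measurable_const
      measurable_const)

theorem continuousAt_phase (a s : Fin 2 → ℝ) {u : ℝ} (hu : ∀ l, u ≠ s l) :
    ContinuousAt (phase a s) u := by
  refine tendsto_finsetSum _ fun l _ => ContinuousAt.mul continuousAt_const ?_
  rcases lt_or_gt_of_ne (hu l) with h | h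
  · refine continuousAt_const.congr (f := fun _ => (1 : ℝ)) ?_
    filter_upwards [Iio_mem_nhds h] with v hv
    simp [le_of_lt (Set.mem_Iio.1 hv)]
  · refine continuousAt_const.congr (f := fun _ => (0 : ℝ)) ?_
    filter_upwards [Ioi_mem_nhds h] with v hv
    simp [Set.mem_Ioi.1 hv]

theorem phase_of_lt {a s : Fin 2 → ℝ} {M u : ℝ} (hs : ∀ l, s l ≤ M) (hu : M < u) :
    phase a s u = 0 := by
  refine Finset.sum_eq_zero fun l _ => ?_
  simp [not_le.2 ((hs l).trans_lt hu)]

theorem IsPoissonizedScheme.map_X_eq (h : IsPoissonizedScheme p μ T X) (n : ℕ) :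
    μ.map (X n) = μ.map (X 0) := by
  refine Measure.ext_of_singleton fun k => ?_
  rw [Measure.map_apply (h.measurable_X n) (measurableSet_singleton k),
    Measure.map_apply (h.measurable_X 0) (measurableSet_singleton k)]
  exact (h.law_X n k).trans (h.law_X 0 k).symm

/-- The mean over the box hit by a ball of a factor which is `1` for boxes outside `K`. -/
theorem integral_mark (hp : IsBoxDistribution p) (h : IsPoissonizedScheme p μ T X)
    [IsProbabilityMeasure μ] (K : Finset ℕ) (e : ℕ → ℂ) :
    ∫ k, (if k ∈ K then e k else 1) ∂(μ.map (X 0)) = 1 - ∑ k ∈ K, (p k : ℂ) * (1 - e k) := by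
  have : IsProbabilityMeasure (μ.map (X 0)) :=
    Measure.isProbabilityMeasure_map (h.measurable_X 0).aemeasurable
  have h1 : (fun k => if k ∈ K then e k else 1) =
      fun k => 1 - ∑ k' ∈ K, Set.indicator {k'} (fun _ => 1 - e k') k := by
    ext k
    by_cases hk : k ∈ K
    · rw [Finset.sum_eq_single k]
      · simp [hk]
      · intro b _ hb
        simp [hb.symm]
      · exact fun hk' => absurd hk hk'
    · rw [Finset.sum_eq_zero]
      · simp [hk]
      · intro b hb
        have : k ≠ b := fun hkb => hk (hkb ▸ hb)
        simp [this]
  have h2 : ∀ k' ∈ K, Integrable (Set.indicator {k'} (fun _ => 1 - e k')) (μ.map (X 0)) :=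
    fun k' _ => (integrable_const _).indicator (measurableSet_singleton k')
  rw [h1, integral_sub (integrable_const _) (integrable_finsetSum _ h2), integral_finsetSum _ h2]
  simp only [integral_const, probReal_univ, one_smul]
  congr 1
  refine Finset.sum_congr rfl fun k _ => ?_
  rw [integral_indicator_const _ (measurableSet_singleton k), measureReal_def,
    Measure.map_apply (h.measurable_X 0) (measurableSet_singleton k)]
  have h3 : μ (X 0 ⁻¹' {k}) = ENNReal.ofReal (p k) := h.law_X 0 k
  rw [h3, ENNReal.toReal_ofReal (hp.nonneg k), Complex.real_smul]

/-- The exponential of a linear combination of box counts is a product over the balls of factors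
which depend only on the time and the box of the ball. -/
theorem prod_mark_eq_cexp {Ω : Type*} {T : ℕ → Ω → ℝ} {X : ℕ → Ω → ℕ}
    {n : ℕ} {ω : Ω} (K : Finset ℕ) (a s : ℕ → Fin 2 → ℝ) {M : ℝ}
    (hs : ∀ k ∈ K, ∀ l, s k l ≤ M) (hn : ∀ i, n ≤ i → M < throwTime T i ω) :
    ∏ i ∈ Finset.range n, (if X i ω ∈ K then
        Complex.exp (Complex.I * phase (a (X i ω)) (s (X i ω)) (throwTime T i ω)) else 1) =
      Complex.exp (Complex.I *
        ∑ k ∈ K, ∑ l, ((a k l * boxCount T X k (s k l) ω : ℝ) : ℂ)) := by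
  have h1 : ∀ i, (if X i ω ∈ K then
        Complex.exp (Complex.I * phase (a (X i ω)) (s (X i ω)) (throwTime T i ω)) else 1) =
      Complex.exp (Complex.I *
        ((∑ k ∈ K, if X i ω = k then phase (a k) (s k) (throwTime T i ω) else 0 : ℝ) : ℂ)) := by
    intro i
    by_cases hk : X i ω ∈ K
    · simp [hk]
    · simp [hk]
  simp only [h1, ← Complex.exp_sum, ← Finset.mul_sum]
  congr 2
  rw [← Complex.ofReal_sum, Finset.sum_comm, Complex.ofReal_sum]
  refine Finset.sum_congr rfl fun k hk => ?_
  rw [← Complex.ofReal_sum]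
  congr 1
  have h2 : ∀ i, (if X i ω = k then phase (a k) (s k) (throwTime T i ω) else 0) =
      ∑ l, a k l * if throwTime T i ω ≤ s k l ∧ X i ω = k then 1 else 0 := by
    intro i
    by_cases hX : X i ω = k <;> simp [hX, phase]
  simp only [h2]
  rw [Finset.sum_comm]
  refine Finset.sum_congr rfl fun l _ => ?_
  rw [← Finset.mul_sum, boxCount_eq_card (fun i hi => (hs k hk l).trans_lt (hn i hi)),
    Finset.sum_boole]

/-- The joint characteristic function of the counts of finitely many boxes, each at two times. It is
a product over the boxes. -/
theorem integral_cexp_boxCount (hp : IsBoxDistribution p) (h : IsPoissonizedScheme p μ T X)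
    [IsProbabilityMeasure μ] (K : Finset ℕ) (a s : ℕ → Fin 2 → ℝ) {M : ℝ}
    (hs : ∀ k ∈ K, ∀ l, s k l ≤ M) :
    ∫ ω, Complex.exp (Complex.I *
        ∑ k ∈ K, ∑ l, ((a k l * boxCount T X k (s k l) ω : ℝ) : ℂ)) ∂μ =
      ∏ k ∈ K, Complex.exp (-(p k *
        ∫ u in (0 : ℝ)..M, (1 - Complex.exp (Complex.I * phase (a k) (s k) u)))) := by
  set e : ℕ → ℝ → ℂ := fun k u => Complex.exp (Complex.I * phase (a k) (s k) u) with he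
  let g : ℝ → ℕ → ℂ := fun u k => if k ∈ K then e k u else 1
  set ν := μ.map (X 0) with hν
  have hem : ∀ k, Measurable (e k) := fun k =>
    Complex.measurable_exp.comp (measurable_const.mul
      (Complex.measurable_ofReal.comp (measurable_phase _ _)))
  have heb : ∀ k u, ‖e k u‖ = 1 := fun k u => by
    simp only [he]
    rw [mul_comm, Complex.norm_exp_ofReal_mul_I]
  have hgm : ∀ k, Measurable fun u => g u k := by
    intro k
    by_cases hk : k ∈ K
    · simpa [g, hk] using hem k
    · simp [g, hk]
  have hgb : ∀ u k, ‖g u k‖ ≤ 1 := by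
    intro u k
    by_cases hk : k ∈ K
    · simp [g, hk, heb]
    · simp [g, hk]
  have hgM : ∀ u k, M < u → g u k = 1 := by
    intro u k hu
    by_cases hk : k ∈ K
    · simp [g, hk, he, phase_of_lt (hs k hk) hu]
    · simp [g, hk]
  have hmean : ∀ u, ∫ k, g u k ∂ν = 1 - ∑ k ∈ K, (p k : ℂ) * (1 - e k u) := fun u =>
    integral_mark hp h K fun k => e k u
  have hhm : Measurable fun u => ∫ k, g u k ∂ν := by
    simp only [hmean]
    exact measurable_const.sub (Finset.measurable_fun_sum _ fun k _ =>
      measurable_const.mul (measurable_const.sub (hem k)))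
  have hD : (⋃ k ∈ K, ⋃ l, {s k l}).Countable :=
    (K.countable_toSet.biUnion fun k _ => Set.countable_iUnion fun _ => Set.countable_singleton _)
  have hc : ∀ u, u ∉ (⋃ k ∈ K, ⋃ l, {s k l}) → ContinuousAt (fun u => ∫ k, g u k ∂ν) u := by
    intro u hu
    simp only [Set.mem_iUnion, Set.mem_singleton_iff, exists_prop, not_exists, not_and] at hu
    simp only [hmean]
    refine continuousAt_const.sub (tendsto_finsetSum _ fun k hk => ?_)
    refine ContinuousAt.mul continuousAt_const (continuousAt_const.sub ?_)
    exact (Complex.continuous_exp.continuousAt).comp (continuousAt_const.mul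
      (Complex.continuous_ofReal.continuousAt.comp
        (continuousAt_phase _ _ (fun l => hu k hk l))))
  have hstep := integral_survivalFactor_mul_prod_marks h.measurable_T h.measurable_X h.law_T
    h.indep_T h.indep_X h.indep_T_X (ν := ν) h.map_X_eq hgm hgb hgM hhm hD hc
  have hhb : ∀ u, ‖∫ k, g u k ∂ν‖ ≤ 1 := fun u => by
    have : IsProbabilityMeasure ν :=
      Measure.isProbabilityMeasure_map (h.measurable_X 0).aemeasurable
    have := norm_integral_le_of_norm_le_const (μ := ν) (ae_of_all _ (hgb u))
    simpa using this
  have hhM : ∀ u, M < u → ∫ k, g u k ∂ν = 1 := fun u hu => by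
    have : IsProbabilityMeasure ν :=
      Measure.isProbabilityMeasure_map (h.measurable_X 0).aemeasurable
    simp [hgM u _ hu]
  have hFm := (continuous_survivalFactor (M := M) hhm hhb).measurable
  have hFb := norm_survivalFactor_le hhm hhb hhM
  have hg2 : Measurable fun q : ℝ × ℕ => g q.1 q.2 := measurable_from_prod_countable_left hgm
  -- After finitely many balls the product is complete and the survival factor is `1`; the means
  -- are constant in the number of balls by the martingale identity.
  have hlim : Tendsto (fun n => ∫ ω, survivalFactor (fun u => ∫ k, g u k ∂ν) M
      (∑ i ∈ Finset.range n, T i ω) * ∏ i ∈ Finset.range n, g (throwTime T i ω) (X i ω) ∂μ) atTop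
      (𝓝 (∫ ω, Complex.exp (Complex.I *
        ∑ k ∈ K, ∑ l, ((a k l * boxCount T X k (s k l) ω : ℝ) : ℂ)) ∂μ)) := by
    refine tendsto_integral_of_dominated_convergence (fun _ => (1 : ℝ)) (fun n => ?_)
      (integrable_const _) (fun n => ae_of_all _ fun ω => ?_) ?_
    · refine Measurable.aestronglyMeasurable ((hFm.comp (Finset.measurable_fun_sum _ fun i _ =>
        h.measurable_T i)).mul (Finset.measurable_fun_prod _ fun i _ => ?_))
      exact hg2.comp ((measurable_throwTime h.measurable_T i).prodMk (h.measurable_X i))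
    · simp only [norm_mul, norm_prod]
      exact mul_le_one₀ (hFb _) (Finset.prod_nonneg fun _ _ => norm_nonneg _)
        (Finset.prod_le_one (fun _ _ => norm_nonneg _) fun _ _ => hgb _ _)
    · filter_upwards [ae_tendsto_sum h.measurable_T h.law_T h.indep_T] with ω hω
      obtain ⟨n₀, hn₀⟩ := eventually_atTop.1 (hω.eventually_gt_atTop M)
      refine tendsto_const_nhds.congr' ?_
      filter_upwards [eventually_ge_atTop n₀] with n hn
      rw [survivalFactor_of_le hhM (hn₀ n hn).le, one_mul]
      exact (prod_mark_eq_cexp K a s hs fun i hi => hn₀ (i + 1) (by omega)).symm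
  simp only [hstep] at hlim
  rw [tendsto_nhds_unique hlim tendsto_const_nhds, survivalFactor, ← Complex.exp_sum]
  congr 1
  simp only [hmean, sub_sub_cancel]
  rw [Finset.sum_neg_distrib, intervalIntegral.integral_finsetSum]
  · simp only [intervalIntegral.integral_const_mul, he]
  · intro k _
    exact (intervalIntegrable_one_sub (hem k) (fun u => (heb k u).le) 0 M).const_mul _

/-- The box counts, each observed at two times of its own, are independent. -/
theorem IsPoissonizedScheme.iIndepFun_boxCount (hp : IsBoxDistribution p)
    (h : IsPoissonizedScheme p μ T X) [IsProbabilityMeasure μ] (s t : ℕ → ℝ) :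
    iIndepFun (fun k ω => (boxCount T X k (s k) ω, boxCount T X k (t k) ω)) μ := by
  let r : ℕ → Fin 2 → ℝ := fun k => ![s k, t k]
  let Y : ℕ → Ω → EuclideanSpace ℝ (Fin 2) := fun k ω =>
    WithLp.toLp 2 fun l => (boxCount T X k (r k l) ω : ℝ)
  have hNm : ∀ k u, Measurable fun ω => (boxCount T X k u ω : ℝ) := fun k u =>
    measurable_from_top.comp (measurable_boxCount h.measurable_T h.measurable_X k u)
  have hYm : ∀ k, Measurable (Y k) := fun k =>
    (WithLp.measurable_toLp 2 _).comp (measurable_pi_lambda _ fun l => hNm k _)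
  have hY : iIndepFun Y μ := by
    rw [iIndepFun_iff_finset]
    intro K
    rw [iIndepFun_iff_charFun_pi (X := K.restrict Y) (fun i => (hYm i).aemeasurable)]
    intro b
    let a : ℕ → Fin 2 → ℝ := fun k l => if hk : k ∈ K then b ⟨k, hk⟩ l else 0
    obtain ⟨M, hM⟩ : ∃ M : ℝ, ∀ k ∈ K, ∀ l, r k l ≤ M := by
      refine ⟨∑ k ∈ K, ∑ l, |r k l|, fun k hk l => (le_abs_self _).trans ?_⟩
      refine (Finset.single_le_sum (f := fun l => |r k l|) (fun _ _ => abs_nonneg _)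
        (Finset.mem_univ l)).trans ?_
      exact Finset.single_le_sum (f := fun k => ∑ l, |r k l|)
        (fun _ _ => Finset.sum_nonneg fun _ _ => abs_nonneg _) hk
    have hZm : Measurable fun ω => WithLp.toLp 2 (fun i : K => K.restrict Y i ω) :=
      (WithLp.measurable_toLp 2 _).comp (measurable_pi_lambda _ fun i => hYm i)
    rw [charFun_apply, integral_map hZm.aemeasurable (by fun_prop)]
    have h1 : ∀ i : K, charFun (μ.map (K.restrict Y i)) (b i) = Complex.exp (-(p i *
        ∫ u in (0 : ℝ)..M, (1 - Complex.exp (Complex.I * phase (a i) (r i) u)))) := by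
      intro i
      change charFun (μ.map (Y i)) (b i) = _
      rw [charFun_apply, integral_map (hYm i).aemeasurable (by fun_prop)]
      have h2 := integral_cexp_boxCount hp h {(i : ℕ)} a r (M := M)
        (fun k hk l => hM k (by rw [Finset.mem_singleton.1 hk]; exact i.2) l)
      rw [Finset.prod_singleton] at h2
      rw [← h2]
      congr 1
      ext ω
      rw [mul_comm]
      congr 2
      simp [Y, a, PiLp.inner_apply]
    simp only [h1]
    have h3 := integral_cexp_boxCount hp h K a r hM
    rw [Finset.prod_coe_sort K fun k => Complex.exp (-(p k *
        ∫ u in (0 : ℝ)..M, (1 - Complex.exp (Complex.I * phase (a k) (r k) u)))), ← h3]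
    congr 1
    ext ω
    rw [mul_comm]
    congr 2
    rw [← Finset.sum_coe_sort K]
    simp [Y, a, PiLp.inner_apply]
  -- The integer counts are recovered from their real coordinates by taking integer parts.
  have h4 : Measurable fun x : EuclideanSpace ℝ (Fin 2) => (⌊x 0⌋₊, ⌊x 1⌋₊) :=
    (Nat.measurable_floor.comp (by fun_prop)).prodMk (Nat.measurable_floor.comp (by fun_prop))
  have h5 := hY.comp (fun _ => fun x : EuclideanSpace ℝ (Fin 2) => (⌊x 0⌋₊, ⌊x 1⌋₊))
    (fun _ => h4)
  convert h5 using 2 with k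
  ext1 ω
  simp [Y, r]

/-- Thinning: the number of balls in box `k` at time `t` is Poisson with mean `p k * t`. -/
theorem IsPoissonizedScheme.map_boxCount (hp : IsBoxDistribution p)
    (h : IsPoissonizedScheme p μ T X) [IsProbabilityMeasure μ] (k : ℕ) {t : ℝ} (ht : 0 ≤ t) :
    μ.map (boxCount T X k t) = poissonMeasure (p k * t).toNNReal := by
  have hm := measurable_boxCount h.measurable_T h.measurable_X k t
  have hNm : Measurable fun ω => (boxCount T X k t ω : ℝ) := measurable_from_top.comp hm
  have hreal : μ.map (fun ω => (boxCount T X k t ω : ℝ)) =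
      (poissonMeasure (p k * t).toNNReal).map (fun n : ℕ => (n : ℝ)) := by
    have : IsProbabilityMeasure (μ.map (fun ω => (boxCount T X k t ω : ℝ))) :=
      Measure.isProbabilityMeasure_map hNm.aemeasurable
    refine Measure.ext_of_charFun ?_
    ext b
    rw [charFun_map_cast_poissonMeasure, charFun_apply,
      integral_map hNm.aemeasurable (by fun_prop)]
    have h2 := integral_cexp_boxCount hp h {k} (fun _ => ![b, 0]) (fun _ _ => t) (M := t)
      (fun _ _ _ => le_rfl)
    rw [Finset.prod_singleton] at h2
    have h3 : ∫ u in (0 : ℝ)..t,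
        (1 - Complex.exp (Complex.I * phase ![b, 0] (fun _ => t) u)) =
        ∫ u in (0 : ℝ)..t, (1 - Complex.exp (Complex.I * b)) := by
      refine intervalIntegral.integral_congr fun u hu => ?_
      rw [Set.uIcc_of_le ht] at hu
      simp [phase, hu.2]
    rw [h3, intervalIntegral.integral_const, sub_zero] at h2
    have h4 : ((p k * t).toNNReal : ℂ) = p k * t := by
      rw [← Complex.ofReal_mul, ← Real.coe_toNNReal _ (mul_nonneg (hp.nonneg k) ht)]
      simp
    rw [h4]
    convert h2 using 1
    · congr 1
      ext ω
      simp [mul_comm]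
    · rw [Complex.real_smul, mul_comm (b : ℂ)]
      congr 1
      ring
  have h6 : (μ.map (fun ω => (boxCount T X k t ω : ℝ))).map (fun x : ℝ => ⌊x⌋₊) =
      ((poissonMeasure (p k * t).toNNReal).map (fun n : ℕ => (n : ℝ))).map
        (fun x : ℝ => ⌊x⌋₊) := by rw [hreal]
  rw [Measure.map_map Nat.measurable_floor hNm,
    Measure.map_map Nat.measurable_floor measurable_from_top] at h6
  have h7 : ((fun x : ℝ => ⌊x⌋₊) ∘ fun n : ℕ => (n : ℝ)) = id := by ext n; simp
  have h8 : ((fun x : ℝ => ⌊x⌋₊) ∘ fun ω => (boxCount T X k t ω : ℝ)) = boxCount T X k t := by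
    ext ω; simp
  rwa [h7, h8, Measure.map_id] at h6

/-- The probability `e⁻ˣ xⁱ / i!` that a Poisson variable with mean `x` equals `i`. -/
noncomputable def poissonWeight (i : ℕ) (x : ℝ) : ℝ := Real.exp (-x) * x ^ i / i !

theorem IsPoissonizedScheme.measureReal_boxCount_eq (hp : IsBoxDistribution p)
    (h : IsPoissonizedScheme p μ T X) [IsProbabilityMeasure μ] (k i : ℕ) {t : ℝ} (ht : 0 ≤ t) :
    μ.real {ω | boxCount T X k t ω = i} = poissonWeight i (p k * t) := by
  have hm := measurable_boxCount h.measurable_T h.measurable_X k t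
  have h1 : μ.real {ω | boxCount T X k t ω = i} = (μ.map (boxCount T X k t)).real {i} := by
    rw [map_measureReal_apply hm (measurableSet_singleton i)]
    rfl
  rw [h1, h.map_boxCount hp k ht, poissonMeasure_real_singleton, poissonWeight,
    Real.coe_toNNReal _ (mul_nonneg (hp.nonneg k) ht)]

end Karlin

/-! ### Moment generating functions and the lower exponential bound -/

namespace Karlin

variable {Ω : Type*} [MeasurableSpace Ω] {μ : Measure Ω}

section MomentGeneratingFunction

theorem exp_bounds {x : ℝ} (hx : |x| ≤ 1) :
    1 + x + x ^ 2 / 2 * (1 - |x|) ≤ Real.exp x ∧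
      Real.exp x ≤ 1 + x + x ^ 2 / 2 * (1 + |x|) := by
  have h := Real.exp_bound hx (n := 3) (by norm_num)
  norm_num [Finset.sum_range_succ, Nat.factorial] at h
  rw [abs_le] at h
  have h3 : |x| ^ 3 = x ^ 2 * |x| := by rw [pow_succ, sq_abs]
  have h4 : 0 ≤ x ^ 2 * |x| := by positivity
  constructor <;> nlinarith

theorem exp_sub_sq_le {u : ℝ} (hu : 0 ≤ u) : Real.exp (u - u ^ 2) ≤ 1 + u := by
  have h1 : 0 < 1 - (u - u ^ 2) := by nlinarith [sq_nonneg (u - 1 / 2)]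
  have h2 : 1 - (u - u ^ 2) ≤ Real.exp (-(u - u ^ 2)) := by
    linarith [Real.add_one_le_exp (-(u - u ^ 2))]
  have h3 : Real.exp (u - u ^ 2) * Real.exp (-(u - u ^ 2)) = 1 := by
    rw [← Real.exp_add]; simp
  have h4 : Real.exp (u - u ^ 2) * (1 - (u - u ^ 2)) ≤ 1 :=
    (mul_le_mul_of_nonneg_left h2 (Real.exp_nonneg _)).trans_eq h3
  have h5 : (1 + u) * (1 - (u - u ^ 2)) = 1 + u ^ 3 := by ring
  have h6 : 0 ≤ u ^ 3 := by positivity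
  by_contra h
  push Not at h
  nlinarith

variable [IsProbabilityMeasure μ]

theorem integrable_exp_mul_of_bounded {Y : Ω → ℝ} (hm : Measurable Y) (hb : ∀ ω, |Y ω| ≤ 1)
    (t : ℝ) : Integrable (fun ω => Real.exp (t * Y ω)) μ := by
  refine Integrable.of_bound (by fun_prop) (Real.exp |t|) (ae_of_all _ fun ω => ?_)
  rw [Real.norm_of_nonneg (Real.exp_nonneg _), Real.exp_le_exp]
  refine (le_abs_self _).trans ?_
  rw [abs_mul]
  exact mul_le_of_le_one_right (abs_nonneg _) (hb ω)

/-- The moment generating function of a centred variable bounded by one is close to that of a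
Gaussian variable with the same variance. -/
theorem mgf_bounds {Y : Ω → ℝ} (hm : Measurable Y) (hb : ∀ ω, |Y ω| ≤ 1)
    (h0 : ∫ ω, Y ω ∂μ = 0) {t : ℝ} (ht : |t| ≤ 1) :
    Real.exp (t ^ 2 * (1 - 2 * |t|) * variance Y μ / 2) ≤ mgf Y μ t ∧
      mgf Y μ t ≤ Real.exp (t ^ 2 * (1 + |t|) * variance Y μ / 2) := by
  have hYi : Integrable Y μ := Integrable.of_bound hm.aestronglyMeasurable 1
    (ae_of_all _ fun ω => by simpa using hb ω)
  have hsq : ∀ ω, Y ω ^ 2 ≤ 1 := fun ω => by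
    rw [← sq_abs]; exact pow_le_one₀ (abs_nonneg _) (hb ω)
  have hYi2 : Integrable (fun ω => Y ω ^ 2) μ := Integrable.of_bound
    (hm.pow_const 2).aestronglyMeasurable 1 (ae_of_all _ fun ω => by
      rw [Real.norm_of_nonneg (sq_nonneg _)]; exact hsq ω)
  have hvar : variance Y μ = ∫ ω, Y ω ^ 2 ∂μ := variance_of_integral_eq_zero hm.aemeasurable h0
  have hv0 : 0 ≤ variance Y μ := variance_nonneg _ _
  have hv1 : variance Y μ ≤ 1 := by
    rw [hvar]
    calc ∫ ω, Y ω ^ 2 ∂μ ≤ ∫ _, (1 : ℝ) ∂μ := integral_mono hYi2 (integrable_const _) hsq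
      _ = 1 := by simp
  have hval : ∀ c : ℝ, ∫ ω, (1 + t * Y ω + c * Y ω ^ 2) ∂μ = 1 + c * variance Y μ := by
    intro c
    have h1 : Integrable (fun ω => 1 + t * Y ω) μ := (integrable_const _).add (hYi.const_mul t)
    rw [integral_add h1 (hYi2.const_mul c),
      integral_add (integrable_const _) (hYi.const_mul t), integral_const_mul,
      integral_const_mul, h0, hvar]
    simp
  have hint : ∀ c : ℝ, Integrable (fun ω => 1 + t * Y ω + c * Y ω ^ 2) μ := fun c =>
    ((integrable_const _).add (hYi.const_mul t)).add (hYi2.const_mul c)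
  have htY : ∀ ω, |t * Y ω| ≤ |t| := fun ω => by
    rw [abs_mul]; exact mul_le_of_le_one_right (abs_nonneg _) (hb ω)
  have ht0 := abs_nonneg t
  constructor
  · set u := t ^ 2 / 2 * (1 - |t|) * variance Y μ with hu
    have hu0 : 0 ≤ u := by
      have : 0 ≤ 1 - |t| := by linarith
      positivity
    have hsqt : t ^ 2 ≤ |t| := by
      rw [← sq_abs]; nlinarith
    have hut : u ≤ |t| := by
      have h1 : t ^ 2 / 2 * (1 - |t|) ≤ |t| := by nlinarith [sq_nonneg t]
      calc u ≤ |t| * variance Y μ := by rw [hu]; gcongr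
        _ ≤ |t| := mul_le_of_le_one_right ht0 hv1
    calc Real.exp (t ^ 2 * (1 - 2 * |t|) * variance Y μ / 2) ≤ Real.exp (u - u ^ 2) := by
          rw [Real.exp_le_exp]
          have h2 : u * (1 - |t|) ≤ u - u ^ 2 := by nlinarith
          have h3 : t ^ 2 * (1 - 2 * |t|) * variance Y μ / 2 ≤ u * (1 - |t|) := by
            rw [hu]
            have : 0 ≤ t ^ 2 * variance Y μ := by positivity
            nlinarith [sq_nonneg |t|, mul_nonneg this (sq_nonneg |t|)]
          exact h3.trans h2
      _ ≤ 1 + u := exp_sub_sq_le hu0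
      _ = ∫ ω, (1 + t * Y ω + t ^ 2 / 2 * (1 - |t|) * Y ω ^ 2) ∂μ := by rw [hval]
      _ ≤ mgf Y μ t := by
          refine integral_mono (hint _) (integrable_exp_mul_of_bounded hm hb t) fun ω => ?_
          have h1 := (exp_bounds ((htY ω).trans ht)).1
          have h2 : 0 ≤ t ^ 2 * Y ω ^ 2 := by positivity
          have h3 := htY ω
          rw [mul_pow] at h1
          nlinarith
  · calc mgf Y μ t ≤ ∫ ω, (1 + t * Y ω + t ^ 2 / 2 * (1 + |t|) * Y ω ^ 2) ∂μ := by
          refine integral_mono (integrable_exp_mul_of_bounded hm hb t) (hint _) fun ω => ?_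
          have h1 := (exp_bounds ((htY ω).trans ht)).2
          have h2 : 0 ≤ t ^ 2 * Y ω ^ 2 := by positivity
          have h3 := htY ω
          rw [mul_pow] at h1
          nlinarith
      _ = t ^ 2 * (1 + |t|) * variance Y μ / 2 + 1 := by rw [hval]; ring
      _ ≤ _ := Real.add_one_le_exp _

theorem mgf_sum_bounds {ι : Type*} {Y : ι → Ω → ℝ} (hind : iIndepFun Y μ)
    (hm : ∀ k, Measurable (Y k))
    (hb : ∀ k ω, |Y k ω| ≤ 1) (h0 : ∀ k, ∫ ω, Y k ω ∂μ = 0) (s : Finset ι) {t : ℝ}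
    (ht : |t| ≤ 1) :
    Real.exp (t ^ 2 * (1 - 2 * |t|) * (∑ k ∈ s, variance (Y k) μ) / 2) ≤ mgf (∑ k ∈ s, Y k) μ t ∧
      mgf (∑ k ∈ s, Y k) μ t ≤
        Real.exp (t ^ 2 * (1 + |t|) * (∑ k ∈ s, variance (Y k) μ) / 2) := by
  rw [hind.mgf_sum hm, Finset.mul_sum, Finset.mul_sum, Finset.sum_div, Finset.sum_div,
    Real.exp_sum, Real.exp_sum]
  exact ⟨Finset.prod_le_prod (fun _ _ => Real.exp_nonneg _)
      fun k _ => (mgf_bounds (hm k) (hb k) (h0 k) ht).1,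
    Finset.prod_le_prod (fun _ _ => mgf_nonneg)
      fun k _ => (mgf_bounds (hm k) (hb k) (h0 k) ht).2⟩

end MomentGeneratingFunction

section LowerTail

variable [IsProbabilityMeasure μ]

/-- Kolmogorov's lower exponential bound for one value of the tilting parameter `t`: if the moment
generating function of `S` is close to that of a centred Gaussian variable of variance `V`, then
`e^{tS}` puts at least half of its mass on `S ∈ [(1 - β) t V, (1 + β) t V]`. -/
theorem exp_le_measure_of_mgf_bounds {S : Ω → ℝ} (hS : Measurable S) {V t β : ℝ} (hV : 0 < V)
    (hint : ∀ u, Integrable (fun ω => Real.exp (u * S ω)) μ)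
    (hlow : ∀ u, |u| ≤ 1 → Real.exp (u ^ 2 * (1 - 2 * |u|) * V / 2) ≤ mgf S μ u)
    (hup : ∀ u, |u| ≤ 1 → mgf S μ u ≤ Real.exp (u ^ 2 * (1 + |u|) * V / 2))
    (hβ0 : 0 < β) (hβ1 : β ≤ 1) (ht0 : 0 < t) (htβ : 20 * t ≤ β ^ 2)
    (hA : 8 ≤ β ^ 2 * (t ^ 2 * V)) :
    Real.exp (-(t ^ 2 * V * (1 / 2 + β + t))) / 2 ≤ μ.real {ω | (1 - β) * t * V ≤ S ω} := by
  set A := t ^ 2 * V with hAdef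
  set x := (1 - β) * t * V with hx
  set b := (1 + β) * t * V with hbdef
  have hA0 : 0 < A := by positivity
  have hβ2 : β ^ 2 ≤ 1 := by nlinarith
  have ht1 : t ≤ 1 / 20 := by linarith
  have hGlow : Real.exp (A * (1 / 2 - t)) ≤ mgf S μ t := by
    have := hlow t (by rw [abs_of_pos ht0]; linarith)
    rw [abs_of_pos ht0] at this
    convert this using 2
    rw [hAdef]; ring
  -- The left-hand side will bound the mass of `exp (t S)` on `S < x`, and on `b < S`; the
  -- right-hand side is a quarter of the lower bound for the total mass.
  have hquart : Real.exp (A * (1 / 2 - β ^ 2 / 2 + 4 * t)) ≤ Real.exp (A * (1 / 2 - t)) / 4 := by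
    have h1 : Real.exp (A * (1 / 2 - β ^ 2 / 2 + 4 * t)) ≤
        Real.exp (A * (1 / 2 - t)) * Real.exp (-2) := by
      rw [← Real.exp_add, Real.exp_le_exp]
      nlinarith
    have h2 : Real.exp (-2) ≤ 1 / 4 := by
      rw [Real.exp_neg, one_div]
      apply inv_anti₀ (by norm_num)
      have : Real.exp 2 = Real.exp 1 * Real.exp 1 := by rw [← Real.exp_add]; norm_num
      have := Real.exp_one_gt_d9
      nlinarith
    calc _ ≤ _ := h1
      _ ≤ Real.exp (A * (1 / 2 - t)) * (1 / 4) := by gcongr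
      _ = _ := by ring
  have hI1 : ∫ ω in {ω | S ω < x}, Real.exp (t * S ω) ∂μ ≤ Real.exp (A * (1 / 2 - t)) / 4 := by
    have hu : |(1 - β) * t| ≤ 1 := by
      rw [abs_of_nonneg (by nlinarith)]; nlinarith
    have hms : MeasurableSet {ω | S ω < x} := measurableSet_lt hS measurable_const
    calc ∫ ω in {ω | S ω < x}, Real.exp (t * S ω) ∂μ
        ≤ ∫ ω in {ω | S ω < x}, Real.exp (β * t * x) * Real.exp ((1 - β) * t * S ω) ∂μ := by
          refine setIntegral_mono_on (hint t).integrableOn ((hint _).const_mul _).integrableOn hms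
            fun ω hω => ?_
          rw [← Real.exp_add, Real.exp_le_exp]
          have h1 : β * t * S ω ≤ β * t * x :=
            mul_le_mul_of_nonneg_left (le_of_lt hω) (by positivity)
          linarith
      _ ≤ ∫ ω, Real.exp (β * t * x) * Real.exp ((1 - β) * t * S ω) ∂μ :=
          setIntegral_le_integral ((hint _).const_mul _) (ae_of_all _ fun ω => by positivity)
      _ = Real.exp (β * t * x) * mgf S μ ((1 - β) * t) := by
          rw [integral_const_mul]; rfl
      _ ≤ Real.exp (β * t * x) * Real.exp (((1 - β) * t) ^ 2 * (1 + |(1 - β) * t|) * V / 2) := by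
          gcongr; exact hup _ hu
      _ ≤ Real.exp (A * (1 / 2 - β ^ 2 / 2 + 4 * t)) := by
          rw [← Real.exp_add, Real.exp_le_exp, abs_of_nonneg (by nlinarith), hx, hAdef]
          have h1 : β * t * ((1 - β) * t * V) +
              ((1 - β) * t) ^ 2 * (1 + (1 - β) * t) * V / 2 =
              t ^ 2 * V * (β * (1 - β) + (1 - β) ^ 2 / 2 + (1 - β) ^ 3 * t / 2) := by ring
          rw [h1]
          refine mul_le_mul_of_nonneg_left ?_ hA0.le
          have h2 : (1 - β) ^ 3 ≤ 1 := pow_le_one₀ (by linarith) (by linarith)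
          nlinarith
      _ ≤ _ := hquart
  have hI2 : ∫ ω in {ω | b < S ω}, Real.exp (t * S ω) ∂μ ≤ Real.exp (A * (1 / 2 - t)) / 4 := by
    have hu : |(1 + β) * t| ≤ 1 := by
      rw [abs_of_nonneg (by positivity)]; nlinarith
    have hms : MeasurableSet {ω | b < S ω} := measurableSet_lt measurable_const hS
    calc ∫ ω in {ω | b < S ω}, Real.exp (t * S ω) ∂μ
        ≤ ∫ ω in {ω | b < S ω}, Real.exp (-(β * t * b)) * Real.exp ((1 + β) * t * S ω) ∂μ := by
          refine setIntegral_mono_on (hint t).integrableOn ((hint _).const_mul _).integrableOn hms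
            fun ω hω => ?_
          rw [← Real.exp_add, Real.exp_le_exp]
          have h1 : β * t * b ≤ β * t * S ω :=
            mul_le_mul_of_nonneg_left (le_of_lt hω) (by positivity)
          linarith
      _ ≤ ∫ ω, Real.exp (-(β * t * b)) * Real.exp ((1 + β) * t * S ω) ∂μ :=
          setIntegral_le_integral ((hint _).const_mul _) (ae_of_all _ fun ω => by positivity)
      _ = Real.exp (-(β * t * b)) * mgf S μ ((1 + β) * t) := by
          rw [integral_const_mul]; rfl
      _ ≤ Real.exp (-(β * t * b)) *
            Real.exp (((1 + β) * t) ^ 2 * (1 + |(1 + β) * t|) * V / 2) := by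
          gcongr; exact hup _ hu
      _ ≤ Real.exp (A * (1 / 2 - β ^ 2 / 2 + 4 * t)) := by
          rw [← Real.exp_add, Real.exp_le_exp, abs_of_nonneg (by positivity), hbdef, hAdef]
          have h1 : -(β * t * ((1 + β) * t * V)) +
              ((1 + β) * t) ^ 2 * (1 + (1 + β) * t) * V / 2 =
              t ^ 2 * V * (-(β * (1 + β)) + (1 + β) ^ 2 / 2 + (1 + β) ^ 3 * t / 2) := by ring
          rw [h1]
          refine mul_le_mul_of_nonneg_left ?_ hA0.le
          have h2 : (1 + β) ^ 3 ≤ 2 ^ 3 := by gcongr; linarith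
          nlinarith
      _ ≤ _ := hquart
  have hI3 : ∫ ω in {ω | x ≤ S ω ∧ S ω ≤ b}, Real.exp (t * S ω) ∂μ ≤
      Real.exp (t * b) * μ.real {ω | x ≤ S ω} := by
    have hms : MeasurableSet {ω | x ≤ S ω ∧ S ω ≤ b} :=
      (measurableSet_le measurable_const hS).inter (measurableSet_le hS measurable_const)
    calc ∫ ω in {ω | x ≤ S ω ∧ S ω ≤ b}, Real.exp (t * S ω) ∂μ
        ≤ ∫ _ in {ω | x ≤ S ω ∧ S ω ≤ b}, Real.exp (t * b) ∂μ := by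
          refine setIntegral_mono_on (hint t).integrableOn (integrable_const _).integrableOn hms
            fun ω hω => ?_
          rw [Real.exp_le_exp]
          exact mul_le_mul_of_nonneg_left hω.2 ht0.le
      _ = Real.exp (t * b) * μ.real {ω | x ≤ S ω ∧ S ω ≤ b} := by
          rw [setIntegral_const, smul_eq_mul, mul_comm]
      _ ≤ _ := by
          refine mul_le_mul_of_nonneg_left (measureReal_mono fun ω h => h.1) (Real.exp_nonneg _)
  have hsplit : mgf S μ t ≤ ∫ ω in {ω | S ω < x}, Real.exp (t * S ω) ∂μ +
      ∫ ω in {ω | b < S ω}, Real.exp (t * S ω) ∂μ +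
      ∫ ω in {ω | x ≤ S ω ∧ S ω ≤ b}, Real.exp (t * S ω) ∂μ := by
    have hm1 : MeasurableSet {ω | S ω < x} := measurableSet_lt hS measurable_const
    have hm2 : MeasurableSet {ω | b < S ω} := measurableSet_lt measurable_const hS
    have hm3 : MeasurableSet {ω | x ≤ S ω ∧ S ω ≤ b} :=
      (measurableSet_le measurable_const hS).inter (measurableSet_le hS measurable_const)
    have hi12 : Integrable (fun ω => {ω | S ω < x}.indicator (fun ω => Real.exp (t * S ω)) ω +
        {ω | b < S ω}.indicator (fun ω => Real.exp (t * S ω)) ω) μ :=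
      ((hint t).indicator hm1).add ((hint t).indicator hm2)
    rw [← integral_indicator hm1, ← integral_indicator hm2, ← integral_indicator hm3,
      ← integral_add ((hint t).indicator hm1) ((hint t).indicator hm2),
      ← integral_add hi12 ((hint t).indicator hm3)]
    refine integral_mono (hint t) (hi12.add ((hint t).indicator hm3)) fun ω => ?_
    have hE := Real.exp_pos (t * S ω)
    by_cases h1 : S ω < x <;> by_cases h2 : b < S ω
    · simp [h1, h2, not_le.2 h1, hE.le]
    · simp [h1, h2, not_le.2 h1]
    · simp [h1, h2]
    · simp [h1, h2, not_lt.1 h1, not_lt.1 h2]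
  have hfin : Real.exp (A * (1 / 2 - t)) / 2 ≤ Real.exp (t * b) * μ.real {ω | x ≤ S ω} := by
    linarith
  have htb : t * b = A * (1 + β) := by rw [hbdef, hAdef]; ring
  rw [htb] at hfin
  have h9 : Real.exp (-(A * (1 / 2 + β + t))) / 2 =
      Real.exp (-(A * (1 + β))) * (Real.exp (A * (1 / 2 - t)) / 2) := by
    rw [mul_div_assoc', ← Real.exp_add]
    congr 2
    ring
  have h10 : Real.exp (-(A * (1 + β))) * (Real.exp (A * (1 + β)) * μ.real {ω | x ≤ S ω}) =
      μ.real {ω | x ≤ S ω} := by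
    rw [← mul_assoc, ← Real.exp_add]; simp
  rw [h9, ← h10]
  gcongr

end LowerTail

end Karlin

/-! ### Sums of independent variables in the unit interval -/

namespace Karlin

variable {Ω : Type*} [MeasurableSpace Ω] {μ : Measure Ω} [IsProbabilityMeasure μ]

/-- The lower exponential bound with an error `γ` in the exponent, in the range
`r⁻¹ √V ≤ x ≤ r V` of moderate deviations. -/
theorem exists_exp_le_measure {γ : ℝ} (hγ : 0 < γ) :
    ∃ r : ℝ, 0 < r ∧ ∀ (S : Ω → ℝ) (V x : ℝ), Measurable S → 0 < V →
      (∀ u, Integrable (fun ω => Real.exp (u * S ω)) μ) →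
      (∀ u, |u| ≤ 1 → Real.exp (u ^ 2 * (1 - 2 * |u|) * V / 2) ≤ mgf S μ u) →
      (∀ u, |u| ≤ 1 → mgf S μ u ≤ Real.exp (u ^ 2 * (1 + |u|) * V / 2)) →
      0 < x → x ≤ r * V → V ≤ r * x ^ 2 →
      Real.exp (-((1 + γ) * (x ^ 2 / (2 * V)))) ≤ μ.real {ω | x ≤ S ω} := by
  set β := γ / (2 * (6 + γ)) with hβ
  have hβ0 : 0 < β := by positivity
  have hβ1 : β < 1 / 2 := by
    rw [hβ, div_lt_iff₀ (by positivity)]; linarith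
  have hβγ : β * (6 + γ) = γ / 2 := by rw [hβ]; field_simp
  refine ⟨min (β ^ 2 / 40) (min (β ^ 2 / 8) (γ / 4)), by positivity, ?_⟩
  intro S V x hS hV hint hlow hup hx hxV hVx
  have hr1 : x ≤ β ^ 2 / 40 * V := hxV.trans (by gcongr; exact min_le_left _ _)
  have hr2 : V ≤ β ^ 2 / 8 * x ^ 2 := hVx.trans (by
    gcongr; exact (min_le_right _ _).trans (min_le_left _ _))
  have hr3 : V ≤ γ / 4 * x ^ 2 := hVx.trans (by
    gcongr; exact (min_le_right _ _).trans (min_le_right _ _))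
  have h1β : 0 < 1 - β := by linarith
  -- The tilting parameter is such that the lower end `(1 - β) t V` of the tilted mass is `x`.
  set t := x / ((1 - β) * V) with ht
  have ht0 : 0 < t := by positivity
  have htx : (1 - β) * t * V = x := by rw [ht]; field_simp
  have ht20 : 20 * t ≤ β ^ 2 := by
    rw [ht, mul_div_assoc', div_le_iff₀ (by positivity)]
    have : β ^ 2 * ((1 - β) * V) ≥ β ^ 2 * (1 / 2 * V) := by
      gcongr; linarith
    linarith
  have hA : (1 - β) ^ 2 * (t ^ 2 * V) * V = x ^ 2 := by rw [← htx]; ring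
  have hA8 : 8 ≤ β ^ 2 * (t ^ 2 * V) := by
    have h1 : x ^ 2 ≤ t ^ 2 * V * V := by
      rw [← hA]
      have : (1 - β) ^ 2 ≤ 1 := by nlinarith
      have : 0 ≤ t ^ 2 * V * V := by positivity
      nlinarith
    have h2 : 8 * V ≤ β ^ 2 * (t ^ 2 * V) * V := by
      have : 0 < β ^ 2 := by positivity
      nlinarith
    exact le_of_mul_le_mul_right h2 hV
  have hmain := exp_le_measure_of_mgf_bounds hS hV hint hlow hup hβ0 (by linarith) ht0 ht20 hA8
  rw [htx] at hmain
  refine le_trans ?_ hmain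
  have h2 : Real.exp (-1) ≤ 1 / 2 := by
    rw [Real.exp_neg, one_div]
    exact inv_anti₀ (by norm_num) (by linarith [Real.add_one_le_exp (1 : ℝ)])
  -- The factor `1 / 2` is absorbed into the exponent, which is large because `V ≤ γ x² / 4`.
  have h3 : Real.exp (-(t ^ 2 * V * (1 / 2 + β + t))) * Real.exp (-1) ≤
      Real.exp (-(t ^ 2 * V * (1 / 2 + β + t))) / 2 := by
    rw [div_eq_mul_one_div (Real.exp _)]
    exact mul_le_mul_of_nonneg_left h2 (Real.exp_nonneg _)
  refine le_trans ?_ h3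
  rw [← Real.exp_add, Real.exp_le_exp]
  set B := t ^ 2 * V with hB
  have hB0 : 0 < B := by positivity
  have hxB : x ^ 2 / (2 * V) = (1 - β) ^ 2 * B / 2 := by rw [← hA]; field_simp
  rw [hxB]
  have h4 : 4 ≤ γ * ((1 - β) ^ 2 * B) := by
    have : 4 * V ≤ γ * ((1 - β) ^ 2 * B) * V := by rw [mul_assoc, hA]; linarith
    exact le_of_mul_le_mul_right this hV
  have h5 : 1 / 2 + β + t ≤ (1 + γ / 2) * (1 - β) ^ 2 / 2 := by
    have h6 : t ≤ β := by nlinarith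
    nlinarith
  have h7 := mul_le_mul_of_nonneg_left h5 hB0.le
  nlinarith

section InfiniteSum

variable {ξ : ℕ → Ω → ℝ}

theorem integrable_of_mem_Icc {f : Ω → ℝ} (hm : Measurable f) (h01 : ∀ ω, f ω ∈ Set.Icc (0 : ℝ) 1) :
    Integrable f μ :=
  Integrable.of_bound hm.aestronglyMeasurable 1 (ae_of_all _ fun ω => by
    rw [Real.norm_of_nonneg (h01 ω).1]; exact (h01 ω).2)

theorem memLp_of_mem_Icc {f : Ω → ℝ} (hm : Measurable f) (h01 : ∀ ω, f ω ∈ Set.Icc (0 : ℝ) 1) :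
    MemLp f 2 μ :=
  MemLp.of_bound hm.aestronglyMeasurable 1 (ae_of_all _ fun ω => by
    rw [Real.norm_of_nonneg (h01 ω).1]; exact (h01 ω).2)

theorem variance_le_integral_of_mem_Icc {f : Ω → ℝ} (hm : Measurable f)
    (h01 : ∀ ω, f ω ∈ Set.Icc (0 : ℝ) 1) : variance f μ ≤ ∫ ω, f ω ∂μ := by
  refine (variance_le_expectation_sq hm.aestronglyMeasurable).trans ?_
  refine integral_mono ((memLp_of_mem_Icc hm h01).integrable_sq) (integrable_of_mem_Icc hm h01)
    fun ω => ?_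
  have := h01 ω
  simp only [Pi.pow_apply]
  nlinarith [this.1, this.2]

theorem ae_summable_of_summable_integral (hm : ∀ k, Measurable (ξ k))
    (h01 : ∀ k ω, ξ k ω ∈ Set.Icc (0 : ℝ) 1) (hs : Summable fun k => ∫ ω, ξ k ω ∂μ) :
    ∀ᵐ ω ∂μ, Summable fun k => ξ k ω := by
  have h1 : ∫⁻ ω, ∑' k, ENNReal.ofReal (ξ k ω) ∂μ ≠ ⊤ := by
    rw [lintegral_tsum fun k => (hm k).ennreal_ofReal.aemeasurable]
    have : ∀ k, ∫⁻ ω, ENNReal.ofReal (ξ k ω) ∂μ = ENNReal.ofReal (∫ ω, ξ k ω ∂μ) := fun k =>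
      (ofReal_integral_eq_lintegral_ofReal (integrable_of_mem_Icc (hm k) (h01 k))
        (ae_of_all _ fun ω => (h01 k ω).1)).symm
    simp only [this]
    exact hs.tsum_ofReal_ne_top
  have h2 := ae_lt_top' (Measurable.tsum fun k => (hm k).ennreal_ofReal).aemeasurable h1
  filter_upwards [h2] with ω hω
  have := ENNReal.summable_toReal hω.ne
  simpa [ENNReal.toReal_ofReal (h01 _ ω).1] using this

theorem hasSum_integral_tsum (hm : ∀ k, Measurable (ξ k))
    (h01 : ∀ k ω, ξ k ω ∈ Set.Icc (0 : ℝ) 1) (hs : Summable fun k => ∫ ω, ξ k ω ∂μ) :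
    HasSum (fun k => ∫ ω, ξ k ω ∂μ) (∫ ω, ∑' k, ξ k ω ∂μ) := by
  refine hasSum_integral_of_summable_integral_norm
    (fun k => integrable_of_mem_Icc (hm k) (h01 k)) ?_
  simpa only [Real.norm_of_nonneg (h01 _ _).1] using hs

theorem sum_variance_eq_variance_sum {ι : Type*} {ξ : ι → Ω → ℝ} (hind : iIndepFun ξ μ)
    (hm : ∀ k, Measurable (ξ k)) (h01 : ∀ k ω, ξ k ω ∈ Set.Icc (0 : ℝ) 1) (s : Finset ι) :
    variance (fun ω => ∑ k ∈ s, ξ k ω) μ = ∑ k ∈ s, variance (ξ k) μ := by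
  rw [← IndepFun.variance_sum (fun k _ => memLp_of_mem_Icc (hm k) (h01 k))
    fun i _ j _ hij => hind.indepFun hij]
  congr 1
  ext ω
  simp

/-- The centred summands are bounded by one, have mean zero and are independent. -/
theorem centred_properties {ι : Type*} {ξ : ι → Ω → ℝ} (hind : iIndepFun ξ μ)
    (hm : ∀ k, Measurable (ξ k)) (h01 : ∀ k ω, ξ k ω ∈ Set.Icc (0 : ℝ) 1) :
    iIndepFun (fun k ω => ξ k ω - ∫ ω', ξ k ω' ∂μ) μ ∧
      (∀ k, Measurable fun ω => ξ k ω - ∫ ω', ξ k ω' ∂μ) ∧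
      (∀ k ω, |ξ k ω - ∫ ω', ξ k ω' ∂μ| ≤ 1) ∧
      (∀ k, ∫ ω, (ξ k ω - ∫ ω', ξ k ω' ∂μ) ∂μ = 0) ∧
      (∀ k, variance (fun ω => ξ k ω - ∫ ω', ξ k ω' ∂μ) μ = variance (ξ k) μ) := by
  refine ⟨hind.comp (fun k x => x - ∫ ω', ξ k ω' ∂μ) (fun k => by fun_prop),
    fun k => (hm k).sub_const _, fun k ω => ?_, fun k => ?_, fun k => ?_⟩
  · have h0 : 0 ≤ ∫ ω', ξ k ω' ∂μ := integral_nonneg fun ω => (h01 k ω).1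
    have h1 : ∫ ω', ξ k ω' ∂μ ≤ 1 := by
      calc ∫ ω', ξ k ω' ∂μ ≤ ∫ _, (1 : ℝ) ∂μ :=
            integral_mono (integrable_of_mem_Icc (hm k) (h01 k)) (integrable_const _)
              fun ω => (h01 k ω).2
        _ = 1 := by simp
    have := h01 k ω
    rw [abs_le]
    constructor <;> linarith [this.1, this.2]
  · rw [integral_sub (integrable_of_mem_Icc (hm k) (h01 k)) (integrable_const _)]
    simp
  · exact variance_sub_const (hm k).aestronglyMeasurable _

/-- The exponential moment bound for an infinite sum, by Fatou's lemma; `W` bounds the variance of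
every partial sum. -/
theorem lintegral_exp_tsum_le (hind : iIndepFun ξ μ) (hm : ∀ k, Measurable (ξ k))
    (h01 : ∀ k ω, ξ k ω ∈ Set.Icc (0 : ℝ) 1) (hs : Summable fun k => ∫ ω, ξ k ω ∂μ) {W : ℝ}
    (hW : ∀ n, ∑ k ∈ Finset.range n, variance (ξ k) μ ≤ W) {t : ℝ} (ht : |t| ≤ 1) :
    ∫⁻ ω, ENNReal.ofReal (Real.exp (t * (∑' k, ξ k ω - ∫ ω', ∑' k, ξ k ω' ∂μ))) ∂μ ≤
      ENNReal.ofReal (Real.exp (t ^ 2 * (1 + |t|) * W / 2)) := by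
  obtain ⟨hYi, hYm, hYb, hY0, hYv⟩ := centred_properties hind hm h01
  set Y := fun k ω => ξ k ω - ∫ ω', ξ k ω' ∂μ with hY
  have hYv' : ∀ k, variance (Y k) μ = variance (ξ k) μ := hYv
  let f : ℕ → Ω → ENNReal := fun n ω =>
    ENNReal.ofReal (Real.exp (t * (∑ k ∈ Finset.range n, Y k) ω))
  have hYsum : ∀ n, Measurable (∑ k ∈ Finset.range n, Y k) := fun n =>
    by rw [Finset.sum_fn]; exact Finset.measurable_sum _ fun k _ => hYm k
  have hfm : ∀ n, Measurable (f n) := fun n =>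
    (Real.measurable_exp.comp ((hYsum n).const_mul t)).ennreal_ofReal
  have hlim : ∀ᵐ ω ∂μ, liminf (fun n => f n ω) atTop =
      ENNReal.ofReal (Real.exp (t * (∑' k, ξ k ω - ∫ ω', ∑' k, ξ k ω' ∂μ))) := by
    filter_upwards [ae_summable_of_summable_integral hm h01 hs] with ω hω
    refine Tendsto.liminf_eq ?_
    refine (ENNReal.continuous_ofReal.tendsto _).comp ((Real.continuous_exp.tendsto _).comp ?_)
    refine Tendsto.const_mul t ?_
    have h1 := (hω.hasSum.sub (hasSum_integral_tsum hm h01 hs)).tendsto_sum_nat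
    convert h1 using 2 with n
    simp [hY]
  have hfn : ∀ n, ∫⁻ ω, f n ω ∂μ ≤ ENNReal.ofReal (Real.exp (t ^ 2 * (1 + |t|) * W / 2)) := by
    intro n
    have hpos : 0 < mgf (∑ k ∈ Finset.range n, Y k) μ t := by
      refine lt_of_lt_of_le (Real.exp_pos _)
        (mgf_sum_bounds hYi hYm hYb hY0 (Finset.range n) ht).1
    have hint : Integrable (fun ω => Real.exp (t * (∑ k ∈ Finset.range n, Y k) ω)) μ := by
      by_contra h
      rw [mgf_undef h] at hpos
      exact lt_irrefl _ hpos
    have h1 : ∫⁻ ω, f n ω ∂μ = ENNReal.ofReal (mgf (∑ k ∈ Finset.range n, Y k) μ t) :=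
      (ofReal_integral_eq_lintegral_ofReal hint (ae_of_all _ fun ω => Real.exp_nonneg _)).symm
    rw [h1]
    refine ENNReal.ofReal_le_ofReal
      ((mgf_sum_bounds hYi hYm hYb hY0 (Finset.range n) ht).2.trans ?_)
    rw [Real.exp_le_exp]
    simp only [hYv']
    gcongr
    exact hW n
  calc ∫⁻ ω, ENNReal.ofReal (Real.exp (t * (∑' k, ξ k ω - ∫ ω', ∑' k, ξ k ω' ∂μ))) ∂μ
      = ∫⁻ ω, liminf (fun n => f n ω) atTop ∂μ :=
        lintegral_congr_ae (hlim.mono fun ω h => h.symm)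
    _ ≤ liminf (fun n => ∫⁻ ω, f n ω ∂μ) atTop := lintegral_liminf_le hfm
    _ ≤ _ := by
        refine (liminf_le_liminf (Eventually.of_forall hfn)).trans_eq ?_
        exact tendsto_const_nhds.liminf_eq

/-- A Bernstein type inequality for an infinite sum of independent variables in `[0, 1]`. -/
theorem measure_abs_tsum_sub_le (hind : iIndepFun ξ μ) (hm : ∀ k, Measurable (ξ k))
    (h01 : ∀ k ω, ξ k ω ∈ Set.Icc (0 : ℝ) 1) (hs : Summable fun k => ∫ ω, ξ k ω ∂μ) {W x : ℝ}
    (hW : ∀ n, ∑ k ∈ Finset.range n, variance (ξ k) μ ≤ W) (hx : 0 < x) (hxW : x ≤ W) :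
    μ {ω | x ≤ |∑' k, ξ k ω - ∫ ω', ∑' k, ξ k ω' ∂μ|} ≤
      ENNReal.ofReal (2 * Real.exp (-(x ^ 2 / (2 * W) * (1 - x / W)))) := by
  have hW0 : 0 < W := hx.trans_le hxW
  have hSm : Measurable fun ω => ∑' k, ξ k ω := Measurable.tsum hm
  set D : Ω → ℝ := fun ω => ∑' k, ξ k ω - ∫ ω', ∑' k, ξ k ω' ∂μ with hD
  have hDm : Measurable D := hSm.sub_const _
  have hq : x / W ≤ 1 := (div_le_one hW0).2 hxW
  have hq0 : 0 < x / W := by positivity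
  -- Chernoff bound with tilting parameter `x / W`, for either sign.
  have hside : ∀ s : ℝ, |s| = 1 → μ {ω | x ≤ s * D ω} ≤
      ENNReal.ofReal (Real.exp (-(x ^ 2 / (2 * W) * (1 - x / W)))) := by
    intro s hs1
    have habs : |s * (x / W)| = x / W := by rw [abs_mul, hs1, one_mul, abs_of_pos hq0]
    have hs2 : s ^ 2 = 1 := by rw [← sq_abs, hs1]; norm_num
    have h1 := lintegral_exp_tsum_le hind hm h01 hs hW (t := s * (x / W)) (by rw [habs]; exact hq)
    rw [habs] at h1
    have h2 := mul_meas_ge_le_lintegral (μ := μ)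
      (f := fun ω => ENNReal.ofReal (Real.exp (s * (x / W) * D ω)))
      (Real.measurable_exp.comp (hDm.const_mul _)).ennreal_ofReal
      (ENNReal.ofReal (Real.exp (x / W * x)))
    have h3 : {ω | ENNReal.ofReal (Real.exp (x / W * x)) ≤
        ENNReal.ofReal (Real.exp (s * (x / W) * D ω))} = {ω | x ≤ s * D ω} := by
      ext ω
      simp only [Set.mem_ofPred_eq]
      rw [ENNReal.ofReal_le_ofReal_iff (Real.exp_nonneg _), Real.exp_le_exp,
        show s * (x / W) * D ω = x / W * (s * D ω) by ring, mul_le_mul_iff_right₀ hq0]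
    rw [h3] at h2
    have h4 := h2.trans h1
    have h5 : ENNReal.ofReal (Real.exp (-(x ^ 2 / (2 * W) * (1 - x / W)))) =
        ENNReal.ofReal (Real.exp (-(x / W * x))) *
          ENNReal.ofReal (Real.exp ((s * (x / W)) ^ 2 * (1 + x / W) * W / 2)) := by
      rw [← ENNReal.ofReal_mul (Real.exp_nonneg _), ← Real.exp_add]
      congr 2
      rw [mul_pow, hs2]
      field_simp
      ring
    have h6 : ENNReal.ofReal (Real.exp (-(x / W * x))) * ENNReal.ofReal (Real.exp (x / W * x)) = 1
        := by
      rw [← ENNReal.ofReal_mul (Real.exp_nonneg _), ← Real.exp_add]; simp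
    calc μ {ω | x ≤ s * D ω}
        = ENNReal.ofReal (Real.exp (-(x / W * x))) *
            (ENNReal.ofReal (Real.exp (x / W * x)) * μ {ω | x ≤ s * D ω}) := by
          rw [← mul_assoc, h6, one_mul]
      _ ≤ _ := by rw [h5]; gcongr
  have hsub : {ω | x ≤ |D ω|} ⊆ {ω | x ≤ 1 * D ω} ∪ {ω | x ≤ -1 * D ω} := by
    intro ω hω
    rcases le_abs.1 (show x ≤ |D ω| from hω) with h | h
    · exact Or.inl (by simpa using h)
    · exact Or.inr (by simpa using h)
  calc μ {ω | x ≤ |D ω|} ≤ μ {ω | x ≤ 1 * D ω} + μ {ω | x ≤ -1 * D ω} :=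
        (measure_mono hsub).trans (measure_union_le _ _)
    _ ≤ _ := add_le_add (hside 1 (by simp)) (hside (-1) (by simp))
    _ = _ := by rw [← ENNReal.ofReal_add (Real.exp_nonneg _) (Real.exp_nonneg _), ← two_mul]

/-- An infinite sum of independent variables in `[0, 1]` with summable means is square integrable,
and its variance is the sum of the variances. -/
theorem memLp_tsum (hind : iIndepFun ξ μ) (hm : ∀ k, Measurable (ξ k))
    (h01 : ∀ k ω, ξ k ω ∈ Set.Icc (0 : ℝ) 1) (hs : Summable fun k => ∫ ω, ξ k ω ∂μ) :
    MemLp (fun ω => ∑' k, ξ k ω) 2 μ ∧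
      HasSum (fun k => variance (ξ k) μ) (variance (fun ω => ∑' k, ξ k ω) μ) := by
  have hSm : Measurable fun ω => ∑' k, ξ k ω := Measurable.tsum hm
  have hvs : Summable fun k => variance (ξ k) μ :=
    hs.of_nonneg_of_le (fun k => variance_nonneg _ _)
      fun k => variance_le_integral_of_mem_Icc (hm k) (h01 k)
  have hmean := hasSum_integral_tsum hm h01 hs
  set m := ∫ ω, ∑' k, ξ k ω ∂μ with hmdef
  let S : ℕ → Ω → ℝ := fun n ω => ∑ k ∈ Finset.range n, ξ k ω
  have hSn : ∀ n, Measurable (S n) := fun n => Finset.measurable_fun_sum _ fun k _ => hm k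
  have hSL : ∀ n, MemLp (S n) 2 μ := fun n =>
    memLp_finsetSum _ fun k _ => memLp_of_mem_Icc (hm k) (h01 k)
  have hES : ∀ n, ∫ ω, S n ω ∂μ = ∑ k ∈ Finset.range n, ∫ ω, ξ k ω ∂μ := fun n =>
    integral_finsetSum _ fun k _ => integrable_of_mem_Icc (hm k) (h01 k)
  have hSsq : ∀ n, ∫ ω, S n ω ^ 2 ∂μ =
      ∑ k ∈ Finset.range n, variance (ξ k) μ + (∑ k ∈ Finset.range n, ∫ ω, ξ k ω ∂μ) ^ 2 := by
    intro n
    have h1 := variance_eq_sub (hSL n)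
    rw [sum_variance_eq_variance_sum hind hm h01, hES] at h1
    simp only [Pi.pow_apply] at h1
    linarith
  have hlimsq : Tendsto (fun n => ∫ ω, S n ω ^ 2 ∂μ) atTop
      (𝓝 (∑' k, variance (ξ k) μ + m ^ 2)) := by
    simp only [hSsq]
    exact hvs.hasSum.tendsto_sum_nat.add (hmean.tendsto_sum_nat.pow 2)
  have hptw : ∀ᵐ ω ∂μ, Tendsto (fun n => S n ω) atTop (𝓝 (∑' k, ξ k ω)) := by
    filter_upwards [ae_summable_of_summable_integral hm h01 hs] with ω hω
    exact hω.hasSum.tendsto_sum_nat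
  have hle : ∀ᵐ ω ∂μ, ∀ n, S n ω ≤ ∑' k, ξ k ω := by
    filter_upwards [ae_summable_of_summable_integral hm h01 hs] with ω hω n
    exact hω.sum_le_tsum _ fun k _ => (h01 k ω).1
  have hS0 : ∀ n ω, 0 ≤ S n ω := fun n ω => Finset.sum_nonneg fun k _ => (h01 k ω).1
  -- Fatou's lemma gives square integrability; the partial sums increase to the whole sum, which
  -- then dominates them.
  have hfin : ∫⁻ ω, ENNReal.ofReal ((∑' k, ξ k ω) ^ 2) ∂μ ≤
      ENNReal.ofReal (∑' k, variance (ξ k) μ + m ^ 2) := by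
    calc ∫⁻ ω, ENNReal.ofReal ((∑' k, ξ k ω) ^ 2) ∂μ
        = ∫⁻ ω, liminf (fun n => ENNReal.ofReal (S n ω ^ 2)) atTop ∂μ := by
          refine lintegral_congr_ae (hptw.mono fun ω h => Tendsto.liminf_eq ?_ |>.symm)
          exact (ENNReal.continuous_ofReal.tendsto _).comp (h.pow 2)
      _ ≤ liminf (fun n => ∫⁻ ω, ENNReal.ofReal (S n ω ^ 2) ∂μ) atTop :=
          lintegral_liminf_le fun n => ((hSn n).pow_const 2).ennreal_ofReal
      _ = _ := by
          refine Tendsto.liminf_eq ?_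
          refine ((ENNReal.continuous_ofReal.tendsto _).comp hlimsq).congr fun n => ?_
          exact ofReal_integral_eq_lintegral_ofReal (hSL n).integrable_sq
            (ae_of_all _ fun ω => sq_nonneg _)
  have hsqint : Integrable (fun ω => (∑' k, ξ k ω) ^ 2) μ :=
    (lintegral_ofReal_ne_top_iff_integrable (hSm.pow_const 2).aestronglyMeasurable
      (ae_of_all _ fun ω => sq_nonneg _)).1 (hfin.trans_lt ENNReal.ofReal_lt_top).ne
  have hL2 : MemLp (fun ω => ∑' k, ξ k ω) 2 μ :=
    (memLp_two_iff_integrable_sq hSm.aestronglyMeasurable).2 hsqint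
  refine ⟨hL2, ?_⟩
  have hlim2 : Tendsto (fun n => ∫ ω, S n ω ^ 2 ∂μ) atTop (𝓝 (∫ ω, (∑' k, ξ k ω) ^ 2 ∂μ)) := by
    refine tendsto_integral_of_dominated_convergence (fun ω => (∑' k, ξ k ω) ^ 2)
      (fun n => ((hSn n).pow_const 2).aestronglyMeasurable) hsqint (fun n => ?_) ?_
    · filter_upwards [hle] with ω hω
      rw [Real.norm_of_nonneg (sq_nonneg _)]
      exact pow_le_pow_left₀ (hS0 n ω) (hω n) 2
    · filter_upwards [hptw] with ω hω using hω.pow 2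
  have h1 := tendsto_nhds_unique hlimsq hlim2
  have h2 := variance_eq_sub hL2
  simp only [Pi.pow_apply] at h2
  rw [h2, ← h1, ← hmdef, add_sub_cancel_right]
  exact hvs.hasSum

/-- The lower exponential bound for a finite sum of independent variables in `[0, 1]`, on either
side (`σ = 1` or `σ = -1`). -/
theorem exists_exp_le_measure_sum {γ : ℝ} (hγ : 0 < γ) :
    ∃ r : ℝ, 0 < r ∧ ∀ (ξ : ℕ → Ω → ℝ) (s : Finset ℕ) (x σ : ℝ), iIndepFun ξ μ →
      (∀ k, Measurable (ξ k)) → (∀ k ω, ξ k ω ∈ Set.Icc (0 : ℝ) 1) → |σ| = 1 →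
      0 < ∑ k ∈ s, variance (ξ k) μ →
      0 < x → x ≤ r * ∑ k ∈ s, variance (ξ k) μ → ∑ k ∈ s, variance (ξ k) μ ≤ r * x ^ 2 →
      Real.exp (-((1 + γ) * (x ^ 2 / (2 * ∑ k ∈ s, variance (ξ k) μ)))) ≤
        μ.real {ω | x ≤ σ * ∑ k ∈ s, (ξ k ω - ∫ ω', ξ k ω' ∂μ)} := by
  obtain ⟨r, hr, H⟩ := exists_exp_le_measure (μ := μ) hγ
  refine ⟨r, hr, fun ξ s x σ hind hm h01 hσ hV hx hxV hVx => ?_⟩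
  obtain ⟨hYi, hYm, hYb, hY0, hYv⟩ := centred_properties hind hm h01
  set Y := fun k ω => ξ k ω - ∫ ω', ξ k ω' ∂μ with hY
  have hYv' : ∀ k, variance (Y k) μ = variance (ξ k) μ := hYv
  have hσ2 : σ ^ 2 = 1 := by rw [← sq_abs, hσ]; norm_num
  have hSm : Measurable (∑ k ∈ s, Y k) := by
    rw [Finset.sum_fn]; exact Finset.measurable_sum _ fun k _ => hYm k
  have hSeq : ∀ ω, ∑ k ∈ s, (ξ k ω - ∫ ω', ξ k ω' ∂μ) = (∑ k ∈ s, Y k) ω := fun ω => by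
    simp [hY]
  have hint : ∀ u, Integrable (fun ω => Real.exp (u * (∑ k ∈ s, Y k) ω)) μ := fun u =>
    hYi.integrable_exp_mul_sum hYm fun k _ => integrable_exp_mul_of_bounded (hYm k) (hYb k) u
  have hmgf : ∀ u, mgf (fun ω => σ * (∑ k ∈ s, Y k) ω) μ u = mgf (∑ k ∈ s, Y k) μ (σ * u) := by
    intro u
    simp only [mgf]
    congr 1
    ext ω
    congr 1
    ring
  have habs : ∀ u, |σ * u| = |u| := fun u => by rw [abs_mul, hσ, one_mul]
  simp only [hSeq]
  refine H (fun ω => σ * (∑ k ∈ s, Y k) ω) _ x (hSm.const_mul σ) hV (fun u => ?_) (fun u hu => ?_)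
    (fun u hu => ?_) hx hxV hVx
  · convert hint (u * σ) using 2
    ring_nf
  · have := (mgf_sum_bounds hYi hYm hYb hY0 s (t := σ * u) (by rwa [habs])).1
    rw [hmgf]
    simpa only [habs, mul_pow, hσ2, one_mul, hYv'] using this
  · have := (mgf_sum_bounds hYi hYm hYb hY0 s (t := σ * u) (by rwa [habs])).2
    rw [hmgf]
    simpa only [habs, mul_pow, hσ2, one_mul, hYv'] using this

end InfiniteSum

end Karlin

/-! ### The counting function and an Abelian theorem -/

namespace Karlin

section CountingFunction

variable {p : ℕ → ℝ}

theorem IsBoxDistribution.summable_mul (hp : IsBoxDistribution p) (t : ℝ) :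
    Summable fun k => p k * t := hp.hasSum_one.summable.mul_right t

theorem mem_rho_set_iff {k : ℕ} (hpk : 0 ≤ p k) {t z : ℝ} (hz : 0 < z) :
    (0 < p k ∧ 1 / p k ≤ t / z) ↔ z ≤ p k * t := by
  rcases hpk.eq_or_lt with h | h
  · simp [← h, hz]
  · rw [div_le_div_iff₀ h hz, one_mul, mul_comm t]
    simp [h]

theorem IsBoxDistribution.finite_setOf_le (hp : IsBoxDistribution p) {t z : ℝ} (hz : 0 < z) :
    {k | z ≤ p k * t}.Finite := by
  have h := (hp.summable_mul t).tendsto_cofinite_zero.eventually_lt_const hz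
  simpa [Filter.eventually_cofinite] using h

theorem rho_eq_ncard (hp : IsBoxDistribution p) {t z : ℝ} (hz : 0 < z) :
    rho p (t / z) = ({k | z ≤ p k * t}.ncard : ℝ) := by
  rw [rho]
  congr 2
  ext k
  exact mem_rho_set_iff (hp.nonneg k) hz

/-- `ρ(t / z)` counts the boxes with `z ≤ t pₖ`. -/
theorem hasSum_rho (hp : IsBoxDistribution p) {t z : ℝ} (hz : 0 < z) :
    HasSum (fun k => if z ≤ p k * t then (1 : ℝ) else 0) (rho p (t / z)) := by
  have hfin := hp.finite_setOf_le (t := t) hz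
  rw [rho_eq_ncard hp hz, Set.ncard_eq_toFinset_card _ hfin]
  have h1 : HasSum (fun k => if z ≤ p k * t then (1 : ℝ) else 0)
      (∑ k ∈ hfin.toFinset, if z ≤ p k * t then (1 : ℝ) else 0) :=
    hasSum_sum_of_ne_finset_zero (by intro b hb; simpa using hb)
  convert h1 using 1
  rw [Finset.sum_congr rfl (g := fun _ => (1 : ℝ))]
  · simp
  · intro k hk
    have : z ≤ p k * t := by simpa using hk
    simp [this]

theorem rho_nonneg (t : ℝ) : 0 ≤ rho p t := Nat.cast_nonneg _

theorem rho_mono (hp : IsBoxDistribution p) : Monotone (rho p) := by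
  intro s t hst
  rw [rho, rho, Nat.cast_le]
  refine Set.ncard_le_ncard (fun k hk => ⟨hk.1, hk.2.trans hst⟩) ?_
  have h := hp.finite_setOf_le (t := t) one_pos
  convert h using 1
  ext k
  simpa using mem_rho_set_iff (hp.nonneg k) (t := t) one_pos

theorem rho_le (hp : IsBoxDistribution p) {t : ℝ} (ht : 0 ≤ t) : rho p t ≤ t := by
  have h1 := hasSum_rho hp (t := t) one_pos
  rw [div_one] at h1
  have h2 : HasSum (fun k => p k * t) t := by simpa using hp.hasSum_one.mul_right t
  refine hasSum_le (fun k => ?_) h1 h2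
  split_ifs with h
  · exact h
  · exact mul_nonneg (hp.nonneg k) ht

variable {α : ℝ} {L : ℝ → ℝ}

/-- `ρ` is regularly varying with index `α`. -/
theorem tendsto_rho_div (hL : IsSlowlyVarying L)
    (hρ : rho p ~[atTop] fun t => t ^ α * L t) {c : ℝ} (hc : 0 < c) :
    Tendsto (fun t => rho p (c * t) / rho p t) atTop (𝓝 (c ^ α)) := by
  obtain ⟨⟨A, hA, -⟩, hLc⟩ := hL
  have hpos : ∀ᶠ t in atTop, 0 < t ^ α * L t := by
    filter_upwards [eventually_ge_atTop A, eventually_gt_atTop 0] with t h1 h2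
    have := hA t h1
    positivity
  have hr : Tendsto (fun t => rho p t / (t ^ α * L t)) atTop (𝓝 1) := by
    have := (isEquivalent_iff_tendsto_one (hpos.mono fun t h => h.ne')).1 hρ
    exact this
  have hct : Tendsto (fun t : ℝ => c * t) atTop atTop := tendsto_id.const_mul_atTop hc
  have h1 := ((hr.comp hct).mul (hLc c hc)).mul (hr.inv₀ one_ne_zero)
  have h2 := h1.const_mul (c ^ α)
  simp only [inv_one, mul_one] at h2
  refine h2.congr' ?_
  filter_upwards [hpos, hct.eventually hpos, eventually_gt_atTop 0] with t h3 h4 h5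
  have h6 : t ^ α ≠ 0 := (Real.rpow_pos_of_pos h5 α).ne'
  have h7 : c ^ α ≠ 0 := (Real.rpow_pos_of_pos hc α).ne'
  have h8 : L t ≠ 0 := right_ne_zero_of_mul h3.ne'
  have h9 : L (c * t) ≠ 0 := right_ne_zero_of_mul h4.ne'
  simp only [Function.comp_apply, Real.mul_rpow hc.le h5.le]
  field_simp

theorem eventually_rho_pos (hp : IsBoxDistribution p) : ∀ᶠ t in atTop, 0 < rho p t := by
  obtain ⟨k, hk⟩ := hp.infinite_pos.nonempty
  filter_upwards [eventually_ge_atTop (1 / p k)] with t ht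
  refine lt_of_lt_of_le ?_ (rho_mono hp ht)
  rw [rho, Nat.cast_pos]
  refine Set.ncard_pos ?_ |>.2 ⟨k, hk, le_rfl⟩
  have h := hp.finite_setOf_le (t := 1 / p k) one_pos
  convert h using 1
  ext l
  simpa using mem_rho_set_iff (hp.nonneg l) (t := 1 / p k) one_pos

/-- Potter type bound along the powers of `2`. -/
theorem exists_rho_two_pow_le (hp : IsBoxDistribution p) (hL : IsSlowlyVarying L)
    (hρ : rho p ~[atTop] fun t => t ^ α * L t) {β : ℝ} (hβ : α < β) :
    ∃ t₀ : ℝ, 0 < t₀ ∧ ∀ t, t₀ ≤ t → 0 < rho p t ∧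
      ∀ n : ℕ, rho p (2 ^ n * t) ≤ ((2 : ℝ) ^ β) ^ n * rho p t := by
  have h2 : (2 : ℝ) ^ α < 2 ^ β := Real.rpow_lt_rpow_of_exponent_lt one_lt_two hβ
  have h3 := (tendsto_rho_div hL hρ two_pos).eventually_lt_const h2
  obtain ⟨t₀, ht₀⟩ := eventually_atTop.1 (h3.and (eventually_rho_pos hp))
  refine ⟨max t₀ 1, by positivity, fun t ht => ?_⟩
  have ht1 : t₀ ≤ t := (le_max_left _ _).trans ht
  have ht2 : 1 ≤ t := (le_max_right _ _).trans ht
  refine ⟨(ht₀ t ht1).2, fun n => ?_⟩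
  induction n with
  | zero => simp
  | succ n ih =>
    have h4 : t ≤ 2 ^ n * t := le_mul_of_one_le_left (by linarith) (one_le_pow₀ one_le_two)
    obtain ⟨h5, h6⟩ := ht₀ (2 ^ n * t) (ht1.trans h4)
    rw [div_lt_iff₀ h6] at h5
    calc rho p (2 ^ (n + 1) * t) = rho p (2 * (2 ^ n * t)) := by ring_nf
      _ ≤ 2 ^ β * rho p (2 ^ n * t) := h5.le
      _ ≤ 2 ^ β * (((2 : ℝ) ^ β) ^ n * rho p t) := by gcongr
      _ = _ := by ring

/-- A Potter type bound: for `z < 1` it is obtained from the powers of `2`, for `z ≥ 1` from the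
monotonicity of `ρ`. -/
theorem exists_rho_div_le (hp : IsBoxDistribution p) (hL : IsSlowlyVarying L)
    (hρ : rho p ~[atTop] fun t => t ^ α * L t) {β : ℝ} (hβ : α < β) (hβ0 : 0 ≤ β) :
    ∃ C : ℝ, 0 < C ∧ ∀ᶠ t in atTop, ∀ z, 0 < z → rho p (t / z) ≤ C * (1 + z ^ (-β)) * rho p t := by
  obtain ⟨t₀, h0, ht₀⟩ := exists_rho_two_pow_le hp hL hρ hβ
  have h2β : (1 : ℝ) ≤ 2 ^ β := Real.one_le_rpow one_le_two hβ0
  refine ⟨2 ^ β, by positivity, ?_⟩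
  filter_upwards [eventually_ge_atTop t₀] with t ht z hz
  obtain ⟨hpos, hn⟩ := ht₀ t ht
  have htpos : 0 < t := h0.trans_le ht
  have hzβ : 0 < z ^ (-β) := Real.rpow_pos_of_pos hz _
  rcases le_or_gt 1 z with h1 | h1
  · calc rho p (t / z) ≤ rho p t := rho_mono hp (div_le_self htpos.le h1)
      _ = 1 * 1 * rho p t := by ring
      _ ≤ _ := by gcongr; linarith
  · obtain ⟨n, hn1, hn2⟩ := exists_nat_pow_near ((one_le_inv₀ hz).2 h1.le) (one_lt_two (α := ℝ))
    calc rho p (t / z) ≤ rho p (2 ^ (n + 1) * t) := by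
          refine rho_mono hp ?_
          rw [div_eq_inv_mul]; gcongr
      _ ≤ ((2 : ℝ) ^ β) ^ (n + 1) * rho p t := hn _
      _ = 2 ^ β * ((2 : ℝ) ^ n) ^ β * rho p t := by
          rw [pow_succ, ← Real.rpow_natCast, ← Real.rpow_natCast, ← Real.rpow_mul two_pos.le,
            ← Real.rpow_mul two_pos.le, mul_comm β]
          ring
      _ ≤ 2 ^ β * (z⁻¹) ^ β * rho p t := by gcongr
      _ = 2 ^ β * z ^ (-β) * rho p t := by rw [Real.inv_rpow hz.le, Real.rpow_neg hz.le]
      _ ≤ _ := by gcongr; linarith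

/-- `ρ` grows faster than every power with exponent below its index. -/
theorem eventually_rpow_le_rho (hp : IsBoxDistribution p) (hL : IsSlowlyVarying L)
    (hρ : rho p ~[atTop] fun t => t ^ α * L t) {β : ℝ} (hβ0 : 0 < β) (hβ : β < α) :
    ∀ᶠ t in atTop, t ^ β ≤ rho p t := by
  set δ := (α + β) / 2 with hδ
  have hδβ : β < δ := by rw [hδ]; linarith
  have h2 : (2 : ℝ) ^ δ < 2 ^ α :=
    Real.rpow_lt_rpow_of_exponent_lt one_lt_two (by rw [hδ]; linarith)
  have h3 := (tendsto_rho_div hL hρ two_pos).eventually_const_lt h2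
  obtain ⟨t₁, ht₁⟩ := eventually_atTop.1 (h3.and (eventually_rho_pos hp))
  set t₀ := max t₁ 1 with ht₀
  have h0 : 0 < t₀ := by positivity
  have hpos : 0 < rho p t₀ := (ht₁ t₀ (le_max_left _ _)).2
  have hn : ∀ n : ℕ, ((2 : ℝ) ^ δ) ^ n * rho p t₀ ≤ rho p (2 ^ n * t₀) := by
    intro n
    induction n with
    | zero => simp
    | succ n ih =>
      have h4 : t₀ ≤ 2 ^ n * t₀ := le_mul_of_one_le_left h0.le (one_le_pow₀ one_le_two)
      obtain ⟨h5, h6⟩ := ht₁ (2 ^ n * t₀) ((le_max_left _ _).trans h4)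
      rw [lt_div_iff₀ h6] at h5
      calc ((2 : ℝ) ^ δ) ^ (n + 1) * rho p t₀ = 2 ^ δ * (((2 : ℝ) ^ δ) ^ n * rho p t₀) := by ring
        _ ≤ 2 ^ δ * rho p (2 ^ n * t₀) := by gcongr
        _ ≤ rho p (2 * (2 ^ n * t₀)) := h5.le
        _ = _ := by ring_nf
  have hbig : ∀ t, t₀ ≤ t → (t / (2 * t₀)) ^ δ * rho p t₀ ≤ rho p t := by
    intro t ht
    obtain ⟨n, hn1, hn2⟩ := exists_nat_pow_near ((one_le_div h0).2 ht) (one_lt_two (α := ℝ))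
    rw [le_div_iff₀ h0] at hn1
    refine le_trans ?_ ((hn n).trans (rho_mono hp hn1))
    gcongr
    rw [← Real.rpow_natCast, ← Real.rpow_mul two_pos.le, mul_comm δ, Real.rpow_mul two_pos.le,
      Real.rpow_natCast]
    have : t / (2 * t₀) ≤ 2 ^ n := by
      rw [pow_succ, div_lt_iff₀ h0] at hn2
      rw [div_le_iff₀ (by positivity)]
      linarith
    have htp : 0 < t := h0.trans_le ht
    gcongr
    linarith
  have hlim : Tendsto (fun t : ℝ => t ^ (δ - β)) atTop atTop :=
    tendsto_rpow_atTop (by linarith)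
  filter_upwards [eventually_ge_atTop t₀,
    hlim.eventually_ge_atTop ((2 * t₀) ^ δ / rho p t₀)] with t ht h5
  have htp : 0 < t := h0.trans_le ht
  refine le_trans ?_ (hbig t ht)
  rw [Real.div_rpow htp.le (by positivity), div_mul_eq_mul_div, le_div_iff₀ (by positivity)]
  rw [div_le_iff₀ hpos, Real.rpow_sub htp, div_mul_eq_mul_div, le_div_iff₀ (by positivity)] at h5
  linarith

end CountingFunction

section AbelianTheorem

variable {p : ℕ → ℝ} {α : ℝ} {L : ℝ → ℝ}

theorem aestronglyMeasurable_rho_div (hp : IsBoxDistribution p) (t : ℝ) :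
    AEStronglyMeasurable (fun z => rho p (t / z)) (volume.restrict (Set.Ioi 0)) := by
  have h1 : Measurable fun z : ℝ => ∑' k, if z ≤ p k * t then (1 : ℝ) else 0 :=
    Measurable.tsum fun k => Measurable.ite measurableSet_Iic measurable_const measurable_const
  refine h1.aestronglyMeasurable.congr ?_
  filter_upwards [ae_restrict_mem measurableSet_Ioi] with z hz
  exact (hasSum_rho hp hz).tsum_eq

/-- Summation by parts: `∑ₖ ∫₀^{t pₖ} g = ∫₀^∞ g(z) ρ(t / z) dz`. -/
theorem hasSum_primitive (hp : IsBoxDistribution p) {g : ℝ → ℝ} (hg : Measurable g) {t : ℝ}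
    (ht : 0 ≤ t) (hint : IntegrableOn (fun z => g z * rho p (t / z)) (Set.Ioi 0)) :
    HasSum (fun k => ∫ z in (0 : ℝ)..(p k * t), g z)
      (∫ z in Set.Ioi 0, g z * rho p (t / z)) := by
  have hF : ∀ k, ∫ z in (0 : ℝ)..(p k * t), g z =
      ∫ z in Set.Ioi 0, g z * if z ≤ p k * t then 1 else 0 := by
    intro k
    rw [intervalIntegral.integral_of_le (mul_nonneg (hp.nonneg k) ht),
      ← integral_indicator measurableSet_Ioc, ← integral_indicator measurableSet_Ioi]
    congr 1
    ext z
    by_cases h1 : 0 < z <;> by_cases h2 : z ≤ p k * t <;> simp [h1, h2]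
  simp only [hF]
  refine hasSum_integral_of_dominated_convergence
    (fun k z => |g z| * if z ≤ p k * t then 1 else 0) (fun k => ?_) (fun k => ?_) ?_ ?_ ?_
  · exact (hg.mul (Measurable.ite measurableSet_Iic measurable_const
      measurable_const)).aestronglyMeasurable
  · refine ae_of_all _ fun z => ?_
    rw [norm_mul, Real.norm_eq_abs]
    gcongr
    split_ifs <;> simp
  · filter_upwards [ae_restrict_mem measurableSet_Ioi] with z hz
    exact (hasSum_rho hp hz).summable.mul_left _
  · refine hint.norm.congr ?_
    filter_upwards [ae_restrict_mem measurableSet_Ioi] with z hz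
    rw [tsum_mul_left, (hasSum_rho hp hz).tsum_eq, norm_mul, Real.norm_eq_abs,
      Real.norm_of_nonneg (rho_nonneg _)]
  · filter_upwards [ae_restrict_mem measurableSet_Ioi] with z hz
    exact (hasSum_rho hp hz).mul_left _

/-- An Abelian theorem: `∑ₖ f(t pₖ) ~ ρ(t) ∫₀^∞ g(z) z^{-α} dz` for `f(x) = ∫₀ˣ g`. -/
theorem tendsto_tsum_primitive_div_rho (hp : IsBoxDistribution p) (hL : IsSlowlyVarying L)
    (hρ : rho p ~[atTop] fun t => t ^ α * L t) {β : ℝ} (hβ : α < β) (hβ0 : 0 ≤ β)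
    {g f : ℝ → ℝ} (hg : Measurable g)
    (hint : IntegrableOn (fun z => g z * (1 + z ^ (-β))) (Set.Ioi 0))
    (hf : ∀ x, 0 ≤ x → f x = ∫ z in (0 : ℝ)..x, g z) :
    (∀ᶠ t in atTop, Summable fun k => f (p k * t)) ∧
      Tendsto (fun t => (∑' k, f (p k * t)) / rho p t) atTop
        (𝓝 (∫ z in Set.Ioi 0, g z * z ^ (-α))) := by
  obtain ⟨C, hC, hpot⟩ := exists_rho_div_le hp hL hρ hβ hβ0
  have hkey : ∀ᶠ t in atTop,
      HasSum (fun k => f (p k * t)) (∫ z in Set.Ioi 0, g z * rho p (t / z)) := by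
    filter_upwards [hpot, eventually_ge_atTop 0] with t h1 h2
    simp only [hf _ (mul_nonneg (hp.nonneg _) h2)]
    refine hasSum_primitive hp hg h2 ?_
    refine ((hint.norm.const_mul (C * rho p t))).mono'
      (hg.aestronglyMeasurable.mul (aestronglyMeasurable_rho_div hp t)) ?_
    filter_upwards [ae_restrict_mem measurableSet_Ioi] with z hz
    have hz' : (0 : ℝ) < z := hz
    have h3 : 0 ≤ z ^ (-β) := Real.rpow_nonneg hz'.le _
    rw [norm_mul, norm_mul, Real.norm_of_nonneg (rho_nonneg _),
      Real.norm_of_nonneg (by linarith : 0 ≤ 1 + z ^ (-β))]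
    calc ‖g z‖ * rho p (t / z) ≤ ‖g z‖ * (C * (1 + z ^ (-β)) * rho p t) := by
          gcongr; exact h1 z hz'
      _ = _ := by ring
  refine ⟨hkey.mono fun t h => h.summable, ?_⟩
  have hlim : Tendsto (fun t => ∫ z in Set.Ioi 0, g z * (rho p (t / z) / rho p t)) atTop
      (𝓝 (∫ z in Set.Ioi 0, g z * z ^ (-α))) := by
    refine tendsto_integral_filter_of_dominated_convergence
      (fun z => C * ‖g z * (1 + z ^ (-β))‖) (Eventually.of_forall fun t => ?_) ?_
      (hint.norm.const_mul C) ?_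
    · simp only [div_eq_mul_inv _ (rho p t)]
      exact hg.aestronglyMeasurable.mul
        (AEStronglyMeasurable.mul_const (aestronglyMeasurable_rho_div hp t) _)
    · filter_upwards [hpot, eventually_rho_pos hp] with t h1 h2
      filter_upwards [ae_restrict_mem measurableSet_Ioi] with z hz
      have hz' : (0 : ℝ) < z := hz
      have h3 : 0 ≤ z ^ (-β) := Real.rpow_nonneg hz'.le _
      rw [norm_mul, norm_mul, Real.norm_of_nonneg (div_nonneg (rho_nonneg _) h2.le),
        Real.norm_of_nonneg (by linarith : 0 ≤ 1 + z ^ (-β))]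
      have h4 : rho p (t / z) / rho p t ≤ C * (1 + z ^ (-β)) := by
        rw [div_le_iff₀ h2]; exact h1 z hz'
      calc ‖g z‖ * (rho p (t / z) / rho p t) ≤ ‖g z‖ * (C * (1 + z ^ (-β))) := by gcongr
        _ = _ := by ring
    · filter_upwards [ae_restrict_mem measurableSet_Ioi] with z hz
      have hz' : (0 : ℝ) < z := hz
      have h5 := tendsto_rho_div hL hρ (inv_pos.2 hz')
      simp only [inv_mul_eq_div] at h5
      rw [Real.inv_rpow hz'.le, ← Real.rpow_neg hz'.le] at h5
      exact h5.const_mul _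
  refine hlim.congr' ?_
  filter_upwards [hkey] with t h1
  rw [h1.tsum_eq, ← integral_div]
  simp only [mul_div_assoc]

end AbelianTheorem

end Karlin

/-! ### Poisson weights and the asymptotics of mean and variance -/

namespace Karlin

section PoissonWeight

theorem poissonWeight_nonneg (i : ℕ) {x : ℝ} (hx : 0 ≤ x) : 0 ≤ poissonWeight i x := by
  unfold poissonWeight; positivity

theorem continuous_poissonWeight (i : ℕ) : Continuous (poissonWeight i) := by
  unfold poissonWeight; fun_prop

theorem poissonWeight_le_one (i : ℕ) {x : ℝ} (hx : 0 ≤ x) : poissonWeight i x ≤ 1 := by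
  have h := Real.pow_div_factorial_le_exp x hx i
  have h2 : Real.exp (-x) * Real.exp x = 1 := by rw [← Real.exp_add]; simp
  calc poissonWeight i x = Real.exp (-x) * (x ^ i / i !) := by rw [poissonWeight]; ring
    _ ≤ Real.exp (-x) * Real.exp x := by gcongr
    _ = 1 := h2

theorem poissonWeight_succ_le (i : ℕ) {x : ℝ} (hx : 0 ≤ x) : poissonWeight (i + 1) x ≤ x := by
  have h := poissonWeight_le_one i hx
  have h0 := poissonWeight_nonneg i hx
  have h1 : poissonWeight (i + 1) x = x * poissonWeight i x / (i + 1) := by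
    rw [poissonWeight, poissonWeight, Nat.factorial_succ, pow_succ]
    push_cast
    field_simp
  have h2 : (1 : ℝ) ≤ i + 1 := by linarith [Nat.cast_nonneg (α := ℝ) i]
  rw [h1, div_le_iff₀ (by positivity)]
  nlinarith

theorem poissonWeight_succ_lt_one (i : ℕ) {x : ℝ} (hx : 0 < x) : poissonWeight (i + 1) x < 1 := by
  have h : x ^ (i + 1) / (i + 1)! < Real.exp x := by
    have h1 := Real.sum_le_exp_of_nonneg hx.le (i + 2)
    rw [Finset.sum_range_succ, Finset.sum_range_succ'] at h1
    have h2 : 0 ≤ ∑ k ∈ Finset.range i, x ^ (k + 1) / (k + 1)! :=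
      Finset.sum_nonneg fun k _ => by positivity
    simp only [pow_zero, Nat.factorial_zero, Nat.cast_one, div_one] at h1
    linarith
  have h2 : Real.exp (-x) * Real.exp x = 1 := by rw [← Real.exp_add]; simp
  calc poissonWeight (i + 1) x = Real.exp (-x) * (x ^ (i + 1) / (i + 1)!) := by
        rw [poissonWeight]; ring
    _ < Real.exp (-x) * Real.exp x := by gcongr
    _ = 1 := h2

theorem tendsto_poissonWeight (i : ℕ) : Tendsto (poissonWeight i) atTop (𝓝 0) := by
  have h := (Real.tendsto_pow_mul_exp_neg_atTop_nhds_zero i).div_const (i ! : ℝ)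
  simp only [zero_div] at h
  refine h.congr fun x => ?_
  rw [poissonWeight]; ring

theorem hasDerivAt_poissonWeight (i : ℕ) (x : ℝ) :
    HasDerivAt (poissonWeight (i + 1)) (poissonWeight i x - poissonWeight (i + 1) x) x := by
  have h1 : HasDerivAt (fun x : ℝ => Real.exp (-x)) (-Real.exp (-x)) x := by
    simpa using (hasDerivAt_neg x).exp
  have h2 := (h1.mul (hasDerivAt_pow (i + 1) x)).div_const ((i + 1)! : ℝ)
  refine h2.congr_deriv ?_
  rw [poissonWeight, poissonWeight, Nat.factorial_succ]
  push_cast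
  field_simp
  ring

theorem poissonWeight_mul_rpow {i : ℕ} {a z : ℝ} (hz : 0 < z) :
    poissonWeight i z * z ^ (-a) = (i ! : ℝ)⁻¹ * (z ^ ((i + 1 - a) - 1) * Real.exp (-(1 * z))) := by
  rw [show ((i : ℝ) + 1 - a) - 1 = i + -a by ring, Real.rpow_add hz, Real.rpow_natCast,
    poissonWeight, one_mul]
  field_simp

theorem poissonWeight_mul_mul_rpow {i l : ℕ} {a z : ℝ} (hz : 0 < z) :
    poissonWeight i z * poissonWeight l z * z ^ (-a) =
      ((i ! : ℝ) * l !)⁻¹ * (z ^ ((i + l + 1 - a) - 1) * Real.exp (-(2 * z))) := by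
  rw [show ((i : ℝ) + l + 1 - a) - 1 = i + l + -a by ring, Real.rpow_add hz, Real.rpow_add hz,
    Real.rpow_natCast, Real.rpow_natCast, poissonWeight, poissonWeight,
    show -(2 * z) = -z + -z by ring, Real.exp_add]
  field_simp

theorem integrableOn_rpow_mul_exp {a r : ℝ} (ha : 0 < a) (hr : 0 < r) :
    IntegrableOn (fun z : ℝ => z ^ (a - 1) * Real.exp (-(r * z))) (Set.Ioi 0) := by
  have h := integrableOn_rpow_mul_exp_neg_mul_rpow (s := a - 1) (p := 1) (b := r) (by linarith)
    one_pos hr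
  simpa [Real.rpow_one] using h

theorem integrableOn_poissonWeight (i : ℕ) {a : ℝ} (ha : a < i + 1) :
    IntegrableOn (fun z => poissonWeight i z * z ^ (-a)) (Set.Ioi 0) := by
  refine IntegrableOn.congr_fun ((integrableOn_rpow_mul_exp (a := i + 1 - a) (by linarith)
    one_pos).const_mul ((i ! : ℝ)⁻¹)) (fun z hz => ?_) measurableSet_Ioi
  exact (poissonWeight_mul_rpow hz).symm

theorem integral_poissonWeight (i : ℕ) {a : ℝ} (ha : a < i + 1) :
    ∫ z in Set.Ioi 0, poissonWeight i z * z ^ (-a) = Real.Gamma (i + 1 - a) / i ! := by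
  rw [setIntegral_congr_fun measurableSet_Ioi fun z hz => poissonWeight_mul_rpow hz,
    integral_const_mul, Real.integral_rpow_mul_exp_neg_mul_Ioi (by linarith) one_pos]
  simp
  ring

theorem integrableOn_poissonWeight_mul (i l : ℕ) {a : ℝ} (ha : a < i + l + 1) :
    IntegrableOn (fun z => poissonWeight i z * poissonWeight l z * z ^ (-a)) (Set.Ioi 0) := by
  refine IntegrableOn.congr_fun ((integrableOn_rpow_mul_exp (a := i + l + 1 - a) (by linarith)
    two_pos).const_mul (((i ! : ℝ) * l !)⁻¹)) (fun z hz => ?_) measurableSet_Ioi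
  exact (poissonWeight_mul_mul_rpow hz).symm

theorem integral_poissonWeight_mul (i l : ℕ) {a : ℝ} (ha : a < i + l + 1) :
    ∫ z in Set.Ioi 0, poissonWeight i z * poissonWeight l z * z ^ (-a) =
      (1 / 2) ^ (i + l + 1 - a) * Real.Gamma (i + l + 1 - a) / ((i ! : ℝ) * l !) := by
  rw [setIntegral_congr_fun measurableSet_Ioi fun z hz => poissonWeight_mul_mul_rpow hz,
    integral_const_mul, Real.integral_rpow_mul_exp_neg_mul_Ioi (by linarith) two_pos]
  ring

/-- The limit `α Γ(j - α) / j!` of `E K*_j(t) / ρ(t)`. -/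
noncomputable def meanConst (j : ℕ) (α : ℝ) : ℝ := α * (Real.Gamma (j - α) / (j ! : ℝ))

/-- The derivative of `poissonWeight (i + 1)`, integrated against `z^{-α}`. -/
theorem integral_deriv_poissonWeight (i : ℕ) {α : ℝ} (hα1 : α < 1) :
    ∫ z in Set.Ioi 0, (poissonWeight i z - poissonWeight (i + 1) z) * z ^ (-α) =
      meanConst (i + 1) α := by
  have hi : (0 : ℝ) ≤ i := Nat.cast_nonneg i
  simp only [sub_mul]
  rw [integral_sub (integrableOn_poissonWeight i (by linarith))
    (integrableOn_poissonWeight (i + 1) (by push_cast; linarith)),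
    integral_poissonWeight i (by linarith), integral_poissonWeight (i + 1) (by push_cast; linarith)]
  have h1 : Real.Gamma ((i + 1 : ℕ) + 1 - α) = (i + 1 - α) * Real.Gamma (i + 1 - α) := by
    rw [← Real.Gamma_add_one (by linarith)]
    congr 1
    push_cast
    ring
  rw [h1, meanConst, Nat.factorial_succ]
  push_cast
  field_simp
  ring

theorem half_rpow (i : ℕ) (α : ℝ) : (1 / 2 : ℝ) ^ (2 * (i : ℝ) - α) = 2 ^ α / 2 ^ (2 * i) := by
  rw [one_div, Real.inv_rpow two_pos.le, ← Real.rpow_neg two_pos.le,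
    show -(2 * (i : ℝ) - α) = α - ((2 * i : ℕ) : ℝ) by push_cast; ring, Real.rpow_sub two_pos,
    Real.rpow_natCast]

/-- The derivative of `poissonWeight (i + 1) ^ 2`, integrated against `z^{-α}`. -/
theorem integral_deriv_poissonWeight_sq (i : ℕ) {α : ℝ} (hα1 : α < 1) :
    ∫ z in Set.Ioi 0, (2 * poissonWeight (i + 1) z *
        (poissonWeight i z - poissonWeight (i + 1) z)) * z ^ (-α) =
      meanConst (i + 1) α - varConst (i + 1) α := by
  have hi : (0 : ℝ) ≤ i := Nat.cast_nonneg i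
  have h0 : ∀ z : ℝ, (2 * poissonWeight (i + 1) z *
        (poissonWeight i z - poissonWeight (i + 1) z)) * z ^ (-α) =
      2 * (poissonWeight (i + 1) z * poissonWeight i z * z ^ (-α) -
        poissonWeight (i + 1) z * poissonWeight (i + 1) z * z ^ (-α)) := fun z => by ring
  simp only [h0]
  rw [integral_const_mul,
    integral_sub (integrableOn_poissonWeight_mul _ _ (by push_cast; linarith))
    (integrableOn_poissonWeight_mul _ _ (by push_cast; linarith)),
    integral_poissonWeight_mul _ _ (by push_cast; linarith),
    integral_poissonWeight_mul _ _ (by push_cast; linarith)]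
  have h1 : ((i + 1 : ℕ) : ℝ) + i + 1 - α = 2 * ((i + 1 : ℕ) : ℝ) - α := by push_cast; ring
  have h2 : ((i + 1 : ℕ) : ℝ) + (i + 1 : ℕ) + 1 - α = (2 * ((i + 1 : ℕ) : ℝ) - α) + 1 := by
    push_cast; ring
  rw [h1, h2, Real.Gamma_add_one (by push_cast; linarith), Real.rpow_add (by norm_num),
    half_rpow, meanConst, varConst, Nat.factorial_succ]
  push_cast
  field_simp
  ring

/-- `c_{j,α} = ∫₀^∞ (q_j - q_j²)(z) α z^{-α-1} dz`, where `0 < q_j < 1` on `(0, ∞)`. -/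
theorem varConst_pos {j : ℕ} (hj : 1 ≤ j) {α : ℝ} (hα0 : 0 < α) (hα1 : α < 1) :
    0 < varConst j α := by
  obtain ⟨i, rfl⟩ : ∃ i, j = i + 1 := ⟨j - 1, by omega⟩
  have hi : (0 : ℝ) ≤ i := Nat.cast_nonneg i
  have hi1 := integrableOn_poissonWeight (i + 1) (a := α + 1) (by push_cast; linarith)
  have hi2 := integrableOn_poissonWeight_mul (i + 1) (i + 1) (a := α + 1) (by push_cast; linarith)
  have h1 : varConst (i + 1) α = α * ∫ z in Set.Ioi 0,
      (poissonWeight (i + 1) z * z ^ (-(α + 1)) -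
        poissonWeight (i + 1) z * poissonWeight (i + 1) z * z ^ (-(α + 1))) := by
    rw [integral_sub hi1 hi2, integral_poissonWeight _ (by push_cast; linarith),
      integral_poissonWeight_mul _ _ (by push_cast; linarith), varConst]
    have h1 : ((i + 1 : ℕ) : ℝ) + 1 - (α + 1) = (i + 1 : ℕ) - α := by ring
    have h2 : ((i + 1 : ℕ) : ℝ) + (i + 1 : ℕ) + 1 - (α + 1) = 2 * ((i + 1 : ℕ) : ℝ) - α := by
      ring
    rw [h1, h2, half_rpow]
    field_simp
  rw [h1]
  refine mul_pos hα0 ?_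
  have hpos : ∀ z ∈ Set.Ioi (0 : ℝ), 0 < poissonWeight (i + 1) z * z ^ (-(α + 1)) -
        poissonWeight (i + 1) z * poissonWeight (i + 1) z * z ^ (-(α + 1)) := by
    intro z hz
    have hz' : (0 : ℝ) < z := hz
    have h3 := poissonWeight_succ_lt_one i hz'
    have h4 : 0 < poissonWeight (i + 1) z := by unfold poissonWeight; positivity
    have h5 : 0 < z ^ (-(α + 1)) := Real.rpow_pos_of_pos hz' _
    have : poissonWeight (i + 1) z * z ^ (-(α + 1)) -
        poissonWeight (i + 1) z * poissonWeight (i + 1) z * z ^ (-(α + 1)) =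
        poissonWeight (i + 1) z * (1 - poissonWeight (i + 1) z) * z ^ (-(α + 1)) := by ring
    rw [this]
    have : 0 < 1 - poissonWeight (i + 1) z := by linarith
    positivity
  rw [setIntegral_pos_iff_support_of_nonneg_ae]
  · have : Function.support (fun z => poissonWeight (i + 1) z * z ^ (-(α + 1)) -
        poissonWeight (i + 1) z * poissonWeight (i + 1) z * z ^ (-(α + 1))) ∩ Set.Ioi 0 =
        Set.Ioi 0 := Set.inter_eq_right.2 fun z hz => (hpos z hz).ne'
    rw [this]
    simp
  · filter_upwards [ae_restrict_mem measurableSet_Ioi] with z hz using (hpos z hz).le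
  · exact hi1.sub hi2

end PoissonWeight

section Asymptotics

variable {p : ℕ → ℝ} {α : ℝ} {L : ℝ → ℝ}

theorem IsBoxDistribution.summable_poissonWeight (hp : IsBoxDistribution p) {j : ℕ} (hj : 1 ≤ j)
    {t : ℝ} (ht : 0 ≤ t) : Summable fun k => poissonWeight j (p k * t) := by
  obtain ⟨i, rfl⟩ : ∃ i, j = i + 1 := ⟨j - 1, by omega⟩
  exact (hp.summable_mul t).of_nonneg_of_le
    (fun k => poissonWeight_nonneg _ (mul_nonneg (hp.nonneg k) ht))
    fun k => poissonWeight_succ_le i (mul_nonneg (hp.nonneg k) ht)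

theorem tendsto_sum_poissonWeight_div_rho (hp : IsBoxDistribution p) (hα0 : 0 < α) (hα1 : α < 1)
    (hL : IsSlowlyVarying L) (hρ : rho p ~[atTop] fun t => t ^ α * L t) {j : ℕ} (hj : 1 ≤ j) :
    Tendsto (fun t => (∑' k, poissonWeight j (p k * t)) / rho p t) atTop
      (𝓝 (meanConst j α)) := by
  obtain ⟨i, rfl⟩ : ∃ i, j = i + 1 := ⟨j - 1, by omega⟩
  have hi : (0 : ℝ) ≤ i := Nat.cast_nonneg i
  set β := (1 + α) / 2 with hβ
  have hβ1 : β < 1 := by rw [hβ]; linarith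
  rw [← integral_deriv_poissonWeight i hα1]
  have hcont : Continuous fun z => poissonWeight i z - poissonWeight (i + 1) z :=
    (continuous_poissonWeight i).sub (continuous_poissonWeight (i + 1))
  refine (tendsto_tsum_primitive_div_rho hp hL hρ (β := β) (by rw [hβ]; linarith)
    (by rw [hβ]; linarith) hcont.measurable ?_ fun x hx => ?_).2
  · have h1 : ∀ a : ℝ, a < 1 → IntegrableOn
        (fun z => (poissonWeight i z - poissonWeight (i + 1) z) * z ^ (-a)) (Set.Ioi 0) := by
      intro a ha
      simp only [sub_mul]
      exact (integrableOn_poissonWeight i (by linarith)).sub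
        (integrableOn_poissonWeight (i + 1) (by push_cast; linarith))
    have h2 := (h1 0 one_pos).add (h1 β hβ1)
    refine h2.congr (ae_of_all _ fun z => ?_)
    simp
    ring
  · rw [intervalIntegral.integral_eq_sub_of_hasDerivAt
      (fun z _ => hasDerivAt_poissonWeight i z) (hcont.intervalIntegrable _ _)]
    simp [poissonWeight]

theorem tendsto_sum_poissonWeight_sq_div_rho (hp : IsBoxDistribution p) (hα0 : 0 < α)
    (hα1 : α < 1) (hL : IsSlowlyVarying L) (hρ : rho p ~[atTop] fun t => t ^ α * L t) {j : ℕ}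
    (hj : 1 ≤ j) :
    Tendsto (fun t => (∑' k, poissonWeight j (p k * t) ^ 2) / rho p t) atTop
      (𝓝 (meanConst j α - varConst j α)) := by
  obtain ⟨i, rfl⟩ : ∃ i, j = i + 1 := ⟨j - 1, by omega⟩
  have hi : (0 : ℝ) ≤ i := Nat.cast_nonneg i
  set β := (1 + α) / 2 with hβ
  have hβ1 : β < 1 := by rw [hβ]; linarith
  rw [← integral_deriv_poissonWeight_sq i hα1]
  have hcont : Continuous fun z => 2 * poissonWeight (i + 1) z *
      (poissonWeight i z - poissonWeight (i + 1) z) :=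
    ((continuous_poissonWeight _).const_mul 2).mul
      ((continuous_poissonWeight i).sub (continuous_poissonWeight (i + 1)))
  refine (tendsto_tsum_primitive_div_rho hp hL hρ (β := β)
    (f := fun x => poissonWeight (i + 1) x ^ 2)
    (by rw [hβ]; linarith) (by rw [hβ]; linarith) hcont.measurable ?_ fun x hx => ?_).2
  · have h1 : ∀ a : ℝ, a < 1 → IntegrableOn (fun z => 2 * (poissonWeight (i + 1) z *
        poissonWeight i z * z ^ (-a) - poissonWeight (i + 1) z * poissonWeight (i + 1) z *
        z ^ (-a))) (Set.Ioi 0) := by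
      intro a ha
      exact ((integrableOn_poissonWeight_mul _ _ (by push_cast; linarith)).sub
        (integrableOn_poissonWeight_mul _ _ (by push_cast; linarith))).const_mul 2
    have h2 := (h1 0 one_pos).add (h1 β hβ1)
    refine h2.congr (ae_of_all _ fun z => ?_)
    simp
    ring
  · have h3 : ∀ z, HasDerivAt (fun x => poissonWeight (i + 1) x ^ 2) (2 * poissonWeight (i + 1) z *
        (poissonWeight i z - poissonWeight (i + 1) z)) z := fun z => by
      refine ((hasDerivAt_poissonWeight i z).fun_pow 2).congr_deriv ?_
      simp
    rw [intervalIntegral.integral_eq_sub_of_hasDerivAt (fun z _ => h3 z)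
      (hcont.intervalIntegrable _ _)]
    simp [poissonWeight]

theorem tendsto_sum_poissonWeight_variance_div_rho (hp : IsBoxDistribution p) (hα0 : 0 < α)
    (hα1 : α < 1) (hL : IsSlowlyVarying L) (hρ : rho p ~[atTop] fun t => t ^ α * L t) {j : ℕ}
    (hj : 1 ≤ j) :
    Tendsto (fun t => (∑' k, poissonWeight j (p k * t) * (1 - poissonWeight j (p k * t))) /
      rho p t) atTop (𝓝 (varConst j α)) := by
  have h1 := (tendsto_sum_poissonWeight_div_rho hp hα0 hα1 hL hρ hj).sub
    (tendsto_sum_poissonWeight_sq_div_rho hp hα0 hα1 hL hρ hj)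
  rw [sub_sub_cancel] at h1
  refine h1.congr' ?_
  filter_upwards [eventually_ge_atTop 0] with t ht
  have hs := hp.summable_poissonWeight hj ht
  have hs2 : Summable fun k => poissonWeight j (p k * t) ^ 2 := by
    refine hs.of_nonneg_of_le (fun k => sq_nonneg _) fun k => ?_
    have h2 := mul_nonneg (hp.nonneg k) ht
    nlinarith [poissonWeight_nonneg j h2, poissonWeight_le_one j h2]
  rw [← sub_div, ← hs.tsum_sub hs2]
  congr 2
  ext k
  ring

/-- Boxes with `t pₖ` outside `(a⁻¹, a]` contribute little to `E K*_j(t)` when `a` is large: those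
with `t pₖ > a` because there are at most `ρ(t)` of them and the Poisson weight is small far out,
those with `t pₖ ≤ a⁻¹` because the weight is at most `t pₖ`. -/
theorem exists_window (hp : IsBoxDistribution p) (hα0 : 0 < α) (hα1 : α < 1)
    (hL : IsSlowlyVarying L) (hρ : rho p ~[atTop] fun t => t ^ α * L t) {j : ℕ} (hj : 1 ≤ j)
    {ε : ℝ} (hε : 0 < ε) :
    ∃ a : ℝ, 1 < a ∧ ∀ᶠ t in atTop,
      (∑' k, if a⁻¹ < p k * t ∧ p k * t ≤ a then 0 else poissonWeight j (p k * t)) ≤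
        ε * rho p t := by
  obtain ⟨i, rfl⟩ : ∃ i, j = i + 1 := ⟨j - 1, by omega⟩
  have hlim1 := (tendsto_poissonWeight (i + 1)).eventually_lt_const (half_pos hε)
  obtain ⟨a₀, ha₀⟩ := eventually_atTop.1 hlim1
  have hlim2 : Tendsto (fun a : ℝ => a ^ (-(1 - α)) / (1 - α)) atTop (𝓝 0) := by
    simpa using (tendsto_rpow_neg_atTop (sub_pos.2 hα1)).div_const (1 - α)
  obtain ⟨a, ha1, ha2, ha3⟩ := ((eventually_gt_atTop 1).and ((eventually_ge_atTop a₀).and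
    (hlim2.eventually_lt_const (half_pos hε)))).exists
  have ha0 : 0 < a := one_pos.trans ha1
  refine ⟨a, ha1, ?_⟩
  set β := (1 + α) / 2 with hβ
  have hβ1 : β < 1 := by rw [hβ]; linarith
  -- The primitive of `g` is `min x a⁻¹`, to which the Abelian theorem applies.
  let g : ℝ → ℝ := fun z => if z ≤ a⁻¹ then 1 else 0
  have hg : Measurable g := Measurable.ite measurableSet_Iic measurable_const measurable_const
  have hpow : ∀ c : ℝ, c < 1 → IntegrableOn (fun z : ℝ => z ^ (-c)) (Set.Ioc 0 a⁻¹) := by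
    intro c hc
    have h := intervalIntegral.intervalIntegrable_rpow' (a := 0) (b := a⁻¹) (r := -c) (by linarith)
    rwa [intervalIntegrable_iff_integrableOn_Ioc_of_le (by positivity)] at h
  have hgind : ∀ f : ℝ → ℝ, (Set.Ioi 0).indicator (fun z => g z * f z) =
      (Set.Ioc 0 a⁻¹).indicator f := by
    intro f
    ext z
    by_cases h1 : 0 < z <;> by_cases h2 : z ≤ a⁻¹ <;> simp [g, h1, h2]
  have hval : ∫ z in Set.Ioi 0, g z * z ^ (-α) = a ^ (-(1 - α)) / (1 - α) := by
    rw [← integral_indicator measurableSet_Ioi, hgind, integral_indicator measurableSet_Ioc,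
      ← intervalIntegral.integral_of_le (by positivity), integral_rpow (Or.inl (by linarith)),
      Real.zero_rpow (by linarith), Real.inv_rpow ha0.le, ← Real.rpow_neg ha0.le]
    ring_nf
  have hfx : ∀ x : ℝ, 0 ≤ x → (x ≤ a⁻¹ → x ≤ ∫ z in (0 : ℝ)..x, g z) ∧
      0 ≤ ∫ z in (0 : ℝ)..x, g z := by
    intro x hx
    refine ⟨fun hxa => ?_, intervalIntegral.integral_nonneg hx fun z _ => ?_⟩
    · rw [intervalIntegral.integral_congr (g := fun _ => (1 : ℝ))]
      · simp
      · intro z hz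
        rw [Set.uIcc_of_le hx] at hz
        simp [g, hz.2.trans hxa]
    · simp only [g]; split_ifs <;> norm_num
  obtain ⟨hsum, htend⟩ := tendsto_tsum_primitive_div_rho hp hL hρ (β := β)
    (f := fun x => ∫ z in (0 : ℝ)..x, g z) (by rw [hβ]; linarith) (by rw [hβ]; linarith) hg
    (by
      rw [← integrable_indicator_iff measurableSet_Ioi, hgind,
        integrable_indicator_iff measurableSet_Ioc]
      have h1 := (hpow 0 one_pos).add (hpow β hβ1)
      refine h1.congr (ae_of_all _ fun z => ?_)
      simp) fun x _ => rfl
  rw [hval] at htend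
  filter_upwards [hsum, htend.eventually_lt_const ha3, eventually_rho_pos hp,
    eventually_ge_atTop 0] with t h1 h2 h3 h4
  rw [div_lt_iff₀ h3] at h2
  have h5 := (hasSum_rho hp (t := t) one_pos).mul_left (ε / 2)
  rw [div_one] at h5
  have hx : ∀ k, 0 ≤ p k * t := fun k => mul_nonneg (hp.nonneg k) h4
  have hterm : ∀ k, (if a⁻¹ < p k * t ∧ p k * t ≤ a then 0 else poissonWeight (i + 1) (p k * t)) ≤
      (∫ z in (0 : ℝ)..(p k * t), g z) + ε / 2 * (if 1 ≤ p k * t then 1 else 0) := by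
    intro k
    obtain ⟨h6, h7⟩ := hfx _ (hx k)
    split_ifs with hk h8 h8
    · linarith [hε]
    · linarith
    · rcases le_or_gt (p k * t) a⁻¹ with h9 | h9
      · have := poissonWeight_succ_le i (hx k)
        have := h6 h9
        linarith [hε]
      · have h10 : a < p k * t := not_le.1 fun h => hk ⟨h9, h⟩
        have := ha₀ (p k * t) (ha2.trans h10.le)
        linarith
    · have h9 : p k * t ≤ a⁻¹ := by
        by_contra h9
        push Not at h9
        exact hk ⟨h9, (not_le.1 h8).le.trans ha1.le⟩
      have := poissonWeight_succ_le i (hx k)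
      have := h6 h9
      linarith
  have hs : Summable fun k => if a⁻¹ < p k * t ∧ p k * t ≤ a then 0 else
      poissonWeight (i + 1) (p k * t) := by
    refine (hp.summable_poissonWeight hj h4).of_nonneg_of_le (fun k => ?_) fun k => ?_
    · split_ifs
      · exact le_rfl
      · exact poissonWeight_nonneg _ (hx k)
    · split_ifs
      · exact poissonWeight_nonneg _ (hx k)
      · exact le_rfl
  calc _ ≤ ∑' k, ((∫ z in (0 : ℝ)..(p k * t), g z) + ε / 2 * (if 1 ≤ p k * t then 1 else 0)) :=
        hs.tsum_le_tsum hterm (h1.add h5.summable)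
    _ = (∑' k, ∫ z in (0 : ℝ)..(p k * t), g z) + ε / 2 * rho p t := by
        rw [h1.tsum_add h5.summable, h5.tsum_eq]
    _ ≤ ε * rho p t := by linarith

end Asymptotics

end Karlin

/-! ### Small counts as sums of independent indicators, and their increments -/

namespace Karlin

variable {Ω : Type*} [MeasurableSpace Ω] {μ : Measure Ω} {T : ℕ → Ω → ℝ} {X : ℕ → Ω → ℕ}
  {p : ℕ → ℝ}

section PathProperties

theorem IsPoissonizedScheme.ae_eventually_lt_throwTime [IsProbabilityMeasure μ]
    (h : IsPoissonizedScheme p μ T X) :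
    ∀ᵐ ω ∂μ, ∀ t : ℝ, ∃ n, ∀ i, n ≤ i → t < throwTime T i ω := by
  filter_upwards [ae_tendsto_sum h.measurable_T h.law_T h.indep_T] with ω hω t
  obtain ⟨n, hn⟩ := eventually_atTop.1 (hω.eventually_gt_atTop t)
  exact ⟨n, fun i hi => hn (i + 1) (by omega)⟩

/-- The hypothesis on `ω`, which holds almost surely, is that finitely many balls are thrown by any
time. Monotonicity may fail without it, an infinite count being read as `0`. -/
theorem boxCount_mono {Ω : Type*} {T : ℕ → Ω → ℝ} {X : ℕ → Ω → ℕ} {ω : Ω}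
    (hω : ∀ t : ℝ, ∃ n, ∀ i, n ≤ i → t < throwTime T i ω) (k : ℕ) {s t : ℝ}
    (hst : s ≤ t) : boxCount T X k s ω ≤ boxCount T X k t ω := by
  obtain ⟨n, hn⟩ := hω t
  rw [boxCount_eq_card hn, boxCount_eq_card fun i hi => hst.trans_lt (hn i hi)]
  exact Finset.card_le_card fun i hi => by
    simp only [Finset.mem_filter] at hi ⊢
    exact ⟨hi.1, hi.2.1.trans hst, hi.2.2⟩

theorem finite_boxCount_ne_zero {Ω : Type*} {T : ℕ → Ω → ℝ} {X : ℕ → Ω → ℕ} {ω : Ω}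
    (hω : ∀ t : ℝ, ∃ n, ∀ i, n ≤ i → t < throwTime T i ω) (t : ℝ) :
    {k | boxCount T X k t ω ≠ 0}.Finite := by
  obtain ⟨n, hn⟩ := hω t
  refine (((Finset.range n).image fun i => X i ω).finite_toSet).subset fun k hk => ?_
  have hk' : boxCount T X k t ω ≠ 0 := hk
  rw [boxCount_eq_card hn, Finset.card_ne_zero] at hk'
  obtain ⟨i, hi⟩ := hk'
  simp only [Finset.mem_filter] at hi
  simp only [Finset.coe_image, Set.mem_image]
  exact ⟨i, hi.1, hi.2.2⟩

end PathProperties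

section BoxTerm

/-- The indicator that the numbers of balls in box `k` at the times `s k` and `t k` form a pair
in `B k`. -/
noncomputable def boxTerm (T : ℕ → Ω → ℝ) (X : ℕ → Ω → ℕ) (B : ℕ → Set (ℕ × ℕ)) (s t : ℕ → ℝ)
    (k : ℕ) (ω : Ω) : ℝ :=
  (B k).indicator (fun _ => (1 : ℝ)) (boxCount T X k (s k) ω, boxCount T X k (t k) ω)

variable (B : ℕ → Set (ℕ × ℕ)) (s t : ℕ → ℝ)

theorem boxTerm_mem_Icc {Ω : Type*} {T : ℕ → Ω → ℝ} {X : ℕ → Ω → ℕ}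
    (k : ℕ) (ω : Ω) : boxTerm T X B s t k ω ∈ Set.Icc (0 : ℝ) 1 := by
  unfold boxTerm Set.indicator
  split_ifs <;> simp

theorem IsPoissonizedScheme.measurable_boxTerm (h : IsPoissonizedScheme p μ T X) (k : ℕ) :
    Measurable (boxTerm T X B s t k) := by
  have h1 : Measurable ((B k).indicator fun _ => (1 : ℝ)) := measurable_of_countable _
  exact h1.comp ((measurable_boxCount h.measurable_T h.measurable_X k _).prodMk
    (measurable_boxCount h.measurable_T h.measurable_X k _))

theorem IsPoissonizedScheme.iIndepFun_boxTerm [IsProbabilityMeasure μ] (hp : IsBoxDistribution p)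
    (h : IsPoissonizedScheme p μ T X) : iIndepFun (boxTerm T X B s t) μ :=
  (h.iIndepFun_boxCount hp s t).comp (fun k => (B k).indicator fun _ => (1 : ℝ))
    fun _ => measurable_of_countable _

theorem IsPoissonizedScheme.integral_boxTerm [IsProbabilityMeasure μ]
    (h : IsPoissonizedScheme p μ T X) (k : ℕ) :
    ∫ ω, boxTerm T X B s t k ω ∂μ =
      μ.real {ω | (boxCount T X k (s k) ω, boxCount T X k (t k) ω) ∈ B k} := by
  have h1 : Measurable fun ω => (boxCount T X k (s k) ω, boxCount T X k (t k) ω) :=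
    (measurable_boxCount h.measurable_T h.measurable_X k _).prodMk
    (measurable_boxCount h.measurable_T h.measurable_X k _)
  have h2 : MeasurableSet {ω | (boxCount T X k (s k) ω, boxCount T X k (t k) ω) ∈ B k} :=
    h1 (MeasurableSet.of_discrete)
  have h3 : boxTerm T X B s t k = Set.indicator
      {ω | (boxCount T X k (s k) ω, boxCount T X k (t k) ω) ∈ B k} (fun _ => (1 : ℝ)) := by
    ext ω
    simp only [boxTerm, Set.indicator]
    rfl
  rw [h3, integral_indicator_const _ h2, smul_eq_mul, mul_one]

theorem IsPoissonizedScheme.variance_boxTerm [IsProbabilityMeasure μ]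
    (h : IsPoissonizedScheme p μ T X) (k : ℕ) :
    variance (boxTerm T X B s t k) μ = (∫ ω, boxTerm T X B s t k ω ∂μ) *
      (1 - ∫ ω, boxTerm T X B s t k ω ∂μ) := by
  rw [variance_eq_sub (memLp_of_mem_Icc (h.measurable_boxTerm B s t k) (boxTerm_mem_Icc B s t k))]
  have h1 : boxTerm T X B s t k ^ 2 = boxTerm T X B s t k := by
    ext ω
    simp only [Pi.pow_apply, boxTerm, Set.indicator]
    split_ifs <;> simp
  rw [h1]
  ring

end BoxTerm

section SmallCount

/-- The pairs of counts whose second entry is `j`. -/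
def exactly (j : ℕ) : Set (ℕ × ℕ) := {x | x.2 = j}

/-- This holds for infinite sets as well, where both sides are `0` by convention. -/
theorem tsum_boxTerm_eq_ncard {Ω : Type*} {T : ℕ → Ω → ℝ} {X : ℕ → Ω → ℕ}
    {B : ℕ → Set (ℕ × ℕ)} {s t : ℕ → ℝ} {ω : Ω} :
    ∑' k, boxTerm T X B s t k ω =
      ({k | (boxCount T X k (s k) ω, boxCount T X k (t k) ω) ∈ B k}.ncard : ℝ) := by
  classical
  set A := {k | (boxCount T X k (s k) ω, boxCount T X k (t k) ω) ∈ B k} with hA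
  have h1 : ∀ k, boxTerm T X B s t k ω = A.indicator (fun _ => (1 : ℝ)) k := by
    intro k
    simp only [boxTerm, Set.indicator, hA, Set.mem_ofPred_eq]
  simp only [h1]
  rw [← tsum_subtype]
  simp [Nat.card_coe_set_eq]

theorem smallCount_eq_tsum {Ω : Type*} {T : ℕ → Ω → ℝ} {X : ℕ → Ω → ℕ} {j : ℕ}
    (hj : 1 ≤ j) (t : ℝ) (ω : Ω) :
    smallCount T X j t ω =
      ∑' k, boxTerm T X (fun _ => exactly j) (fun _ => t) (fun _ => t) k ω := by
  rw [tsum_boxTerm_eq_ncard, smallCount]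
  congr 2
  ext k
  simp only [Set.mem_ofPred_eq, exactly, boxCount]
  constructor
  · intro h; simp [h]
  · intro h
    rw [ENat.toNat_eq_iff (by omega)] at h
    exact h

variable [IsProbabilityMeasure μ]

theorem IsPoissonizedScheme.integral_boxTerm_exactly (hp : IsBoxDistribution p)
    (h : IsPoissonizedScheme p μ T X) (j k : ℕ) {s t : ℕ → ℝ} (ht : 0 ≤ t k) :
    ∫ ω, boxTerm T X (fun _ => exactly j) s t k ω ∂μ = poissonWeight j (p k * t k) := by
  rw [h.integral_boxTerm, ← h.measureReal_boxCount_eq hp k j ht]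
  rfl

theorem IsPoissonizedScheme.summable_integral_exactly (hp : IsBoxDistribution p)
    (h : IsPoissonizedScheme p μ T X) {j : ℕ} (hj : 1 ≤ j) {t : ℝ} (ht : 0 ≤ t) :
    Summable fun k => ∫ ω, boxTerm T X (fun _ => exactly j) (fun _ => t) (fun _ => t) k ω ∂μ := by
  simp only [h.integral_boxTerm_exactly hp j _ (t := fun _ => t) ht]
  exact hp.summable_poissonWeight hj ht

theorem IsPoissonizedScheme.integral_smallCount (hp : IsBoxDistribution p)
    (h : IsPoissonizedScheme p μ T X) {j : ℕ} (hj : 1 ≤ j) {t : ℝ} (ht : 0 ≤ t) :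
    ∫ ω, smallCount T X j t ω ∂μ = ∑' k, poissonWeight j (p k * t) := by
  simp only [smallCount_eq_tsum hj]
  rw [← (hasSum_integral_tsum (h.measurable_boxTerm _ _ _) (boxTerm_mem_Icc _ _ _)
    (h.summable_integral_exactly hp hj ht)).tsum_eq]
  simp only [h.integral_boxTerm_exactly hp j _ (t := fun _ => t) ht]

theorem IsPoissonizedScheme.hasSum_variance_smallCount (hp : IsBoxDistribution p)
    (h : IsPoissonizedScheme p μ T X) {j : ℕ} (hj : 1 ≤ j) {t : ℝ} (ht : 0 ≤ t) :
    HasSum (fun k => poissonWeight j (p k * t) * (1 - poissonWeight j (p k * t)))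
      (variance (smallCount T X j t) μ) := by
  have h1 := (memLp_tsum (h.iIndepFun_boxTerm _ _ _ hp) (h.measurable_boxTerm _ _ _)
    (boxTerm_mem_Icc _ _ _) (h.summable_integral_exactly hp hj ht)).2
  simp only [h.variance_boxTerm, h.integral_boxTerm_exactly hp j _ (t := fun _ => t) ht] at h1
  convert h1 using 2
  ext ω
  exact smallCount_eq_tsum hj t ω

theorem IsPoissonizedScheme.memLp_smallCount (hp : IsBoxDistribution p)
    (h : IsPoissonizedScheme p μ T X) {j : ℕ} (hj : 1 ≤ j) (t : ℝ) :
    MemLp (smallCount T X j t) 2 μ := by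
  rcases le_or_gt 0 t with ht | ht
  · have h1 := (memLp_tsum (h.iIndepFun_boxTerm _ _ _ hp) (h.measurable_boxTerm _ _ _)
      (boxTerm_mem_Icc _ _ _) (h.summable_integral_exactly hp hj ht)).1
    convert h1 using 1
    ext ω
    exact smallCount_eq_tsum hj t ω
  -- Before time zero all boxes are almost surely empty.
  · have h0 : ∀ᵐ ω ∂μ, ∀ k, boxCount T X k 0 ω = 0 := by
      rw [ae_all_iff]
      intro k
      have h1 := h.measureReal_boxCount_eq hp k 0 le_rfl
      simp only [poissonWeight, mul_zero, neg_zero, Real.exp_zero, pow_zero, Nat.factorial_zero,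
        Nat.cast_one, mul_one, div_one] at h1
      have h2 : μ {ω | boxCount T X k 0 ω = 0} = 1 := by
        rw [measureReal_def] at h1
        have h3 := ENNReal.ofReal_toReal (measure_ne_top μ {ω | boxCount T X k 0 ω = 0})
        rw [h1, ENNReal.ofReal_one] at h3
        exact h3.symm
      exact (mem_ae_iff_prob_eq_one ((measurable_boxCount h.measurable_T h.measurable_X k 0)
        (measurableSet_singleton 0))).2 h2
    have h4 : (fun _ => (0 : ℝ)) =ᵐ[μ] smallCount T X j t := by
      filter_upwards [h0, h.ae_eventually_lt_throwTime] with ω h1 h2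
      rw [smallCount_eq_tsum hj]
      have h3 : ∀ k, boxTerm T X (fun _ => exactly j) (fun _ => t) (fun _ => t) k ω = 0 := by
        intro k
        have := boxCount_mono (X := X) h2 k ht.le
        rw [h1 k] at this
        have h5 : boxCount T X k t ω ≠ j := by omega
        simp [boxTerm, exactly, h5]
      simp [h3]
    exact (memLp_const (0 : ℝ)).ae_eq h4

end SmallCount

section Increments

/-- The number of boxes that receive their `i`-th ball during `(s, t]`. -/
noncomputable def upcrossings (T : ℕ → Ω → ℝ) (X : ℕ → Ω → ℕ) (i : ℕ) (s t : ℝ) (ω : Ω) : ℝ :=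
  ∑' k, boxTerm T X (fun _ => {x | x.1 < i ∧ i ≤ x.2}) (fun _ => s) (fun _ => t) k ω

theorem summable_boxTerm_of_pos {Ω : Type*} {T : ℕ → Ω → ℝ} {X : ℕ → Ω → ℕ}
    {B : ℕ → Set (ℕ × ℕ)} {s t : ℝ} {ω : Ω}
    (hω : ∀ t : ℝ, ∃ n, ∀ i, n ≤ i → t < throwTime T i ω)
    (hB : ∀ k, ∀ x ∈ B k, x.2 ≠ 0) :
    Summable fun k => boxTerm T X B (fun _ => s) (fun _ => t) k ω := by
  refine summable_of_hasFiniteSupport ((finite_boxCount_ne_zero (X := X) hω t).subset ?_)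
  intro k hk
  have h1 : boxTerm T X B (fun _ => s) (fun _ => t) k ω ≠ 0 := hk
  by_contra h2
  have h3 : boxCount T X k t ω = 0 := by simpa using h2
  refine h1 (Set.indicator_of_notMem (fun h4 => hB k _ h4 h3) _)

/-- A box enters the set of boxes with exactly `j` balls when it receives its `j`-th ball and leaves
it with the next one. -/
theorem smallCount_sub_smallCount {Ω : Type*} {T : ℕ → Ω → ℝ} {X : ℕ → Ω → ℕ}
    {j : ℕ} (hj : 1 ≤ j) {s t : ℝ} (hst : s ≤ t) {ω : Ω}
    (hω : ∀ t : ℝ, ∃ n, ∀ i, n ≤ i → t < throwTime T i ω) :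
    smallCount T X j t ω - smallCount T X j s ω =
      upcrossings T X j s t ω - upcrossings T X (j + 1) s t ω := by
  have hB : ∀ k, ∀ x ∈ (fun _ : ℕ => exactly j) k, x.2 ≠ 0 := fun k x hx => by
    have : x.2 = j := hx
    omega
  have hU : ∀ i, 1 ≤ i → ∀ k, ∀ x ∈ (fun _ : ℕ => {x : ℕ × ℕ | x.1 < i ∧ i ≤ x.2}) k, x.2 ≠ 0 :=
    fun i hi k x hx => by
      have : i ≤ x.2 := hx.2
      omega
  rw [smallCount_eq_tsum hj, smallCount_eq_tsum hj, upcrossings, upcrossings,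
    ← (summable_boxTerm_of_pos hω hB).tsum_sub (summable_boxTerm_of_pos hω hB),
    ← (summable_boxTerm_of_pos hω (hU j hj)).tsum_sub
      (summable_boxTerm_of_pos hω (hU (j + 1) (by omega)))]
  congr 1
  ext k
  have hle := boxCount_mono (X := X) hω k hst
  simp only [boxTerm, exactly, Set.indicator, Set.mem_ofPred_eq]
  generalize boxCount T X k s ω = a at hle
  generalize boxCount T X k t ω = b at hle
  by_cases h1 : b = j <;> by_cases h2 : a = j <;> by_cases h3 : a < j ∧ j ≤ b <;>
    by_cases h4 : a < j + 1 ∧ j + 1 ≤ b <;> simp only [h1, h2, h3, h4, if_true, if_false] <;>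
    first | omega | norm_num

theorem upcrossings_nonneg {Ω : Type*} {T : ℕ → Ω → ℝ} {X : ℕ → Ω → ℕ}
    (i : ℕ) (s t : ℝ) (ω : Ω) : 0 ≤ upcrossings T X i s t ω :=
  tsum_nonneg fun k => (boxTerm_mem_Icc _ _ _ k ω).1

theorem upcrossings_mono {Ω : Type*} {T : ℕ → Ω → ℝ} {X : ℕ → Ω → ℕ}
    {i : ℕ} (hi : 1 ≤ i) {s t u : ℝ} (htu : t ≤ u) {ω : Ω}
    (hω : ∀ t : ℝ, ∃ n, ∀ i, n ≤ i → t < throwTime T i ω) :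
    upcrossings T X i s t ω ≤ upcrossings T X i s u ω := by
  have hU : ∀ k, ∀ x ∈ (fun _ : ℕ => {x : ℕ × ℕ | x.1 < i ∧ i ≤ x.2}) k, x.2 ≠ 0 :=
    fun k x hx => by
      have : i ≤ x.2 := hx.2
      omega
  refine (summable_boxTerm_of_pos hω hU).tsum_le_tsum (fun k => ?_) (summable_boxTerm_of_pos hω hU)
  have hle := boxCount_mono (X := X) hω k htu
  simp only [boxTerm, Set.indicator, Set.mem_ofPred_eq]
  split_ifs <;> first | omega | simp

variable [IsProbabilityMeasure μ]

theorem IsPoissonizedScheme.measureReal_boxCount_lt (hp : IsBoxDistribution p)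
    (h : IsPoissonizedScheme p μ T X) (k i : ℕ) {t : ℝ} (ht : 0 ≤ t) :
    μ.real {ω | boxCount T X k t ω < i} = ∑ l ∈ Finset.range i, poissonWeight l (p k * t) := by
  have h1 : {ω | boxCount T X k t ω < i} =
      ⋃ l ∈ Finset.range i, {ω | boxCount T X k t ω = l} := by
    ext ω; simp
  rw [h1, measureReal_biUnion_finset]
  · exact Finset.sum_congr rfl fun l _ => h.measureReal_boxCount_eq hp k l ht
  · intro a _ b _ hab
    refine Set.disjoint_left.2 fun ω h1 h2 => hab ?_
    exact (show boxCount T X k t ω = a from h1).symm.trans h2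
  · exact fun l _ => (measurable_boxCount h.measurable_T h.measurable_X k t)
      (measurableSet_singleton l)

theorem hasDerivAt_sum_poissonWeight (i : ℕ) (x : ℝ) :
    HasDerivAt (fun x => ∑ l ∈ Finset.range (i + 1), poissonWeight l x) (-poissonWeight i x) x := by
  induction i with
  | zero =>
    have h1 : HasDerivAt (fun x : ℝ => Real.exp (-x)) (-Real.exp (-x)) x := by
      simpa using (hasDerivAt_neg x).exp
    simpa [poissonWeight] using h1
  | succ i ih =>
    simp only [Finset.sum_range_succ _ (i + 1)]
    exact (ih.add (hasDerivAt_poissonWeight i x)).congr_deriv (by ring)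

/-- A bound for the probability that a Poisson process makes its `i + 1`-st jump in `(x, y]`. -/
theorem sum_poissonWeight_sub_le (i : ℕ) {x y : ℝ} (hx : 0 ≤ x) (hxy : x ≤ y) (hy : y ≤ 2 * x) :
    ∑ l ∈ Finset.range (i + 1), poissonWeight l x - ∑ l ∈ Finset.range (i + 1), poissonWeight l y ≤
      2 ^ i * poissonWeight i x * (y - x) := by
  rcases hxy.eq_or_lt with rfl | hlt
  · simp
  obtain ⟨c, hc, hc2⟩ := exists_hasDerivAt_eq_slope
    (fun x => ∑ l ∈ Finset.range (i + 1), poissonWeight l x) (fun x => -poissonWeight i x) hlt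
    (continuous_finsetSum _ fun l _ => continuous_poissonWeight l).continuousOn
    fun z _ => hasDerivAt_sum_poissonWeight i z
  rw [eq_div_iff (by linarith)] at hc2
  have h1 : poissonWeight i c ≤ 2 ^ i * poissonWeight i x := by
    have h2 : c ^ i ≤ (2 * x) ^ i := pow_le_pow_left₀ (by linarith [hc.1]) (by linarith [hc.2]) i
    rw [mul_pow] at h2
    have h3 : Real.exp (-c) ≤ Real.exp (-x) := Real.exp_le_exp.2 (by linarith [hc.1])
    have h4 : (0 : ℝ) ≤ 2 ^ i * x ^ i := by positivity
    rw [poissonWeight, poissonWeight, mul_div_assoc', div_le_div_iff_of_pos_right (by positivity)]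
    calc Real.exp (-c) * c ^ i ≤ Real.exp (-x) * (2 ^ i * x ^ i) :=
          mul_le_mul h3 h2 (pow_nonneg (by linarith [hc.1]) i) (Real.exp_nonneg _)
      _ = _ := by ring
  have h5 : 0 ≤ y - x := by linarith
  nlinarith [mul_le_mul_of_nonneg_right h1 h5]

theorem IsPoissonizedScheme.integral_boxTerm_upcrossings_le (hp : IsBoxDistribution p)
    (h : IsPoissonizedScheme p μ T X) (i k : ℕ) {s t : ℝ} (hs : 0 < s) (hst : s ≤ t)
    (ht : t ≤ 2 * s) :
    ∫ ω, boxTerm T X (fun _ => {x | x.1 < i + 1 ∧ i + 1 ≤ x.2}) (fun _ => s) (fun _ => t) k ω ∂μ ≤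
      2 ^ i * (i + 1) * ((t - s) / s) * poissonWeight (i + 1) (p k * s) := by
  rw [h.integral_boxTerm]
  have hms : MeasurableSet {ω | boxCount T X k t ω < i + 1} :=
    (measurable_boxCount h.measurable_T h.measurable_X k t) (measurableSet_Iio (a := i + 1))
  have h1 : μ.real {ω | (boxCount T X k s ω, boxCount T X k t ω) ∈
      {x : ℕ × ℕ | x.1 < i + 1 ∧ i + 1 ≤ x.2}} ≤
      μ.real {ω | boxCount T X k s ω < i + 1} - μ.real {ω | boxCount T X k t ω < i + 1} := by
    have hsub : μ.real {ω | boxCount T X k t ω < i + 1} =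
        μ.real ({ω | boxCount T X k s ω < i + 1} ∩ {ω | boxCount T X k t ω < i + 1}) := by
      refine measureReal_congr ?_
      filter_upwards [h.ae_eventually_lt_throwTime] with ω hω
      refine propext ⟨fun h1 => ⟨?_, h1⟩, fun h1 => h1.2⟩
      exact (boxCount_mono (X := X) hω k hst).trans_lt h1
    rw [hsub, ← measureReal_inter_add_sdiff (s := {ω | boxCount T X k s ω < i + 1}) hms,
      add_sub_cancel_left]
    refine measureReal_mono fun ω hω => ⟨hω.1, ?_⟩
    have : i + 1 ≤ boxCount T X k t ω := hω.2
    simp only [Set.mem_ofPred_eq]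
    omega
  refine h1.trans ?_
  rw [h.measureReal_boxCount_lt hp k _ hs.le, h.measureReal_boxCount_lt hp k _ (hs.le.trans hst)]
  have hpk := hp.nonneg k
  refine (sum_poissonWeight_sub_le i (mul_nonneg hpk hs.le) (by gcongr) (by nlinarith)).trans
    (le_of_eq ?_)
  rw [poissonWeight, poissonWeight, Nat.factorial_succ]
  push_cast
  field_simp
  ring

/-- The mean number of boxes which receive their `i + 1`-st ball during `(s, t]` is, up to a
constant, at most the relative length of the interval times `E K*_{i+1}(s)`. -/
theorem IsPoissonizedScheme.upcrossings_mean (hp : IsBoxDistribution p)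
    (h : IsPoissonizedScheme p μ T X) (i : ℕ) {s t : ℝ} (hs : 0 < s) (hst : s ≤ t)
    (ht : t ≤ 2 * s) :
    (Summable fun k => ∫ ω, boxTerm T X (fun _ => {x | x.1 < i + 1 ∧ i + 1 ≤ x.2})
      (fun _ => s) (fun _ => t) k ω ∂μ) ∧
    ∑' k, ∫ ω, boxTerm T X (fun _ => {x | x.1 < i + 1 ∧ i + 1 ≤ x.2})
      (fun _ => s) (fun _ => t) k ω ∂μ ≤
      2 ^ i * (i + 1) * ((t - s) / s) * ∑' k, poissonWeight (i + 1) (p k * s) := by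
  have h1 := (hp.summable_poissonWeight (j := i + 1) (by omega) hs.le).mul_left
    (2 ^ i * (i + 1) * ((t - s) / s))
  have h2 := Summable.of_nonneg_of_le (fun k => integral_nonneg fun ω =>
    (boxTerm_mem_Icc (fun _ => {x | x.1 < i + 1 ∧ i + 1 ≤ x.2}) (fun _ => s) (fun _ => t) k ω).1)
    (fun k => h.integral_boxTerm_upcrossings_le hp i k hs hst ht) h1
  refine ⟨h2, ?_⟩
  rw [← tsum_mul_left]
  exact h2.tsum_le_tsum (fun k => h.integral_boxTerm_upcrossings_le hp i k hs hst ht) h1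

end Increments

end Karlin

/-! ### The scale of the deviations and the first Borel–Cantelli lemma -/

namespace Karlin

section Scale

variable {p : ℕ → ℝ} {α : ℝ} {L : ℝ → ℝ}

/-- `(c ρ(t) log log t)^{1/2}`, which for `c = c_{j,α}` is asymptotically the denominator in the law
of the iterated logarithm, and which is monotone in `t`. -/
noncomputable def lilScale (p : ℕ → ℝ) (c t : ℝ) : ℝ := √(c * rho p t * Real.log (Real.log t))

/-- The ratio `(log log t / ρ(t))^{1/2}` of the scale of the deviations and the variance. -/
noncomputable def scaleRatio (p : ℕ → ℝ) (t : ℝ) : ℝ := √(Real.log (Real.log t) / rho p t)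

theorem tendsto_log_log : Tendsto (fun t : ℝ => Real.log (Real.log t)) atTop atTop :=
  Real.tendsto_log_atTop.comp Real.tendsto_log_atTop

theorem lilScale_mono (hp : IsBoxDistribution p) {c : ℝ} (hc : 0 ≤ c) {s t : ℝ}
    (hs : Real.exp 1 ≤ s) (hst : s ≤ t) : lilScale p c s ≤ lilScale p c t := by
  have hs0 : 0 < s := (Real.exp_pos 1).trans_le hs
  have h1 : 1 ≤ Real.log s := by rwa [Real.le_log_iff_exp_le hs0]
  have h2 : Real.log s ≤ Real.log t := Real.log_le_log hs0 hst
  have h3 : 0 ≤ Real.log (Real.log s) := Real.log_nonneg h1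
  have h4 : Real.log (Real.log s) ≤ Real.log (Real.log t) :=
    Real.log_le_log (one_pos.trans_le h1) h2
  have h5 := rho_mono hp hst
  have h6 : 0 ≤ rho p s := rho_nonneg s
  unfold lilScale
  gcongr
  exact mul_nonneg hc (h6.trans h5)

theorem lilScale_eq {c : ℝ} (hc : 0 ≤ c) {t : ℝ} (ht : 0 < rho p t) :
    lilScale p c t = √c * rho p t * scaleRatio p t := by
  have h1 : c * rho p t * Real.log (Real.log t) =
      c * (rho p t ^ 2 * (Real.log (Real.log t) / rho p t)) := by field_simp
  rw [lilScale, h1, Real.sqrt_mul hc, Real.sqrt_mul (sq_nonneg _), Real.sqrt_sq ht.le, scaleRatio]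
  ring

theorem lilScale_sq {c : ℝ} (hc : 0 ≤ c) {t : ℝ} (ht : 0 ≤ Real.log (Real.log t)) :
    lilScale p c t ^ 2 = c * rho p t * Real.log (Real.log t) :=
  Real.sq_sqrt (mul_nonneg (mul_nonneg hc (rho_nonneg t)) ht)

/-- `ρ` grows like a power of `t`, so its reciprocal absorbs any power of `log t`. -/
theorem tendsto_log_sq_mul_scaleRatio (hp : IsBoxDistribution p) (hα0 : 0 < α)
    (hL : IsSlowlyVarying L) (hρ : rho p ~[atTop] fun t => t ^ α * L t) :
    Tendsto (fun t => Real.log t ^ 2 * scaleRatio p t) atTop (𝓝 0) := by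
  have h1 : Tendsto (fun t : ℝ => Real.log t ^ (5 : ℝ) / t ^ (α / 2)) atTop (𝓝 0) :=
    (isLittleO_log_rpow_rpow_atTop 5 (half_pos hα0)).tendsto_div_nhds_zero
  have h2 : Tendsto (fun t : ℝ => √(Real.log t ^ (5 : ℝ) / t ^ (α / 2))) atTop (𝓝 0) := by
    have h := (Real.continuous_sqrt.tendsto 0).comp h1
    rw [Real.sqrt_zero] at h
    exact h
  refine squeeze_zero' ?_ ?_ h2
  · exact Eventually.of_forall fun t => by unfold scaleRatio; positivity
  · filter_upwards [eventually_rpow_le_rho hp hL hρ (half_pos hα0) (half_lt_self hα0),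
      Real.tendsto_log_atTop.eventually_ge_atTop 1, eventually_gt_atTop 0] with t h3 h4 h5
    have h6 : Real.log t ^ 2 = √((Real.log t) ^ 4) := by
      rw [show Real.log t ^ 4 = (Real.log t ^ 2) ^ 2 by ring, Real.sqrt_sq (sq_nonneg _)]
    have h7 : 0 < t ^ (α / 2) := Real.rpow_pos_of_pos h5 _
    have h8 : Real.log (Real.log t) ≤ Real.log t := Real.log_le_self (by linarith)
    have h9 : 0 ≤ Real.log (Real.log t) := Real.log_nonneg h4
    rw [scaleRatio, h6, ← Real.sqrt_mul (by positivity)]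
    refine Real.sqrt_le_sqrt ?_
    have h10 : Real.log t ^ (5 : ℝ) = Real.log t ^ 4 * Real.log t := by
      rw [← pow_succ, ← Real.rpow_natCast]; norm_num
    rw [h10, mul_div_assoc]
    gcongr

theorem tendsto_scaleRatio (hp : IsBoxDistribution p) (hα0 : 0 < α)
    (hL : IsSlowlyVarying L) (hρ : rho p ~[atTop] fun t => t ^ α * L t) :
    Tendsto (scaleRatio p) atTop (𝓝 0) := by
  refine squeeze_zero' (Eventually.of_forall fun t => by unfold scaleRatio; positivity) ?_
    (tendsto_log_sq_mul_scaleRatio hp hα0 hL hρ)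
  filter_upwards [Real.tendsto_log_atTop.eventually_ge_atTop 1] with t h
  exact le_mul_of_one_le_left (by unfold scaleRatio; positivity) (one_le_pow₀ h)

theorem tendsto_lilScale (hp : IsBoxDistribution p) (hα0 : 0 < α)
    (hL : IsSlowlyVarying L) (hρ : rho p ~[atTop] fun t => t ^ α * L t) {c : ℝ} (hc : 0 < c) :
    Tendsto (lilScale p c) atTop atTop := by
  have h1 : Tendsto (rho p) atTop atTop := by
    refine tendsto_atTop_mono' _ (eventually_rpow_le_rho hp hL hρ (half_pos hα0)
      (half_lt_self hα0)) (tendsto_rpow_atTop (half_pos hα0))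
  exact Real.tendsto_sqrt_atTop.comp ((h1.const_mul_atTop hc).atTop_mul_atTop₀ tendsto_log_log)

end Scale

section BorelCantelli

variable {Ω : Type*} [MeasurableSpace Ω] {μ : Measure Ω} {T : ℕ → Ω → ℝ} {X : ℕ → Ω → ℕ}
  {p : ℕ → ℝ}

theorem summable_two_mul_exp_neg_log {κ : ℝ} (hκ : 0 < κ) :
    ∑' m : ℕ, ENNReal.ofReal (2 * Real.exp (-((1 + κ) * Real.log m))) ≠ ⊤ := by
  have h1 : Summable fun m : ℕ => 2 * (1 / (m : ℝ) ^ (1 + κ)) :=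
    (Real.summable_one_div_nat_rpow.2 (by linarith)).mul_left 2
  have h2 : Summable fun m : ℕ => 2 * Real.exp (-((1 + κ) * Real.log m)) := by
    refine (summable_nat_add_iff 1).1 (((summable_nat_add_iff 1).2 h1).congr fun m => ?_)
    rw [one_div, ← Real.rpow_neg (by positivity), Real.rpow_def_of_pos (by positivity)]
    ring_nf
  exact h2.tsum_ofReal_ne_top

/-- The first Borel–Cantelli lemma combined with the exponential bound for a sequence of sums of
independent indicators. -/
theorem IsPoissonizedScheme.ae_eventually_abs_sub_lt [IsProbabilityMeasure μ]
    (hp : IsBoxDistribution p) (h : IsPoissonizedScheme p μ T X)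
    (B : ℕ → ℕ → Set (ℕ × ℕ)) (s t : ℕ → ℕ → ℝ) (W x : ℕ → ℝ) {κ : ℝ} (hκ : 0 < κ)
    (hsum : ∀ᶠ m in atTop, Summable fun k => ∫ ω, boxTerm T X (B m) (s m) (t m) k ω ∂μ)
    (hW : ∀ᶠ m in atTop, ∀ n,
      ∑ k ∈ Finset.range n, variance (boxTerm T X (B m) (s m) (t m) k) μ ≤ W m)
    (hx : ∀ᶠ m in atTop, 0 < x m ∧ x m ≤ W m)
    (hlog : ∀ᶠ m : ℕ in atTop,
      (1 + κ) * Real.log m ≤ x m ^ 2 / (2 * W m) * (1 - x m / W m)) :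
    ∀ᵐ ω ∂μ, ∀ᶠ m in atTop, |∑' k, boxTerm T X (B m) (s m) (t m) k ω -
      ∫ ω', ∑' k, boxTerm T X (B m) (s m) (t m) k ω' ∂μ| < x m := by
  obtain ⟨m₀, hm₀⟩ := eventually_atTop.1 (hsum.and (hW.and (hx.and hlog)))
  let F : ℕ → Set Ω := fun m => if m₀ ≤ m then
    {ω | x m ≤ |∑' k, boxTerm T X (B m) (s m) (t m) k ω -
      ∫ ω', ∑' k, boxTerm T X (B m) (s m) (t m) k ω' ∂μ|} else ∅
  have hF : ∀ m, μ (F m) ≤ ENNReal.ofReal (2 * Real.exp (-((1 + κ) * Real.log m))) := by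
    intro m
    by_cases hm : m₀ ≤ m
    · obtain ⟨h1, h2, h3, h4⟩ := hm₀ m hm
      simp only [F, hm, if_true]
      refine (measure_abs_tsum_sub_le (h.iIndepFun_boxTerm _ _ _ hp) (h.measurable_boxTerm _ _ _)
        (boxTerm_mem_Icc _ _ _) h1 h2 h3.1 h3.2).trans ?_
      gcongr
    · simp [F, hm]
  have hsumF : ∑' m, μ (F m) ≠ ⊤ :=
    ne_top_of_le_ne_top (summable_two_mul_exp_neg_log hκ) (ENNReal.tsum_le_tsum hF)
  filter_upwards [ae_eventually_notMem hsumF] with ω hω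
  filter_upwards [hω, eventually_ge_atTop m₀] with m h1 h2
  simp only [F, h2, if_true, Set.mem_ofPred_eq, not_le] at h1
  exact h1

variable {α : ℝ} {L : ℝ → ℝ}

/-- The constant in the bound `E ≤ C ((t - s) / s) ρ(s)` for the number of boxes which receive
their `i + 1`-st ball during `(s, t]`. -/
noncomputable def crossingConst (i : ℕ) (α : ℝ) : ℝ := 2 ^ i * (i + 1) * (meanConst (i + 1) α + 1)

theorem meanConst_pos {j : ℕ} (hj : 1 ≤ j) (hα0 : 0 < α) (hα1 : α < 1) : 0 < meanConst j α := by
  have h1 : (1 : ℝ) ≤ j := by exact_mod_cast hj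
  have := Real.Gamma_pos_of_pos (show 0 < (j : ℝ) - α by linarith)
  unfold meanConst
  positivity

theorem crossingConst_pos (i : ℕ) (hα0 : 0 < α) (hα1 : α < 1) : 0 < crossingConst i α := by
  have := meanConst_pos (j := i + 1) (by omega) hα0 hα1
  unfold crossingConst
  positivity

theorem IsPoissonizedScheme.eventually_upcrossings_mean [IsProbabilityMeasure μ]
    (hp : IsBoxDistribution p) (h : IsPoissonizedScheme p μ T X) (hα0 : 0 < α) (hα1 : α < 1)
    (hL : IsSlowlyVarying L) (hρ : rho p ~[atTop] fun t => t ^ α * L t) (i : ℕ) :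
    ∀ᶠ s in atTop, ∀ t, s ≤ t → t ≤ 2 * s →
      (Summable fun k => ∫ ω, boxTerm T X (fun _ => {x | x.1 < i + 1 ∧ i + 1 ≤ x.2})
        (fun _ => s) (fun _ => t) k ω ∂μ) ∧
      ∑' k, ∫ ω, boxTerm T X (fun _ => {x | x.1 < i + 1 ∧ i + 1 ≤ x.2})
        (fun _ => s) (fun _ => t) k ω ∂μ ≤ crossingConst i α * ((t - s) / s) * rho p s := by
  have h1 := (tendsto_sum_poissonWeight_div_rho hp hα0 hα1 hL hρ (j := i + 1)
    (by omega)).eventually_lt_const (lt_add_one _)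
  filter_upwards [h1, eventually_rho_pos hp, eventually_gt_atTop 0] with s h2 h3 h4 t hst ht
  rw [div_lt_iff₀ h3] at h2
  obtain ⟨h5, h6⟩ := h.upcrossings_mean hp i h4 hst ht
  refine ⟨h5, h6.trans ?_⟩
  have h7 : 0 ≤ (t - s) / s := div_nonneg (by linarith) h4.le
  calc 2 ^ i * (i + 1) * ((t - s) / s) * ∑' k, poissonWeight (i + 1) (p k * s)
      ≤ 2 ^ i * (i + 1) * ((t - s) / s) * ((meanConst (i + 1) α + 1) * rho p s) := by gcongr
    _ = _ := by rw [crossingConst]; ring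

/-- Uniform smallness of the increments: along a sequence of intervals `(s m, t m]` whose relative
lengths `δ m` are small compared to `log log (s m) / log m`, the centred numbers of boxes which
receive their `i + 1`-st ball are eventually below `ε` times the scale. -/
theorem IsPoissonizedScheme.ae_eventually_upcrossings [IsProbabilityMeasure μ]
    (hp : IsBoxDistribution p) (h : IsPoissonizedScheme p μ T X) (hα0 : 0 < α) (hα1 : α < 1)
    (hL : IsSlowlyVarying L) (hρ : rho p ~[atTop] fun t => t ^ α * L t) (i : ℕ) {c ε : ℝ}
    (hc : 0 < c) (hε : 0 < ε) (s t δ : ℕ → ℝ) (hs : Tendsto s atTop atTop)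
    (hst : ∀ᶠ m in atTop, s m ≤ t m ∧ 0 < δ m ∧ δ m ≤ 1 ∧ t m - s m ≤ δ m * s m)
    (hδ : Tendsto (fun m => (δ m)⁻¹ * scaleRatio p (s m)) atTop (𝓝 0))
    (hlog : ∀ᶠ m : ℕ in atTop, 4 * Real.log m ≤
      ε ^ 2 * c / (2 * (crossingConst i α * δ m)) * Real.log (Real.log (s m))) :
    ∀ᵐ ω ∂μ, ∀ᶠ m in atTop, |upcrossings T X (i + 1) (s m) (t m) ω -
      ∫ ω', upcrossings T X (i + 1) (s m) (t m) ω' ∂μ| < ε * lilScale p c (s m) := by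
  set C := crossingConst i α with hC
  have hC0 : 0 < C := crossingConst_pos i hα0 hα1
  have hmean := hs.eventually (h.eventually_upcrossings_mean hp hα0 hα1 hL hρ i)
  have hpos := hs.eventually (eventually_rho_pos hp)
  have hs1 := hs.eventually_gt_atTop 0
  have hll := hs.eventually (tendsto_log_log.eventually_gt_atTop 0)
  have hgood : ∀ᶠ m in atTop,
      (Summable fun k => ∫ ω, boxTerm T X (fun _ => {x | x.1 < i + 1 ∧ i + 1 ≤ x.2})
        (fun _ => s m) (fun _ => t m) k ω ∂μ) ∧
      ∑' k, ∫ ω, boxTerm T X (fun _ => {x | x.1 < i + 1 ∧ i + 1 ≤ x.2})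
        (fun _ => s m) (fun _ => t m) k ω ∂μ ≤ C * δ m * rho p (s m) := by
    filter_upwards [hmean, hst, hs1] with m h1 h2 h3
    obtain ⟨h4, h5⟩ := h1 (t m) h2.1 (by nlinarith [h2.2.1, h2.2.2.1, h2.2.2.2])
    refine ⟨h4, h5.trans ?_⟩
    have : (t m - s m) / s m ≤ δ m := by rw [div_le_iff₀ h3]; exact h2.2.2.2
    have := rho_nonneg (p := p) (s m)
    gcongr
  -- The deviation is small compared to the variance bound, so the bound is in the Gaussian range.
  have hratio : ∀ᶠ m in atTop, ε * lilScale p c (s m) / (C * δ m * rho p (s m)) ≤ 1 / 2 := by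
    have h1 := (hδ.const_mul (ε * √c / C)).eventually_le_const
      (show ε * √c / C * 0 < 1 / 2 by norm_num)
    filter_upwards [h1, hpos, hst] with m h2 h3 h4
    have h5 := h4.2.1
    have h6 : ε * lilScale p c (s m) / (C * δ m * rho p (s m)) =
        ε * √c / C * ((δ m)⁻¹ * scaleRatio p (s m)) := by
      rw [lilScale_eq hc.le h3]
      field_simp
    rw [h6]
    exact h2
  refine h.ae_eventually_abs_sub_lt hp (fun _ _ => {x | x.1 < i + 1 ∧ i + 1 ≤ x.2})
    (fun m _ => s m) (fun m _ => t m) (fun m => C * δ m * rho p (s m))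
    (fun m => ε * lilScale p c (s m)) one_pos (hgood.mono fun m h => h.1) ?_ ?_ ?_
  · filter_upwards [hgood] with m h1 n
    refine le_trans ?_ h1.2
    refine le_trans (Finset.sum_le_sum fun k _ => variance_le_integral_of_mem_Icc
      (h.measurable_boxTerm _ _ _ k) (boxTerm_mem_Icc _ _ _ k)) ?_
    exact h1.1.sum_le_tsum _ fun k _ => integral_nonneg fun ω => (boxTerm_mem_Icc _ _ _ k ω).1
  · filter_upwards [hratio, hpos, hst, hll] with m h1 h2 h3 h4
    have h5 : 0 < C * δ m * rho p (s m) := mul_pos (mul_pos hC0 h3.2.1) h2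
    refine ⟨mul_pos hε (Real.sqrt_pos.2 (mul_pos (mul_pos hc h2) h4)), ?_⟩
    rw [div_le_iff₀ h5] at h1
    linarith
  · filter_upwards [hratio, hpos, hst, hll, hlog] with m h1 h2 h3 h4 h6
    have h5 : 0 < C * δ m * rho p (s m) := mul_pos (mul_pos hC0 h3.2.1) h2
    have h7 : (ε * lilScale p c (s m)) ^ 2 / (2 * (C * δ m * rho p (s m))) =
        ε ^ 2 * c / (2 * (C * δ m)) * Real.log (Real.log (s m)) := by
      rw [mul_pow, lilScale_sq hc.le h4.le]
      have := h3.2.1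
      field_simp
    rw [h7]
    set Y := ε ^ 2 * c / (2 * (C * δ m)) * Real.log (Real.log (s m)) with hY
    have hY0 : 0 ≤ Y := by
      have := h3.2.1
      positivity
    nlinarith

end BorelCantelli

end Karlin

/-! ### Geometric times and short intervals -/

namespace Karlin

variable {Ω : Type*} [MeasurableSpace Ω] {μ : Measure Ω} {T : ℕ → Ω → ℝ} {X : ℕ → Ω → ℕ}
  {p : ℕ → ℝ} {α : ℝ} {L : ℝ → ℝ}

section Geometric

theorem tendsto_log_log_pow_div_log {θ : ℝ} (hθ : 1 < θ) :
    Tendsto (fun m : ℕ => Real.log (Real.log (θ ^ m)) / Real.log m) atTop (𝓝 1) := by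
  have h1 : Tendsto (fun m : ℕ => Real.log (m : ℝ)) atTop atTop :=
    Real.tendsto_log_atTop.comp tendsto_natCast_atTop_atTop
  have h2 : Tendsto (fun m : ℕ => 1 + Real.log (Real.log θ) / Real.log m) atTop (𝓝 (1 + 0)) :=
    tendsto_const_nhds.add (h1.const_div_atTop _)
  rw [add_zero] at h2
  refine h2.congr' ?_
  filter_upwards [h1.eventually_gt_atTop 0, eventually_gt_atTop 0] with m h3 h4
  have h5 : (0 : ℝ) < m := by exact_mod_cast h4
  rw [Real.log_pow, Real.log_mul h5.ne' (Real.log_pos hθ).ne']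
  field_simp

/-- Along a geometric sequence of times, a centred sum of independent indicators with variance at
most `w ρ(t)` is eventually below `(2 w ρ(t) log log t)^{1/2}`, up to a factor arbitrarily close
to `1`. -/
theorem IsPoissonizedScheme.ae_eventually_geometric [IsProbabilityMeasure μ]
    (hp : IsBoxDistribution p) (h : IsPoissonizedScheme p μ T X) (hα0 : 0 < α)
    (hL : IsSlowlyVarying L) (hρ : rho p ~[atTop] fun t => t ^ α * L t) {θ c w y : ℝ}
    (hθ : 1 < θ) (hc : 0 < c) (hw : 0 < w) (hy : 0 < y) (hyw : 2 * w < y ^ 2 * c)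
    (B : ℕ → ℕ → Set (ℕ × ℕ))
    (hsum : ∀ᶠ m in atTop, Summable fun k =>
      ∫ ω, boxTerm T X (B m) (fun _ => θ ^ m) (fun _ => θ ^ m) k ω ∂μ)
    (hW : ∀ᶠ m in atTop, ∀ n, ∑ k ∈ Finset.range n,
      variance (boxTerm T X (B m) (fun _ => θ ^ m) (fun _ => θ ^ m) k) μ ≤ w * rho p (θ ^ m)) :
    ∀ᵐ ω ∂μ, ∀ᶠ m in atTop, |∑' k, boxTerm T X (B m) (fun _ => θ ^ m) (fun _ => θ ^ m) k ω -
      ∫ ω', ∑' k, boxTerm T X (B m) (fun _ => θ ^ m) (fun _ => θ ^ m) k ω' ∂μ| <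
      y * lilScale p c (θ ^ m) := by
  have hs := tendsto_pow_atTop_atTop_of_one_lt hθ
  have hpos := hs.eventually (eventually_rho_pos hp)
  have hll := hs.eventually (tendsto_log_log.eventually_gt_atTop 0)
  have hxW : Tendsto (fun m : ℕ => y * lilScale p c (θ ^ m) / (w * rho p (θ ^ m))) atTop
      (𝓝 0) := by
    have h1 := ((tendsto_scaleRatio hp hα0 hL hρ).comp hs).const_mul (y * √c / w)
    rw [mul_zero] at h1
    refine h1.congr' ?_
    filter_upwards [hpos] with m h2
    rw [lilScale_eq hc.le h2, Function.comp_apply]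
    field_simp
  set q := y ^ 2 * c / (2 * w) with hq
  have hq1 : 1 < q := by rw [hq, lt_div_iff₀ (by positivity)]; linarith
  refine h.ae_eventually_abs_sub_lt hp B (fun m _ => θ ^ m) (fun m _ => θ ^ m)
    (fun m => w * rho p (θ ^ m)) (fun m => y * lilScale p c (θ ^ m)) (κ := (q - 1) / 2)
    (by linarith) hsum hW ?_ ?_
  · filter_upwards [hpos, hll, hxW.eventually_le_const one_pos] with m h1 h2 h3
    refine ⟨mul_pos hy (Real.sqrt_pos.2 (mul_pos (mul_pos hc h1) h2)), ?_⟩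
    rwa [div_le_one (mul_pos hw h1)] at h3
  · have h1 : Tendsto (fun m : ℕ => q * (Real.log (Real.log (θ ^ m)) / Real.log m) *
        (1 - y * lilScale p c (θ ^ m) / (w * rho p (θ ^ m)))) atTop (𝓝 (q * 1 * (1 - 0))) :=
      ((tendsto_log_log_pow_div_log hθ).const_mul q).mul (tendsto_const_nhds.sub hxW)
    have h2 := h1.eventually_const_le (show 1 + (q - 1) / 2 < q * 1 * (1 - 0) by linarith)
    have h3 : Tendsto (fun m : ℕ => Real.log (m : ℝ)) atTop atTop :=
      Real.tendsto_log_atTop.comp tendsto_natCast_atTop_atTop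
    filter_upwards [h2, h3.eventually_gt_atTop 0, hpos, hll] with m h4 h5 h6 h7
    have h8 : (y * lilScale p c (θ ^ m)) ^ 2 / (2 * (w * rho p (θ ^ m))) =
        q * Real.log (Real.log (θ ^ m)) := by
      rw [mul_pow, lilScale_sq hc.le h7.le, hq]
      field_simp
    rw [h8]
    have h9 := mul_le_mul_of_nonneg_right h4 h5.le
    refine h9.trans_eq ?_
    field_simp

end Geometric

section UpperBound

variable [IsProbabilityMeasure μ]

theorem IsPoissonizedScheme.integrable_upcrossings (hp : IsBoxDistribution p)
    (h : IsPoissonizedScheme p μ T X) (i : ℕ) {s t : ℝ} (hs : 0 < s) (hst : s ≤ t)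
    (ht : t ≤ 2 * s) : Integrable (upcrossings T X (i + 1) s t) μ :=
  (memLp_tsum (h.iIndepFun_boxTerm _ _ _ hp) (h.measurable_boxTerm _ _ _) (boxTerm_mem_Icc _ _ _)
    (h.upcrossings_mean hp i hs hst ht).1).1.integrable one_le_two

theorem IsPoissonizedScheme.integral_upcrossings (h : IsPoissonizedScheme p μ T X)
    (hp : IsBoxDistribution p) (i : ℕ) {s t : ℝ} (hs : 0 < s) (hst : s ≤ t) (ht : t ≤ 2 * s) :
    ∫ ω, upcrossings T X (i + 1) s t ω ∂μ =
      ∑' k, ∫ ω, boxTerm T X (fun _ => {x | x.1 < i + 1 ∧ i + 1 ≤ x.2})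
        (fun _ => s) (fun _ => t) k ω ∂μ :=
  (hasSum_integral_tsum (h.measurable_boxTerm _ _ _) (boxTerm_mem_Icc _ _ _)
    (h.upcrossings_mean hp i hs hst ht).1).tsum_eq.symm

/-- The centred small count at time `t` is that at time `s` plus the difference of the centred
numbers of boxes which enter and which leave the set of boxes with `i + 1` balls. -/
theorem IsPoissonizedScheme.centred_smallCount_le (hp : IsBoxDistribution p)
    (h : IsPoissonizedScheme p μ T X) (i : ℕ) {s t : ℝ} (hs : 0 < s) (hst : s ≤ t)
    (ht : t ≤ 2 * s) {ω : Ω} (hω : ∀ t : ℝ, ∃ n, ∀ i, n ≤ i → t < throwTime T i ω) :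
    |smallCount T X (i + 1) t ω - ∫ ω', smallCount T X (i + 1) t ω' ∂μ| ≤
      |smallCount T X (i + 1) s ω - ∫ ω', smallCount T X (i + 1) s ω' ∂μ| +
      |upcrossings T X (i + 1) s t ω - ∫ ω', upcrossings T X (i + 1) s t ω' ∂μ| +
      |upcrossings T X (i + 1 + 1) s t ω - ∫ ω', upcrossings T X (i + 1 + 1) s t ω' ∂μ| := by
  have hi : 1 ≤ i + 1 := by omega
  have h1 := smallCount_sub_smallCount (X := X) hi hst hω
  have h2 : ∫ ω', smallCount T X (i + 1) t ω' ∂μ - ∫ ω', smallCount T X (i + 1) s ω' ∂μ =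
      ∫ ω', upcrossings T X (i + 1) s t ω' ∂μ - ∫ ω', upcrossings T X (i + 1 + 1) s t ω' ∂μ := by
    rw [← integral_sub ((h.memLp_smallCount hp hi t).integrable one_le_two)
      ((h.memLp_smallCount hp hi s).integrable one_le_two),
      ← integral_sub (h.integrable_upcrossings hp i hs hst ht)
      (h.integrable_upcrossings hp (i + 1) hs hst ht)]
    refine integral_congr_ae ?_
    filter_upwards [h.ae_eventually_lt_throwTime] with ω' hω'
    exact smallCount_sub_smallCount hi hst hω'
  set a := smallCount T X (i + 1) s ω - ∫ ω', smallCount T X (i + 1) s ω' ∂μ with ha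
  set b := upcrossings T X (i + 1) s t ω - ∫ ω', upcrossings T X (i + 1) s t ω' ∂μ with hb
  set d := upcrossings T X (i + 1 + 1) s t ω - ∫ ω', upcrossings T X (i + 1 + 1) s t ω' ∂μ with hd
  have h3 : smallCount T X (i + 1) t ω - ∫ ω', smallCount T X (i + 1) t ω' ∂μ = a + b - d := by
    rw [ha, hb, hd]; linarith
  rw [h3]
  exact (abs_sub _ _).trans (by gcongr; exact abs_add_le _ _)

/-- Uniform smallness of the increments over polynomially many intervals `(s m, t m]`, with
`log (s m)` of the order of `log m`, whose relative lengths are at most `2 / (log m)²`. -/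
theorem IsPoissonizedScheme.ae_eventually_upcrossings_short (hp : IsBoxDistribution p)
    (h : IsPoissonizedScheme p μ T X) (hα0 : 0 < α) (hα1 : α < 1) (hL : IsSlowlyVarying L)
    (hρ : rho p ~[atTop] fun t => t ^ α * L t) (i : ℕ) {c ε : ℝ} (hc : 0 < c) (hε : 0 < ε)
    (s t : ℕ → ℝ) (hs : Tendsto s atTop atTop)
    (hst : ∀ᶠ m : ℕ in atTop, s m ≤ t m ∧ t m - s m ≤ 2 / Real.log m ^ 2 * s m)
    (hlog : ∀ᶠ m : ℕ in atTop, Real.log m ≤ 2 * Real.log (s m)) :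
    ∀ᵐ ω ∂μ, ∀ᶠ m in atTop, |upcrossings T X (i + 1) (s m) (t m) ω -
      ∫ ω', upcrossings T X (i + 1) (s m) (t m) ω' ∂μ| < ε * lilScale p c (s m) := by
  have hC0 : 0 < crossingConst i α := crossingConst_pos i hα0 hα1
  have hlogm : Tendsto (fun m : ℕ => Real.log (m : ℝ)) atTop atTop :=
    Real.tendsto_log_atTop.comp tendsto_natCast_atTop_atTop
  refine h.ae_eventually_upcrossings hp hα0 hα1 hL hρ i hc hε s t (fun m => 2 / Real.log m ^ 2)
    hs ?_ ?_ ?_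
  · filter_upwards [hst, hlogm.eventually_ge_atTop 2] with m h1 h2
    refine ⟨h1.1, by positivity, ?_, h1.2⟩
    rw [div_le_one (by positivity)]
    nlinarith
  · have h1 := ((tendsto_log_sq_mul_scaleRatio hp hα0 hL hρ).comp hs).const_mul 2
    rw [mul_zero] at h1
    refine squeeze_zero' (Eventually.of_forall fun m => ?_) ?_ h1
    · unfold scaleRatio; positivity
    · filter_upwards [hlog, hlogm.eventually_ge_atTop 2] with m h2 h3
      have h4 : 0 ≤ scaleRatio p (s m) := by unfold scaleRatio; positivity
      rw [inv_div, Function.comp_apply, ← mul_assoc]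
      gcongr
      nlinarith
  · filter_upwards [(hs.eventually (tendsto_log_log.eventually_ge_atTop 1)),
      hlogm.eventually_ge_atTop (16 * crossingConst i α / (ε ^ 2 * c)),
      hlogm.eventually_ge_atTop 1] with m h1 h2 h3
    set C := crossingConst i α with hC
    rw [div_le_iff₀ (by positivity)] at h2
    have h4 : ε ^ 2 * c / (2 * (C * (2 / Real.log m ^ 2))) =
        (Real.log m * (ε ^ 2 * c)) * Real.log m / (4 * C) := by
      field_simp
      ring
    have h5 : 4 * Real.log m ≤ ε ^ 2 * c / (2 * (C * (2 / Real.log m ^ 2))) := by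
      rw [h4, le_div_iff₀ (by positivity)]
      nlinarith
    exact h5.trans (le_mul_of_one_le_right (by positivity) h1)

end UpperBound

end Karlin

/-! ### The upper half of the law of the iterated logarithm -/

namespace Karlin

variable {Ω : Type*} [MeasurableSpace Ω] {μ : Measure Ω} [IsProbabilityMeasure μ]
  {T : ℕ → Ω → ℝ} {X : ℕ → Ω → ℕ} {p : ℕ → ℝ} {α : ℝ} {L : ℝ → ℝ}

/-- The times `exp (i^{1/3})`, between the geometric sequences and the integers: there are
polynomially many of them, in terms of `log t`, up to time `t`, and their relative spacing is of
order `(log t)⁻²`. -/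
noncomputable def midTime (i : ℕ) : ℝ := Real.exp ((i : ℝ) ^ (3⁻¹ : ℝ))

theorem tendsto_cbrt : Tendsto (fun i : ℕ => (i : ℝ) ^ (3⁻¹ : ℝ)) atTop atTop :=
  (tendsto_rpow_atTop (by norm_num)).comp tendsto_natCast_atTop_atTop

theorem tendsto_midTime : Tendsto midTime atTop atTop :=
  Real.tendsto_exp_atTop.comp tendsto_cbrt

theorem tendsto_log_natCast : Tendsto (fun m : ℕ => Real.log (m : ℝ)) atTop atTop :=
  Real.tendsto_log_atTop.comp tendsto_natCast_atTop_atTop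

/-- The exponent of the last power of `θ` up to `midTime i`. -/
noncomputable def geometricIndex (θ : ℝ) (i : ℕ) : ℕ := ⌊(i : ℝ) ^ (3⁻¹ : ℝ) / Real.log θ⌋₊

theorem tendsto_geometricIndex {θ : ℝ} (hθ : 1 < θ) : Tendsto (geometricIndex θ) atTop atTop :=
  tendsto_nat_floor_atTop.comp (tendsto_cbrt.atTop_div_const (Real.log_pos hθ))

theorem geometricIndex_bounds {θ : ℝ} (hθ : 1 < θ) (i : ℕ) :
    θ ^ geometricIndex θ i ≤ midTime i ∧ midTime i ≤ θ * θ ^ geometricIndex θ i := by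
  have h0 : 0 < Real.log θ := Real.log_pos hθ
  have hθ0 : 0 < θ := by linarith
  have h1 : (geometricIndex θ i : ℝ) ≤ (i : ℝ) ^ (3⁻¹ : ℝ) / Real.log θ :=
    Nat.floor_le (by positivity)
  have h2 : (i : ℝ) ^ (3⁻¹ : ℝ) / Real.log θ < geometricIndex θ i + 1 := Nat.lt_floor_add_one _
  rw [le_div_iff₀ h0] at h1
  rw [div_lt_iff₀ h0] at h2
  rw [← pow_succ', midTime, ← Real.log_le_iff_le_exp (by positivity), ←
    Real.le_log_iff_exp_le (by positivity), Real.log_pow, Real.log_pow]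
  push_cast
  exact ⟨h1, h2.le⟩

/-- The index of the last `midTime` up to `m`. -/
noncomputable def midIndex (m : ℕ) : ℕ := ⌊Real.log m ^ 3⌋₊

theorem tendsto_midIndex : Tendsto midIndex atTop atTop :=
  tendsto_nat_floor_atTop.comp ((tendsto_pow_atTop three_ne_zero).comp tendsto_log_natCast)

/-- The last `midTime` up to `m` precedes `m` by a relative distance of at most `2 / (log m)²`. -/
theorem midIndex_bounds {m : ℕ} (hm : 2 ≤ Real.log m) :
    midTime (midIndex m) ≤ m ∧ m - midTime (midIndex m) ≤
      2 / Real.log m ^ 2 * midTime (midIndex m) ∧ Real.log m ≤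
      2 * Real.log (midTime (midIndex m)) := by
  have hm0 : (0 : ℝ) < m := by
    rcases Nat.eq_zero_or_pos m with rfl | h
    · norm_num at hm
    · exact_mod_cast h
  set v := Real.log m with hv
  have h1 : (midIndex m : ℝ) ≤ v ^ 3 := Nat.floor_le (by positivity)
  have h2 : v ^ 3 < midIndex m + 1 := Nat.lt_floor_add_one _
  have hlog : Real.log (midTime (midIndex m)) = (midIndex m : ℝ) ^ (3⁻¹ : ℝ) := Real.log_exp _
  have h3 : ((midIndex m : ℝ) ^ (3⁻¹ : ℝ)) ^ 3 = midIndex m := by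
    rw [← Real.rpow_natCast, ← Real.rpow_mul (by positivity)]
    norm_num
  set w := (midIndex m : ℝ) ^ (3⁻¹ : ℝ) with hw
  have hw0 : 0 ≤ w := by positivity
  have h4 : w ≤ v := le_of_pow_le_pow_left₀ three_ne_zero (by linarith) (by linarith)
  have h5 : (v - w) * v ^ 2 ≤ 1 := by
    have h6 : (v - w) * (v ^ 2 + v * w + w ^ 2) = v ^ 3 - w ^ 3 := by ring
    have h7 : 0 ≤ (v - w) * (v * w + w ^ 2) :=
      mul_nonneg (by linarith) (by positivity)
    nlinarith
  have h8 : v - w ≤ 1 / v ^ 2 := by rwa [le_div_iff₀ (by positivity)]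
  have h9 : 1 / v ^ 2 ≤ 1 := by
    rw [div_le_one (by positivity)]
    nlinarith
  have h10 : Real.exp (v - w) - 1 ≤ 2 / v ^ 2 := by
    have h11 : |v - w| ≤ 1 := by rw [abs_of_nonneg (by linarith)]; linarith
    have h12 := (abs_le.1 (Real.abs_exp_sub_one_sub_id_le h11)).2
    have h13 : (v - w) ^ 2 ≤ v - w := by nlinarith
    calc Real.exp (v - w) - 1 ≤ 2 * (1 / v ^ 2) := by linarith
      _ = 2 / v ^ 2 := by ring
  have h14 : (m : ℝ) = Real.exp (v - w) * midTime (midIndex m) := by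
    rw [midTime, ← Real.exp_add, sub_add_cancel, hv, Real.exp_log hm0]
  have h15 : 0 < midTime (midIndex m) := Real.exp_pos _
  refine ⟨?_, ?_, ?_⟩
  · rw [midTime, ← Real.le_log_iff_exp_le hm0]
    exact h4
  · calc (m : ℝ) - midTime (midIndex m) = (Real.exp (v - w) - 1) * midTime (midIndex m) := by
          rw [sub_mul, one_mul, ← h14]
      _ ≤ _ := by gcongr
  · rw [hlog]
    linarith

/-- Increments of the small count between geometric times and the times `midTime i`. -/
theorem IsPoissonizedScheme.ae_eventually_upcrossings_midTime (hp : IsBoxDistribution p)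
    (h : IsPoissonizedScheme p μ T X) (hα0 : 0 < α) (hα1 : α < 1) (hL : IsSlowlyVarying L)
    (hρ : rho p ~[atTop] fun t => t ^ α * L t) (i : ℕ) {c ε θ : ℝ} (hc : 0 < c) (hε : 0 < ε)
    (hθ : 1 < θ) (hθ2 : θ ≤ 2) (hθε : θ - 1 ≤ ε ^ 2 * c / (48 * crossingConst i α)) :
    ∀ᵐ ω ∂μ, ∀ᶠ m in atTop,
      |upcrossings T X (i + 1) (θ ^ geometricIndex θ m) (midTime m) ω -
        ∫ ω', upcrossings T X (i + 1) (θ ^ geometricIndex θ m) (midTime m) ω' ∂μ| <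
      ε * lilScale p c (θ ^ geometricIndex θ m) := by
  have hC0 : 0 < crossingConst i α := crossingConst_pos i hα0 hα1
  have hs : Tendsto (fun m => θ ^ geometricIndex θ m) atTop atTop :=
    (tendsto_pow_atTop_atTop_of_one_lt hθ).comp (tendsto_geometricIndex hθ)
  have hθ0 : 0 < θ := by linarith
  refine h.ae_eventually_upcrossings hp hα0 hα1 hL hρ i hc hε _ _ (fun _ => θ - 1) hs ?_ ?_ ?_
  · refine Eventually.of_forall fun m => ⟨(geometricIndex_bounds hθ m).1, by linarith,
      by linarith, ?_⟩
    have := (geometricIndex_bounds hθ m).2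
    linarith
  · have := ((tendsto_scaleRatio hp hα0 hL hρ).comp hs).const_mul (θ - 1)⁻¹
    rwa [mul_zero] at this
  · filter_upwards [tendsto_cbrt.eventually_ge_atTop ((Real.log θ + 1) ^ 2),
      eventually_ge_atTop 1] with m h1 h2
    have hm : (1 : ℝ) ≤ m := by exact_mod_cast h2
    have hl : 0 < Real.log θ := Real.log_pos hθ
    set v := (m : ℝ) ^ (3⁻¹ : ℝ) with hv
    have hv1 : 1 ≤ v := by nlinarith
    have h3 : Real.log θ + 1 ≤ √v := Real.le_sqrt_of_sq_le h1
    have h4 : √v ≤ v - Real.log θ := by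
      have := Real.sq_sqrt (show 0 ≤ v by linarith)
      nlinarith
    have h5 : v - Real.log θ ≤ Real.log (θ ^ geometricIndex θ m) := by
      have h6 := Real.log_le_log (Real.exp_pos _) (geometricIndex_bounds hθ m).2
      rw [Real.log_exp, Real.log_mul hθ0.ne' (by positivity)] at h6
      linarith
    have h6 : Real.log m / 6 ≤ Real.log (Real.log (θ ^ geometricIndex θ m)) := by
      have h7 := Real.log_le_log (by linarith) (h4.trans h5)
      rw [Real.log_sqrt (by linarith), hv, Real.log_rpow (by linarith)] at h7
      linarith
    have h7 : 24 ≤ ε ^ 2 * c / (2 * (crossingConst i α * (θ - 1))) := by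
      rw [le_div_iff₀ (by positivity)] at hθε
      have : 0 < θ - 1 := by linarith
      rw [le_div_iff₀ (by positivity)]
      linarith
    have h8 : 0 ≤ Real.log m := Real.log_nonneg hm
    nlinarith

/-- The upper half of the law of the iterated logarithm, in absolute value. A time `t` is reached
from a power of `θ` in three steps: to the last `midTime`, to the last integer, and to `t`. -/
theorem IsPoissonizedScheme.ae_eventually_abs_smallCount_sub_lt (hp : IsBoxDistribution p)
    (h : IsPoissonizedScheme p μ T X) (hα0 : 0 < α) (hα1 : α < 1) (hL : IsSlowlyVarying L)
    (hρ : rho p ~[atTop] fun t => t ^ α * L t) {j : ℕ} (hj : 1 ≤ j) {ε : ℝ} (hε : 0 < ε) :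
    ∀ᵐ ω ∂μ, ∀ᶠ t in atTop, |smallCount T X j t ω - ∫ ω', smallCount T X j t ω' ∂μ| <
      (√2 * (1 + ε) + 8 * ε) * lilScale p (varConst j α) t := by
  have hc := varConst_pos hj hα0 hα1
  set c := varConst j α with hcdef
  have hV := tendsto_sum_poissonWeight_variance_div_rho hp hα0 hα1 hL hρ hj
  rw [← hcdef] at hV
  obtain ⟨i, rfl⟩ : ∃ i, j = i + 1 := ⟨j - 1, by omega⟩
  have hC1 := crossingConst_pos i hα0 hα1
  have hC2 := crossingConst_pos (i + 1) hα0 hα1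
  -- `θ = 1 + η` is so close to `1` that the increments in the first step are small.
  obtain ⟨η, hη0, hη1, hη2, hη3⟩ : ∃ η : ℝ, 0 < η ∧ η ≤ 1 ∧
      η ≤ ε ^ 2 * c / (48 * crossingConst i α) ∧
      η ≤ ε ^ 2 * c / (48 * crossingConst (i + 1) α) :=
    ⟨min 1 (min (ε ^ 2 * c / (48 * crossingConst i α))
      (ε ^ 2 * c / (48 * crossingConst (i + 1) α))), by positivity, min_le_left _ _,
      (min_le_right _ _).trans (min_le_left _ _), (min_le_right _ _).trans (min_le_right _ _)⟩
  set θ := 1 + η with hθ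
  have hθ1 : 1 < θ := by linarith
  have hgeo : ∀ᵐ ω ∂μ, ∀ᶠ n : ℕ in atTop, |smallCount T X (i + 1) (θ ^ n) ω -
      ∫ ω', smallCount T X (i + 1) (θ ^ n) ω' ∂μ| < √2 * (1 + ε) * lilScale p c (θ ^ n) := by
    have hsq : √2 ^ 2 = (2 : ℝ) := Real.sq_sqrt (by norm_num)
    have h1 := h.ae_eventually_geometric hp hα0 hL hρ (w := c * (1 + ε)) (y := √2 * (1 + ε)) hθ1 hc
      (by positivity) (by positivity) (by rw [mul_pow, hsq]; nlinarith [mul_pos hc hε])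
      (fun _ _ => exactly (i + 1))
      (Eventually.of_forall fun n => h.summable_integral_exactly hp hj (by positivity)) ?_
    · filter_upwards [h1] with ω h2
      filter_upwards [h2] with n h3
      simpa only [smallCount_eq_tsum hj] using h3
    · have h2 := (tendsto_pow_atTop_atTop_of_one_lt hθ1).eventually
        ((hV.eventually_lt_const (show c < c * (1 + ε) by nlinarith)).and (eventually_rho_pos hp))
      filter_upwards [h2] with n h3 N
      rw [div_lt_iff₀ h3.2] at h3
      have h4 := (memLp_tsum (h.iIndepFun_boxTerm _ _ _ hp) (h.measurable_boxTerm _ _ _)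
        (boxTerm_mem_Icc _ _ _) (h.summable_integral_exactly hp hj
          (show 0 ≤ θ ^ n by positivity))).2
      have h5 := h.hasSum_variance_smallCount hp hj (show 0 ≤ θ ^ n by positivity)
      rw [funext (smallCount_eq_tsum hj (θ ^ n))] at h5
      rw [h5.tsum_eq] at h3
      exact (sum_le_hasSum _ (fun k _ => variance_nonneg _ _) h4).trans h3.1.le
  have hmid1 := h.ae_eventually_upcrossings_midTime hp hα0 hα1 hL hρ i hc hε hθ1 (by linarith)
    (by linarith)
  have hmid2 := h.ae_eventually_upcrossings_midTime hp hα0 hα1 hL hρ (i + 1) hc hε hθ1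
    (by linarith) (by linarith)
  have hbounds : ∀ᶠ m : ℕ in atTop, midTime (midIndex m) ≤ m ∧ m - midTime (midIndex m) ≤
      2 / Real.log m ^ 2 * midTime (midIndex m) ∧ Real.log m ≤
      2 * Real.log (midTime (midIndex m)) :=
    (tendsto_log_natCast.eventually_ge_atTop 2).mono fun m => midIndex_bounds
  have hint (i : ℕ) := h.ae_eventually_upcrossings_short hp hα0 hα1 hL hρ i hc hε
    (fun m => midTime (midIndex m)) (fun m => m) (tendsto_midTime.comp tendsto_midIndex)
    (hbounds.mono fun m h => ⟨h.1, h.2.1⟩) (hbounds.mono fun m h => h.2.2)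
  have hfine (i : ℕ) := h.ae_eventually_upcrossings_short hp hα0 hα1 hL hρ i hc hε
    (fun m => m) (fun m => m + 1) tendsto_natCast_atTop_atTop (by
      have h1 := ((Real.isLittleO_pow_log_id_atTop (n := 2)).tendsto_div_nhds_zero.comp
        tendsto_natCast_atTop_atTop).eventually_le_const (show (0 : ℝ) < 2 by norm_num)
      filter_upwards [h1, tendsto_log_natCast.eventually_gt_atTop 0, eventually_gt_atTop 0]
        with m h2 h3 h4
      have h5 : (0 : ℝ) < m := by exact_mod_cast h4
      simp only [Function.comp_apply, id] at h2
      rw [div_le_iff₀ h5] at h2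
      refine ⟨by linarith, ?_⟩
      rw [div_mul_eq_mul_div, le_div_iff₀ (by positivity)]
      linarith) (by
      filter_upwards [tendsto_log_natCast.eventually_ge_atTop 0] with m h1
      linarith)
  have hmean (i : ℕ) : ∀ᶠ m : ℕ in atTop,
      ∫ ω', upcrossings T X (i + 1) m (m + 1) ω' ∂μ ≤ ε * lilScale p c m := by
    filter_upwards [tendsto_natCast_atTop_atTop.eventually
      (h.eventually_upcrossings_mean hp hα0 hα1 hL hρ i), eventually_ge_atTop 1,
      ((tendsto_lilScale hp hα0 hL hρ hc).comp tendsto_natCast_atTop_atTop).eventually_ge_atTop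
        (crossingConst i α / ε)] with m h1 h2 h3
    have h4 : (1 : ℝ) ≤ m := by exact_mod_cast h2
    have hC := crossingConst_pos i hα0 hα1
    rw [h.integral_upcrossings hp i (by linarith) (by linarith) (by linarith)]
    refine (h1 _ (by linarith) (by linarith)).2.trans ?_
    rw [Function.comp_apply, div_le_iff₀ hε] at h3
    refine le_trans ?_ (h3.trans_eq (mul_comm _ _))
    have h5 := rho_le hp (show (0 : ℝ) ≤ m by linarith)
    rw [add_sub_cancel_left, mul_assoc]
    refine mul_le_of_le_one_right hC.le ?_
    rw [one_div, inv_mul_le_one₀ (by linarith)]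
    exact h5
  filter_upwards [h.ae_eventually_lt_throwTime, hgeo, hmid1, hmid2, hint i, hint (i + 1), hfine i,
    hfine (i + 1)] with ω hω w1 w2 w3 w4 w5 w6 w7
  have step {s t y δ : ℝ} (hy : 0 ≤ y) (hδ : 0 < δ) (hs : Real.exp 1 ≤ s) (hst : s ≤ t)
      (ht : t ≤ 2 * s)
      (h1 : |smallCount T X (i + 1) s ω - ∫ ω', smallCount T X (i + 1) s ω' ∂μ| <
        y * lilScale p c s)
      (h2 : |upcrossings T X (i + 1) s t ω - ∫ ω', upcrossings T X (i + 1) s t ω' ∂μ| <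
        δ * lilScale p c s)
      (h3 : |upcrossings T X (i + 1 + 1) s t ω - ∫ ω', upcrossings T X (i + 1 + 1) s t ω' ∂μ| <
        δ * lilScale p c s) :
      |smallCount T X (i + 1) t ω - ∫ ω', smallCount T X (i + 1) t ω' ∂μ| <
        (y + 2 * δ) * lilScale p c t := by
    have h4 := h.centred_smallCount_le hp i ((Real.exp_pos 1).trans_le hs) hst ht hω
    have h5 := mul_le_mul_of_nonneg_left (lilScale_mono hp hc.le hs hst)
      (show 0 ≤ y + 2 * δ by linarith)
    linarith
  have hy : 0 ≤ √2 * (1 + ε) := by positivity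
  -- From the geometric times to the times `midTime m`.
  have hA : ∀ᶠ m in atTop, |smallCount T X (i + 1) (midTime m) ω -
      ∫ ω', smallCount T X (i + 1) (midTime m) ω' ∂μ| <
      (√2 * (1 + ε) + 2 * ε) * lilScale p c (midTime m) := by
    filter_upwards [(tendsto_geometricIndex hθ1).eventually w1, w2, w3,
      ((tendsto_pow_atTop_atTop_of_one_lt hθ1).comp
        (tendsto_geometricIndex hθ1)).eventually_ge_atTop (Real.exp 1)] with m h1 h2 h3 h4
    obtain ⟨h5, h6⟩ := geometricIndex_bounds hθ1 m
    have h7 : 0 < θ ^ geometricIndex θ m := by positivity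
    rw [Function.comp_apply] at h4
    exact step hy hε h4 h5 (h6.trans (by gcongr; linarith)) h1 h2 h3
  -- From the times `midTime m` to the integers.
  have hB : ∀ᶠ m : ℕ in atTop, |smallCount T X (i + 1) m ω -
      ∫ ω', smallCount T X (i + 1) m ω' ∂μ| <
      (√2 * (1 + ε) + 2 * ε + 2 * ε) * lilScale p c m := by
    filter_upwards [tendsto_midIndex.eventually hA, w4, w5, hbounds,
      (tendsto_midTime.comp tendsto_midIndex).eventually_ge_atTop (Real.exp 1),
      tendsto_log_natCast.eventually_ge_atTop 2] with m h1 h2 h3 h4 h5 h6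
    rw [Function.comp_apply] at h5
    refine step (by positivity) hε h5 h4.1 ?_ h1 h2 h3
    have h7 : 2 / Real.log m ^ 2 ≤ 1 := by
      rw [div_le_one (by positivity)]
      nlinarith
    have h8 := mul_le_mul_of_nonneg_right h7 ((Real.exp_pos 1).le.trans h5)
    linarith [h4.2.1]
  -- Between two integers, the increments are monotone in the right end point.
  have hC (i' : ℕ) (w : ∀ᶠ m : ℕ in atTop, |upcrossings T X (i' + 1) m (m + 1) ω -
      ∫ ω', upcrossings T X (i' + 1) m (m + 1) ω' ∂μ| < ε * lilScale p c m) :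
      ∀ᶠ m : ℕ in atTop, ∀ t, (m : ℝ) ≤ t → t ≤ m + 1 →
        |upcrossings T X (i' + 1) m t ω - ∫ ω', upcrossings T X (i' + 1) m t ω' ∂μ| <
          2 * ε * lilScale p c m := by
    filter_upwards [w, hmean i', eventually_ge_atTop 1] with m h1 h2 h3 t h4 h5
    have h6 : (1 : ℝ) ≤ m := by exact_mod_cast h3
    have h7 := upcrossings_mono (X := X) (i := i' + 1) (by omega) (s := (m : ℝ)) h5 hω
    have h8 : ∫ ω', upcrossings T X (i' + 1) m t ω' ∂μ ≤
        ∫ ω', upcrossings T X (i' + 1) m (m + 1) ω' ∂μ := by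
      refine integral_mono_ae (h.integrable_upcrossings hp i' (by linarith) h4 (by linarith))
        (h.integrable_upcrossings hp i' (by linarith) (by linarith) (by linarith)) ?_
      filter_upwards [h.ae_eventually_lt_throwTime] with ω' hω'
      exact upcrossings_mono (by omega) h5 hω'
    have h9 := upcrossings_nonneg (T := T) (X := X) (i' + 1) m t ω
    have h10 : 0 ≤ ∫ ω', upcrossings T X (i' + 1) m t ω' ∂μ :=
      integral_nonneg fun ω' => upcrossings_nonneg _ _ _ _
    have h11 := (abs_lt.1 h1).2
    have h12 := (abs_lt.1 h1).1
    rw [abs_lt]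
    constructor <;> linarith
  filter_upwards [tendsto_nat_floor_atTop.eventually hB,
    tendsto_nat_floor_atTop.eventually (hC i w6),
    tendsto_nat_floor_atTop.eventually (hC (i + 1) w7),
    (tendsto_natCast_atTop_atTop.comp tendsto_nat_floor_atTop).eventually_ge_atTop (Real.exp 1),
    eventually_ge_atTop 0] with t h1 h2 h3 h4 h5
  rw [Function.comp_apply] at h4
  have h6 := Nat.floor_le h5
  have h7 := (Nat.lt_floor_add_one t).le
  have h8 : (1 : ℝ) ≤ ⌊t⌋₊ := (Real.one_le_exp zero_le_one).trans h4
  have h9 := step (by positivity) (show 0 < 2 * ε by linarith) h4 h6 (by linarith) h1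
    (h2 t h6 h7) (h3 t h6 h7)
  convert h9 using 2
  ring

end Karlin

/-! ### The second Borel–Cantelli lemma for disjoint blocks -/

namespace Karlin

variable {Ω : Type*} [MeasurableSpace Ω] {μ : Measure Ω} [IsProbabilityMeasure μ]

/-- Events determined by disjoint blocks of an independent family are independent. -/
theorem iIndepSet_of_pairwise_disjoint {ζ : ℕ → Ω → ℝ} (hind : iIndepFun ζ μ)
    (hm : ∀ k, Measurable (ζ k)) {s : ℕ → Finset ℕ} (hs : ∀ m n, m ≠ n → Disjoint (s m) (s n))
    {D : ∀ n, Set (s n → ℝ)} (hD : ∀ n, MeasurableSet (D n)) :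
    iIndepSet (fun n => {ω | (fun k : s n => ζ k ω) ∈ D n}) μ := by
  have hA : ∀ n, MeasurableSet {ω | (fun k : s n => ζ k ω) ∈ D n} := fun n =>
    (measurable_pi_lambda (fun ω (k : s n) => ζ k ω) fun k => hm k) (hD n)
  rw [iIndepSet_iff_meas_biInter hA]
  intro S
  induction S using Finset.induction_on with
  | empty => simp
  | insert n S hn ih =>
    rw [Finset.prod_insert hn, Finset.set_biInter_insert, ← ih]
    have hdis : Disjoint (s n) (S.biUnion s) := by
      rw [Finset.disjoint_biUnion_right]
      exact fun i hi => hs n i fun h => hn (h ▸ hi)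
    have h1 := hind.indepFun_finset (s n) (S.biUnion s) hdis hm
    let E : Set (S.biUnion s → ℝ) := ⋂ i : S, {v | (fun k : s i => v ⟨k,
      Finset.mem_biUnion.2 ⟨i, i.2, k.2⟩⟩) ∈ D i}
    have hE : MeasurableSet E := MeasurableSet.iInter fun i =>
      (measurable_pi_lambda _ fun k => measurable_pi_apply _) (hD i)
    have h2 := h1.measure_inter_preimage_eq_mul _ _ (hD n) hE
    have h3 : (fun ω (k : S.biUnion s) => ζ k ω) ⁻¹' E =
        ⋂ i ∈ S, {ω | (fun k : s i => ζ k ω) ∈ D i} := by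
      ext ω
      simp [E]
    rw [h3] at h2
    exact h2

/-- The second Borel–Cantelli lemma for deviations of order `(log log)^{1/2}` of sums over disjoint
blocks of an independent family. -/
theorem ae_frequently_of_blocks {ζ : ℕ → Ω → ℝ} (hind : iIndepFun ζ μ)
    (hm : ∀ k, Measurable (ζ k)) (h01 : ∀ k ω, ζ k ω ∈ Set.Icc (0 : ℝ) 1) {s : ℕ → Finset ℕ}
    (hs : ∀ m n, m ≠ n → Disjoint (s m) (s n)) {x : ℕ → ℝ} {σ γ : ℝ} (hσ : |σ| = 1) (hγ : 0 < γ)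
    (hV : ∀ᶠ n in atTop, 0 < ∑ k ∈ s n, variance (ζ k) μ) (hx : ∀ᶠ n in atTop, 0 < x n)
    (hxV : Tendsto (fun n => x n / ∑ k ∈ s n, variance (ζ k) μ) atTop (𝓝 0))
    (hVx : Tendsto (fun n => (∑ k ∈ s n, variance (ζ k) μ) / x n ^ 2) atTop (𝓝 0))
    (hlog : ∀ᶠ n : ℕ in atTop,
      (1 + γ) * (x n ^ 2 / (2 * ∑ k ∈ s n, variance (ζ k) μ)) ≤ Real.log n) :
    ∀ᵐ ω ∂μ, ∃ᶠ n in atTop, x n ≤ σ * ∑ k ∈ s n, (ζ k ω - ∫ ω', ζ k ω' ∂μ) := by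
  obtain ⟨r, hr, hdev⟩ := exists_exp_le_measure_sum (μ := μ) hγ
  let D : ∀ n, Set (s n → ℝ) := fun n => {v | x n ≤ σ * ∑ k : s n, (v k - ∫ ω', ζ k ω' ∂μ)}
  have hD : ∀ n, MeasurableSet (D n) := fun n => measurableSet_le measurable_const
    (by fun_prop)
  have hA : ∀ n, {ω | (fun k : s n => ζ k ω) ∈ D n} =
      {ω | x n ≤ σ * ∑ k ∈ s n, (ζ k ω - ∫ ω', ζ k ω' ∂μ)} := by
    intro n
    ext ω
    simp only [D, Set.mem_ofPred_eq]
    rw [Finset.sum_coe_sort (s n) fun k => ζ k ω - ∫ ω', ζ k ω' ∂μ]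
  have hind2 := iIndepSet_of_pairwise_disjoint hind hm hs hD
  simp only [hA] at hind2
  have hmeas : ∀ n, MeasurableSet {ω | x n ≤ σ * ∑ k ∈ s n, (ζ k ω - ∫ ω', ζ k ω' ∂μ)} :=
    fun n => measurableSet_le measurable_const (by fun_prop)
  have hlower : ∀ᶠ n : ℕ in atTop, 1 / (n : ℝ) ≤
      μ.real {ω | x n ≤ σ * ∑ k ∈ s n, (ζ k ω - ∫ ω', ζ k ω' ∂μ)} := by
    filter_upwards [hV, hx, hxV.eventually_le_const hr, hVx.eventually_le_const hr, hlog,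
      eventually_gt_atTop 0] with n h1 h2 h3 h4 h5 h6
    have h7 : (0 : ℝ) < n := by exact_mod_cast h6
    rw [div_le_iff₀ h1] at h3
    rw [div_le_iff₀ (by positivity)] at h4
    refine le_trans ?_ (hdev ζ (s n) (x n) σ hind hm h01 hσ h1 h2 h3 h4)
    rw [one_div, ← Real.exp_log (inv_pos.2 h7), Real.log_inv]
    exact Real.exp_le_exp.2 (neg_le_neg h5)
  have htop : ∑' n, μ {ω | x n ≤ σ * ∑ k ∈ s n, (ζ k ω - ∫ ω', ζ k ω' ∂μ)} = ⊤ := by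
    by_contra hne
    have h1 : Summable fun n => μ.real {ω | x n ≤ σ * ∑ k ∈ s n, (ζ k ω - ∫ ω', ζ k ω' ∂μ)} :=
      ENNReal.summable_toReal hne
    refine Real.not_summable_one_div_natCast (Summable.of_norm_bounded_eventually_nat h1 ?_)
    filter_upwards [hlower] with n h2
    rwa [Real.norm_of_nonneg (by positivity)]
  have h1 := measure_limsup_eq_one hmeas hind2 htop
  have h2 : ∀ᵐ ω ∂μ, ω ∈ limsup (fun n =>
      {ω | x n ≤ σ * ∑ k ∈ s n, (ζ k ω - ∫ ω', ζ k ω' ∂μ)}) atTop := by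
    rw [← prob_compl_eq_zero_iff (MeasurableSet.measurableSet_limsup hmeas)] at h1
    exact h1
  filter_upwards [h2] with ω h3
  exact mem_limsup_iff_frequently_mem.1 h3

end Karlin

/-! ### The lower half of the law of the iterated logarithm -/

namespace Karlin

theorem tsum_eq_sum_add_tsum_ite_mem {f : ℕ → ℝ} (hf : Summable f) (s : Finset ℕ) :
    ∑' k, f k = ∑ k ∈ s, f k + ∑' k, if k ∈ s then 0 else f k := by
  have h1 : HasSum (fun k => if k ∈ s then f k else 0) (∑ k ∈ s, f k) := by
    have h2 : HasSum (fun k => if k ∈ s then f k else 0) (∑ k ∈ s, if k ∈ s then f k else 0) :=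
      hasSum_sum_of_ne_finset_zero fun k hk => if_neg hk
    rwa [Finset.sum_congr rfl fun k hk => if_pos hk] at h2
  have h2 := hf.hasSum.sub h1
  have h3 : (fun k => f k - if k ∈ s then f k else 0) = fun k => if k ∈ s then 0 else f k := by
    funext k
    split_ifs <;> simp
  rw [h3] at h2
  rw [h2.tsum_eq]
  ring

variable {Ω : Type*} [MeasurableSpace Ω] {μ : Measure Ω} [IsProbabilityMeasure μ]
  {T : ℕ → Ω → ℝ} {X : ℕ → Ω → ℕ} {p : ℕ → ℝ} {α : ℝ} {L : ℝ → ℝ}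

/-- The boxes whose mean number of balls at time `t` lies in `(a⁻¹, a]`. -/
def window (p : ℕ → ℝ) (a t : ℝ) : Set ℕ := {k | a⁻¹ < p k * t ∧ p k * t ≤ a}

theorem IsBoxDistribution.finite_window (hp : IsBoxDistribution p) {a : ℝ} (ha : 1 < a) (t : ℝ) :
    (window p a t).Finite :=
  (hp.finite_setOf_le (t := t) (inv_pos.2 (one_pos.trans ha))).subset fun _ hk => hk.1.le

theorem disjoint_window_pow {a : ℝ} (ha : 1 < a) {m n : ℕ} (hmn : m ≠ n) :
    Disjoint (window p a ((a ^ 2) ^ m)) (window p a ((a ^ 2) ^ n)) := by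
  wlog h : m < n generalizing m n
  · exact (this hmn.symm (by omega)).symm
  rw [Set.disjoint_left]
  intro k h1 h2
  have ha0 : 0 < a := one_pos.trans ha
  have h3 : (a ^ 2) ^ m * a ^ 2 ≤ (a ^ 2) ^ n := by
    rw [← pow_succ]
    exact pow_le_pow_right₀ (one_le_pow₀ ha.le) h
  have h4 : 0 < (a ^ 2) ^ m := by positivity
  have hp0 : 0 < p k := pos_of_mul_pos_left ((inv_pos.2 ha0).trans h1.1) h4.le
  have h5 : a⁻¹ * a ^ 2 < p k * (a ^ 2) ^ m * a ^ 2 := by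
    have := h1.1
    gcongr
  have h6 : a⁻¹ * a ^ 2 = a := by field_simp
  have h7 : p k * (a ^ 2) ^ m * a ^ 2 ≤ p k * (a ^ 2) ^ n := by
    rw [mul_assoc]
    gcongr
  have := h2.2
  linarith

/-- The lower half of the law of the iterated logarithm, for both signs `σ`. -/
theorem IsPoissonizedScheme.ae_frequently_le_smallCount_sub (hp : IsBoxDistribution p)
    (h : IsPoissonizedScheme p μ T X) (hα0 : 0 < α) (hα1 : α < 1) (hL : IsSlowlyVarying L)
    (hρ : rho p ~[atTop] fun t => t ^ α * L t) {j : ℕ} (hj : 1 ≤ j) {ε σ : ℝ} (hε : 0 < ε)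
    (hε1 : ε < 1) (hσ : |σ| = 1) :
    ∀ᵐ ω ∂μ, ∃ᶠ t in atTop, (√2 * (1 - ε) - ε) * lilScale p (varConst j α) t ≤
      σ * (smallCount T X j t ω - ∫ ω', smallCount T X j t ω' ∂μ) := by
  have hc := varConst_pos hj hα0 hα1
  have hV := tendsto_sum_poissonWeight_variance_div_rho hp hα0 hα1 hL hρ hj
  set c := varConst j α with hcdef
  have hsq : √2 ^ 2 = (2 : ℝ) := Real.sq_sqrt (by norm_num)
  obtain ⟨δ, hδ0, hδ1, hδ2⟩ : ∃ δ : ℝ, 0 < δ ∧ δ ≤ c * ε / 4 ∧ 2 * δ < ε ^ 2 * c := by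
    refine ⟨min (c * ε / 4) (ε ^ 2 * c / 4), by positivity, min_le_left _ _, ?_⟩
    have h1 := min_le_right (c * ε / 4) (ε ^ 2 * c / 4)
    have h2 : 0 < ε ^ 2 * c := by positivity
    linarith
  obtain ⟨a, ha, hwin⟩ := exists_window hp hα0 hα1 hL hρ hj hδ0
  have hθ : 1 < a ^ 2 := one_lt_pow₀ ha two_ne_zero
  set θ := a ^ 2 with hθdef
  have hθn (n : ℕ) : 0 ≤ θ ^ n := by positivity
  have hs := tendsto_pow_atTop_atTop_of_one_lt hθ
  have hpos := hs.eventually (eventually_rho_pos hp)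
  have hll := hs.eventually (tendsto_log_log.eventually_gt_atTop 0)
  let s : ℕ → Finset ℕ := fun n => (hp.finite_window ha (θ ^ n)).toFinset
  have hmem (n k : ℕ) : k ∈ s n ↔ a⁻¹ < p k * θ ^ n ∧ p k * θ ^ n ≤ a := by
    simp [s, window]
  have hdis : ∀ m n, m ≠ n → Disjoint (s m) (s n) := fun m n hmn => by
    rw [Set.Finite.disjoint_toFinset]
    exact disjoint_window_pow ha hmn
  -- Each box is looked at only at the time to whose window it belongs.
  obtain ⟨u, hu0, hu⟩ : ∃ u : ℕ → ℝ, (∀ k, 0 ≤ u k) ∧ ∀ n, ∀ k ∈ s n, u k = θ ^ n := by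
    classical
    refine ⟨fun k => if h : ∃ n, k ∈ s n then θ ^ h.choose else 0, fun k => ?_, fun n k hk => ?_⟩
    · dsimp only
      split_ifs <;> positivity
    · have hex : ∃ n, k ∈ s n := ⟨n, hk⟩
      dsimp only
      rw [dif_pos hex]
      congr 1
      by_contra hne
      exact Finset.disjoint_left.1 (hdis _ _ hne) hex.choose_spec hk
  have hq (n k : ℕ) := h.integral_boxTerm_exactly hp j k (s := fun _ => θ ^ n)
    (t := fun _ => θ ^ n) (hθn n)
  have hqs (n : ℕ) : Summable fun k => poissonWeight j (p k * θ ^ n) :=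
    hp.summable_poissonWeight hj (hθn n)
  have hq0 (n k : ℕ) : 0 ≤ poissonWeight j (p k * θ ^ n) :=
    poissonWeight_nonneg _ (mul_nonneg (hp.nonneg k) (hθn n))
  have hq1 (n k : ℕ) : poissonWeight j (p k * θ ^ n) ≤ 1 :=
    poissonWeight_le_one _ (mul_nonneg (hp.nonneg k) (hθn n))
  let ζ := boxTerm T X (fun _ => exactly j) u u
  have hζ (n k : ℕ) (hk : k ∈ s n) :
      ζ k = boxTerm T X (fun _ => exactly j) (fun _ => θ ^ n) (fun _ => θ ^ n) k := by
    funext ω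
    simp only [ζ, boxTerm, hu n k hk]
  -- The variance of the sum over a window is almost the full one.
  let V : ℕ → ℝ := fun n => ∑ k ∈ s n, variance (ζ k) μ
  have hVeq (n : ℕ) : V n =
      ∑ k ∈ s n, poissonWeight j (p k * θ ^ n) * (1 - poissonWeight j (p k * θ ^ n)) := by
    refine Finset.sum_congr rfl fun k hk => ?_
    rw [hζ n k hk, h.variance_boxTerm, hq]
  have hwin' : ∀ᶠ n in atTop, (∑' k, if k ∈ s n then 0 else poissonWeight j (p k * θ ^ n)) ≤
      δ * rho p (θ ^ n) := by
    filter_upwards [hs.eventually hwin] with n h1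
    simpa only [hmem] using h1
  have hite (n : ℕ) : Summable fun k => if k ∈ s n then 0 else poissonWeight j (p k * θ ^ n) :=
    (hqs n).of_nonneg_of_le (fun k => by split_ifs; exacts [le_rfl, hq0 n k])
      fun k => by split_ifs; exacts [hq0 n k, le_rfl]
  have hVbd : ∀ᶠ n in atTop, c * (1 - ε / 2) * rho p (θ ^ n) ≤ V n ∧
      V n ≤ 2 * c * rho p (θ ^ n) := by
    filter_upwards [hs.eventually (hV.eventually_const_lt (show c - c * ε / 4 < c by
        have : 0 < c * ε := by positivity
        linarith)),
      hs.eventually (hV.eventually_lt_const (show c < 2 * c by linarith)), hpos, hwin']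
      with n h1 h2 h3 h4
    rw [lt_div_iff₀ h3] at h1
    rw [div_lt_iff₀ h3] at h2
    have hqq0 (k : ℕ) :
        0 ≤ poissonWeight j (p k * θ ^ n) * (1 - poissonWeight j (p k * θ ^ n)) :=
      mul_nonneg (hq0 n k) (by linarith [hq1 n k])
    have hqq1 (k : ℕ) : poissonWeight j (p k * θ ^ n) * (1 - poissonWeight j (p k * θ ^ n)) ≤
        poissonWeight j (p k * θ ^ n) :=
      mul_le_of_le_one_right (hq0 n k) (by linarith [hq0 n k])
    have hqqs : Summable fun k =>
        poissonWeight j (p k * θ ^ n) * (1 - poissonWeight j (p k * θ ^ n)) :=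
      (hqs n).of_nonneg_of_le hqq0 hqq1
    have h5 := tsum_eq_sum_add_tsum_ite_mem hqqs (s n)
    rw [← hVeq] at h5
    have h6 : (∑' k, if k ∈ s n then 0 else
        poissonWeight j (p k * θ ^ n) * (1 - poissonWeight j (p k * θ ^ n))) ≤
        ∑' k, if k ∈ s n then 0 else poissonWeight j (p k * θ ^ n) := by
      refine Summable.tsum_le_tsum (fun k => ?_) ((hite n).of_nonneg_of_le (fun k => ?_)
        fun k => ?_) (hite n)
      · split_ifs; exacts [le_rfl, hqq1 k]
      · split_ifs; exacts [le_rfl, hqq0 k]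
      · split_ifs; exacts [le_rfl, hqq1 k]
    have h7 : 0 ≤ ∑' k, if k ∈ s n then 0 else
        poissonWeight j (p k * θ ^ n) * (1 - poissonWeight j (p k * θ ^ n)) :=
      tsum_nonneg fun k => by split_ifs; exacts [le_rfl, hqq0 k]
    have h8 := mul_le_mul_of_nonneg_right hδ1 h3.le
    constructor <;> nlinarith
  have hε2 : 0 < 1 - ε / 2 := by linarith
  let x : ℕ → ℝ := fun n => √2 * (1 - ε) * lilScale p c (θ ^ n)
  have hxsq : ∀ᶠ n in atTop, x n ^ 2 =
      2 * (1 - ε) ^ 2 * (c * rho p (θ ^ n) * Real.log (Real.log (θ ^ n))) := by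
    filter_upwards [hll] with n h1
    rw [mul_pow, mul_pow, hsq, lilScale_sq hc.le h1.le]
  have hx : ∀ᶠ n in atTop, 0 < x n := by
    filter_upwards [hpos, hll] with n h1 h2
    exact mul_pos (mul_pos (by positivity) (by linarith))
      (Real.sqrt_pos.2 (mul_pos (mul_pos hc h1) h2))
  have hVpos : ∀ᶠ n in atTop, 0 < V n := by
    filter_upwards [hVbd, hpos] with n h1 h2
    exact lt_of_lt_of_le (by positivity) h1.1
  have hfreq : ∀ᵐ ω ∂μ, ∃ᶠ n in atTop, x n ≤ σ * ∑ k ∈ s n, (ζ k ω - ∫ ω', ζ k ω' ∂μ) := by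
    refine ae_frequently_of_blocks (h.iIndepFun_boxTerm _ _ _ hp) (h.measurable_boxTerm _ _ _)
      (boxTerm_mem_Icc _ _ _) hdis hσ hε hVpos hx ?_ ?_ ?_
    · have h1 := ((tendsto_scaleRatio hp hα0 hL hρ).comp hs).const_mul
        (√2 * (1 - ε) * √c / (c * (1 - ε / 2)))
      rw [mul_zero] at h1
      refine squeeze_zero' ?_ ?_ h1
      · filter_upwards [hx, hVpos] with n h2 h3
        exact div_nonneg h2.le h3.le
      · filter_upwards [hVbd, hpos, hx] with n h2 h3 h4
        refine (div_le_div_of_nonneg_left h4.le (by positivity) h2.1).trans_eq ?_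
        simp only [x, Function.comp_apply]
        rw [lilScale_eq hc.le h3]
        field_simp
    · have h1 := ((tendsto_log_log.comp hs).const_div_atTop ((1 - ε) ^ 2)⁻¹)
      refine squeeze_zero' ?_ ?_ h1
      · filter_upwards [hVpos] with n h2
        exact div_nonneg h2.le (sq_nonneg _)
      · filter_upwards [hVbd, hpos, hx, hxsq, hll] with n h2 h3 h4 h5 h6
        refine (div_le_div_of_nonneg_right h2.2 (sq_nonneg _)).trans_eq ?_
        rw [h5, Function.comp_apply]
        have h7 : 1 - ε ≠ 0 := by linarith
        field_simp
    · have h1 := (tendsto_log_log_pow_div_log hθ).const_mul (1 - ε ^ 2)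
      have h2 := h1.eventually_le_const (show (1 - ε ^ 2) * 1 < 1 by nlinarith)
      filter_upwards [h2, hVbd, hpos, hxsq, hll, tendsto_log_natCast.eventually_gt_atTop 0]
        with n h3 h4 h5 h6 h7 h8
      set l := Real.log (Real.log (θ ^ n)) with hl
      have h9 : x n ^ 2 / (2 * V n) ≤ (1 - ε) * l := by
        rw [h6, div_le_iff₀ (by nlinarith [mul_pos (mul_pos hc hε2) h5])]
        have h10 : (1 - ε) * l * (2 * (c * (1 - ε / 2) * rho p (θ ^ n))) ≤
            (1 - ε) * l * (2 * V n) := by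
          have : 0 ≤ 1 - ε := by linarith
          have := h4.1
          gcongr
        refine le_trans ?_ h10
        have h11 : 0 ≤ (1 - ε) * l * (2 * c * rho p (θ ^ n)) * (ε / 2) :=
          mul_nonneg (mul_nonneg (mul_nonneg (by linarith) h7.le) (by positivity)) (by positivity)
        nlinarith
      have h10 : (1 - ε ^ 2) * l ≤ Real.log n := by
        rw [← mul_div_assoc, div_le_one h8] at h3
        exact h3
      calc (1 + ε) * (x n ^ 2 / (2 * V n)) ≤ (1 + ε) * ((1 - ε) * l) := by gcongr
        _ = (1 - ε ^ 2) * l := by ring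
        _ ≤ _ := h10
  -- The boxes outside the window are negligible.
  let B : ℕ → ℕ → Set (ℕ × ℕ) := fun n k => if k ∈ s n then ∅ else exactly j
  have hB (n k : ℕ) (ω : Ω) : boxTerm T X (B n) (fun _ => θ ^ n) (fun _ => θ ^ n) k ω =
      if k ∈ s n then 0 else
        boxTerm T X (fun _ => exactly j) (fun _ => θ ^ n) (fun _ => θ ^ n) k ω := by
    by_cases hk : k ∈ s n <;> simp [boxTerm, B, hk]
  have hBint (n k : ℕ) : ∫ ω, boxTerm T X (B n) (fun _ => θ ^ n) (fun _ => θ ^ n) k ω ∂μ =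
      if k ∈ s n then 0 else poissonWeight j (p k * θ ^ n) := by
    simp only [hB]
    split_ifs
    · simp
    · exact hq n k
  have hBsum (n : ℕ) : Summable fun k =>
      ∫ ω, boxTerm T X (B n) (fun _ => θ ^ n) (fun _ => θ ^ n) k ω ∂μ := by
    simpa only [hBint] using hite n
  have hrest := h.ae_eventually_geometric hp hα0 hL hρ hθ hc hδ0 hε hδ2 B
    (Eventually.of_forall hBsum) (by
      filter_upwards [hwin'] with n h1 N
      refine le_trans (Finset.sum_le_sum fun k _ => variance_le_integral_of_mem_Icc
        (h.measurable_boxTerm _ _ _ k) (boxTerm_mem_Icc _ _ _ k)) ?_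
      refine le_trans ((hBsum n).sum_le_tsum _ fun k _ =>
        integral_nonneg fun ω => (boxTerm_mem_Icc _ _ _ k ω).1) ?_
      simpa only [hBint] using h1)
  filter_upwards [hfreq, hrest, h.ae_eventually_lt_throwTime] with ω w1 w2 hω
  refine hs.frequently ((w1.and_eventually w2).mono fun n hn => ?_)
  obtain ⟨h1, h2⟩ := hn
  have h3 : smallCount T X j (θ ^ n) ω = ∑ k ∈ s n, ζ k ω +
      ∑' k, boxTerm T X (B n) (fun _ => θ ^ n) (fun _ => θ ^ n) k ω := by
    have hsum : Summable fun k =>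
        boxTerm T X (fun _ => exactly j) (fun _ => θ ^ n) (fun _ => θ ^ n) k ω :=
      summable_boxTerm_of_pos hω fun k y hy => by
        have : y.2 = j := hy
        omega
    rw [smallCount_eq_tsum hj, tsum_eq_sum_add_tsum_ite_mem hsum (s n)]
    simp only [hB]
    rw [Finset.sum_congr rfl fun k hk => by rw [← hζ n k hk]]
  have h4 : ∫ ω', smallCount T X j (θ ^ n) ω' ∂μ = ∑ k ∈ s n, ∫ ω', ζ k ω' ∂μ +
      ∫ ω', ∑' k, boxTerm T X (B n) (fun _ => θ ^ n) (fun _ => θ ^ n) k ω' ∂μ := by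
    rw [h.integral_smallCount hp hj (hθn n), tsum_eq_sum_add_tsum_ite_mem (hqs n) (s n),
      ← (hasSum_integral_tsum (h.measurable_boxTerm _ _ _) (boxTerm_mem_Icc _ _ _)
        (hBsum n)).tsum_eq]
    simp only [hBint]
    congr 1
    exact Finset.sum_congr rfl fun k hk => by rw [hζ n k hk, hq n k]
  rw [Finset.sum_sub_distrib] at h1
  set R := ∑' k, boxTerm T X (B n) (fun _ => θ ^ n) (fun _ => θ ^ n) k ω -
    ∫ ω', ∑' k, boxTerm T X (B n) (fun _ => θ ^ n) (fun _ => θ ^ n) k ω' ∂μ with hR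
  have h5 : smallCount T X j (θ ^ n) ω - ∫ ω', smallCount T X j (θ ^ n) ω' ∂μ =
      ∑ k ∈ s n, ζ k ω - ∑ k ∈ s n, ∫ ω', ζ k ω' ∂μ + R := by
    rw [h3, h4, hR]
    ring
  have h6 : |σ * R| < ε * lilScale p c (θ ^ n) := by rwa [abs_mul, hσ, one_mul]
  rw [h5, mul_add, sub_mul]
  have h7 := (abs_lt.1 h6).1
  simp only [x] at h1
  linarith

end Karlin

/-! ### The normalized small counts -/

namespace Karlin

theorem limsup_coe_eq {f : ℝ → ℝ} {a : ℝ} (h1 : ∀ b, a < b → ∀ᶠ t in atTop, f t ≤ b)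
    (h2 : ∀ b, b < a → ∃ᶠ t in atTop, b ≤ f t) :
    limsup (fun t => (f t : EReal)) atTop = (a : EReal) := by
  refine le_antisymm (EReal.le_of_forall_lt_iff_le.1 fun b hb => ?_)
    (EReal.ge_of_forall_gt_iff_ge.1 fun b hb => ?_)
  · exact limsup_le_of_le (by isBoundedDefault)
      ((h1 b (EReal.coe_lt_coe_iff.1 hb)).mono fun t ht => EReal.coe_le_coe_iff.2 ht)
  · exact le_limsup_of_frequently_le
      ((h2 b (EReal.coe_lt_coe_iff.1 hb)).mono fun t ht => EReal.coe_le_coe_iff.2 ht)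
      (by isBoundedDefault)

theorem liminf_coe_eq {f : ℝ → ℝ} {a : ℝ} (h1 : ∀ b, b < a → ∀ᶠ t in atTop, b ≤ f t)
    (h2 : ∀ b, a < b → ∃ᶠ t in atTop, f t ≤ b) :
    liminf (fun t => (f t : EReal)) atTop = (a : EReal) := by
  refine le_antisymm (EReal.le_of_forall_lt_iff_le.1 fun b hb => ?_)
    (EReal.ge_of_forall_gt_iff_ge.1 fun b hb => ?_)
  · exact liminf_le_of_frequently_le
      ((h2 b (EReal.coe_lt_coe_iff.1 hb)).mono fun t ht => EReal.coe_le_coe_iff.2 ht)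
      (by isBoundedDefault)
  · exact le_liminf_of_le (by isBoundedDefault)
      ((h1 b (EReal.coe_lt_coe_iff.1 hb)).mono fun t ht => EReal.coe_le_coe_iff.2 ht)

variable {Ω : Type*} [MeasurableSpace Ω] {μ : Measure Ω} [IsProbabilityMeasure μ]
  {T : ℕ → Ω → ℝ} {X : ℕ → Ω → ℕ} {p : ℕ → ℝ} {α : ℝ} {L : ℝ → ℝ}

theorem isEquivalent_of_tendsto_div_rho (hp : IsBoxDistribution p)
    (hρ : rho p ~[atTop] fun t => t ^ α * L t) {f : ℝ → ℝ} {c : ℝ} (hc : 0 < c)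
    (hf : Tendsto (fun t => f t / rho p t) atTop (𝓝 c)) :
    f ~[atTop] fun t => c * (t ^ α * L t) := by
  have h1 : f ~[atTop] fun t => c * rho p t := by
    refine (isEquivalent_iff_tendsto_one ?_).2 ?_
    · filter_upwards [eventually_rho_pos hp] with t ht
      positivity
    · have h2 := hf.const_mul c⁻¹
      rw [inv_mul_cancel₀ hc.ne'] at h2
      refine h2.congr fun t => ?_
      simp only [Pi.div_apply]
      rw [inv_mul_eq_div, div_div, mul_comm]
  exact h1.trans (IsEquivalent.refl.mul hρ)

theorem IsPoissonizedScheme.tendsto_integral_smallCount_div_rho (hp : IsBoxDistribution p)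
    (h : IsPoissonizedScheme p μ T X) (hα0 : 0 < α) (hα1 : α < 1) (hL : IsSlowlyVarying L)
    (hρ : rho p ~[atTop] fun t => t ^ α * L t) {j : ℕ} (hj : 1 ≤ j) :
    Tendsto (fun t => (∫ ω, smallCount T X j t ω ∂μ) / rho p t) atTop (𝓝 (meanConst j α)) := by
  refine (tendsto_sum_poissonWeight_div_rho hp hα0 hα1 hL hρ hj).congr' ?_
  filter_upwards [eventually_ge_atTop 0] with t ht
  rw [h.integral_smallCount hp hj ht]

theorem IsPoissonizedScheme.tendsto_variance_smallCount_div_rho (hp : IsBoxDistribution p)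
    (h : IsPoissonizedScheme p μ T X) (hα0 : 0 < α) (hα1 : α < 1) (hL : IsSlowlyVarying L)
    (hρ : rho p ~[atTop] fun t => t ^ α * L t) {j : ℕ} (hj : 1 ≤ j) :
    Tendsto (fun t => variance (smallCount T X j t) μ / rho p t) atTop (𝓝 (varConst j α)) := by
  refine (tendsto_sum_poissonWeight_variance_div_rho hp hα0 hα1 hL hρ hj).congr' ?_
  filter_upwards [eventually_ge_atTop 0] with t ht
  rw [(h.hasSum_variance_smallCount hp hj ht).tsum_eq]

/-- A function of the order of `ρ` grows between two powers of `t`, so its iterated logarithm is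
asymptotically that of `t`. -/
theorem tendsto_log_log_div_log_log (hp : IsBoxDistribution p) (hα0 : 0 < α)
    (hL : IsSlowlyVarying L) (hρ : rho p ~[atTop] fun t => t ^ α * L t) {V : ℝ → ℝ} {c : ℝ}
    (hc : 0 < c) (hV : Tendsto (fun t => V t / rho p t) atTop (𝓝 c)) :
    Tendsto (fun t => Real.log (Real.log (V t)) / Real.log (Real.log t)) atTop (𝓝 1) := by
  have hpow : Tendsto (fun t : ℝ => t ^ (α / 4)) atTop atTop :=
    tendsto_rpow_atTop (by linarith)
  have hbd : ∀ᶠ t in atTop, Real.log (α / 4) + Real.log (Real.log t) ≤ Real.log (Real.log (V t)) ∧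
      Real.log (Real.log (V t)) ≤ Real.log 2 + Real.log (Real.log t) := by
    filter_upwards [hV.eventually_const_lt (half_lt_self hc),
      hV.eventually_lt_const (show c < 2 * c by linarith), eventually_rho_pos hp,
      eventually_rpow_le_rho hp hL hρ (half_pos hα0) (half_lt_self hα0),
      hpow.eventually_ge_atTop (2 / c), eventually_ge_atTop (2 * c), eventually_gt_atTop 1]
      with t h1 h2 h3 h4 h5 h6 h7
    have h0 : 0 < t := by linarith
    rw [lt_div_iff₀ h3] at h1
    rw [div_lt_iff₀ h3] at h2
    have hlog : 0 < Real.log t := Real.log_pos h7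
    have h8 : t ^ (α / 4) ≤ V t := by
      have h9 : t ^ (α / 2) = t ^ (α / 4) * t ^ (α / 4) := by
        rw [← Real.rpow_add h0]; ring_nf
      rw [div_le_iff₀ hc] at h5
      have h10 : 0 < t ^ (α / 4) := by positivity
      have h11 : c / 2 * t ^ (α / 2) ≤ c / 2 * rho p t := by gcongr
      rw [h9] at h11
      nlinarith
    have h9 : V t ≤ t ^ 2 := by
      have h10 := rho_le hp h0.le
      have h11 : 2 * c * rho p t ≤ t * t := by gcongr
      linarith [sq t]
    have h10 : α / 4 * Real.log t ≤ Real.log (V t) := by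
      rw [← Real.log_rpow h0]
      exact Real.log_le_log (by positivity) h8
    have h11 : Real.log (V t) ≤ 2 * Real.log t := by
      have h12 := Real.log_le_log (lt_of_lt_of_le (by positivity) h8) h9
      rwa [Real.log_pow] at h12
    have h13 : 0 < α / 4 * Real.log t := by positivity
    rw [← Real.log_mul (by positivity) hlog.ne', ← Real.log_mul two_ne_zero hlog.ne']
    exact ⟨Real.log_le_log h13 h10, Real.log_le_log (h13.trans_le h10) h11⟩
  have hlim (a : ℝ) : Tendsto (fun t : ℝ => a / Real.log (Real.log t) + 1) atTop (𝓝 1) := by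
    have := (tendsto_log_log.const_div_atTop a).add_const 1
    rwa [zero_add] at this
  refine tendsto_of_tendsto_of_tendsto_of_le_of_le' (hlim (Real.log (α / 4))) (hlim (Real.log 2))
    ?_ ?_
  all_goals
    filter_upwards [hbd, tendsto_log_log.eventually_gt_atTop 0] with t h1 h2
    first
    | rw [le_div_iff₀ h2, add_mul, one_mul, div_mul_cancel₀ _ h2.ne']
      exact h1.1
    | rw [div_le_iff₀ h2, add_mul, one_mul, div_mul_cancel₀ _ h2.ne']
      exact h1.2

/-- The denominator in the law of the iterated logarithm may be replaced by `lilScale`. -/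
theorem tendsto_lilScale_div (hp : IsBoxDistribution p) (hα0 : 0 < α)
    (hL : IsSlowlyVarying L) (hρ : rho p ~[atTop] fun t => t ^ α * L t) {V : ℝ → ℝ} {c : ℝ}
    (hc : 0 < c) (hV : Tendsto (fun t => V t / rho p t) atTop (𝓝 c)) :
    Tendsto (fun t => lilScale p c t / √(V t * Real.log (Real.log (V t)))) atTop (𝓝 1) := by
  have h1 : Tendsto (fun t => √((V t / rho p t / c) *
      (Real.log (Real.log (V t)) / Real.log (Real.log t)))⁻¹) atTop (𝓝 (√((c / c) * 1)⁻¹)) :=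
    (((hV.div_const c).mul (tendsto_log_log_div_log_log hp hα0 hL hρ hc hV)).inv₀
      (by simp [hc.ne'])).sqrt
  rw [div_self hc.ne', one_mul, inv_one, Real.sqrt_one] at h1
  refine h1.congr' ?_
  filter_upwards [eventually_rho_pos hp, tendsto_log_log.eventually_gt_atTop 0] with t h2 h3
  rw [lilScale, ← Real.sqrt_div (by positivity)]
  congr 1
  rw [div_div, div_mul_div_comm, inv_div]
  ring

/-- The law of the iterated logarithm for the normalized small counts, in terms of upper and lower
bounds. -/
theorem IsPoissonizedScheme.ae_normalizedCount (hp : IsBoxDistribution p)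
    (h : IsPoissonizedScheme p μ T X) (hα0 : 0 < α) (hα1 : α < 1) (hL : IsSlowlyVarying L)
    (hρ : rho p ~[atTop] fun t => t ^ α * L t) {j : ℕ} (hj : 1 ≤ j) :
    ∀ᵐ ω ∂μ, (∀ b, √2 < b → ∀ᶠ t in atTop, |normalizedCount μ T X j t ω| ≤ b) ∧
      (∀ b, b < √2 → ∃ᶠ t in atTop, b ≤ normalizedCount μ T X j t ω) ∧
      (∀ b, b < √2 → ∃ᶠ t in atTop, b ≤ -normalizedCount μ T X j t ω) := by
  have hc := varConst_pos hj hα0 hα1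
  have hratio := tendsto_lilScale_div hp hα0 hL hρ hc
    (h.tendsto_variance_smallCount_div_rho hp hα0 hα1 hL hρ hj)
  have hscale := tendsto_lilScale hp hα0 hL hρ hc
  set c := varConst j α
  let e : ℕ → ℝ := fun m => 1 / ((m : ℝ) + 1 + 1)
  have he0 (m : ℕ) : 0 < e m := by positivity
  have he1 (m : ℕ) : e m < 1 := by
    rw [div_lt_one (by positivity)]
    have : (0 : ℝ) ≤ m := Nat.cast_nonneg m
    linarith
  have he : Tendsto e atTop (𝓝 0) := by
    have := (tendsto_one_div_add_atTop_nhds_zero_nat (𝕜 := ℝ)).comp (tendsto_add_atTop_nat 1)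
    refine this.congr fun m => ?_
    simp [e]
  have hup : ∀ᵐ ω ∂μ, ∀ m, ∀ᶠ t in atTop,
      |smallCount T X j t ω - ∫ ω', smallCount T X j t ω' ∂μ| <
        (√2 * (1 + e m) + 8 * e m) * lilScale p c t :=
    ae_all_iff.2 fun m => h.ae_eventually_abs_smallCount_sub_lt hp hα0 hα1 hL hρ hj (he0 m)
  have hlow (σ : ℝ) (hσ : |σ| = 1) : ∀ᵐ ω ∂μ, ∀ m, ∃ᶠ t in atTop,
      (√2 * (1 - e m) - e m) * lilScale p c t ≤
        σ * (smallCount T X j t ω - ∫ ω', smallCount T X j t ω' ∂μ) :=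
    ae_all_iff.2 fun m =>
      h.ae_frequently_le_smallCount_sub hp hα0 hα1 hL hρ hj (he0 m) (he1 m) hσ
  filter_upwards [hup, hlow 1 (by simp), hlow (-1) (by simp)] with ω w1 w2 w3
  have hN (t : ℝ) (ht : 0 < lilScale p c t) : normalizedCount μ T X j t ω =
      (smallCount T X j t ω - ∫ ω', smallCount T X j t ω' ∂μ) / lilScale p c t *
      (lilScale p c t / √(variance (smallCount T X j t) μ *
        Real.log (Real.log (variance (smallCount T X j t) μ)))) := by
    rw [normalizedCount, div_mul_div_cancel₀ ht.ne']
  have hlower (σ : ℝ) (w : ∀ m, ∃ᶠ t in atTop, (√2 * (1 - e m) - e m) * lilScale p c t ≤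
      σ * (smallCount T X j t ω - ∫ ω', smallCount T X j t ω' ∂μ)) (b : ℝ) (hb : b < √2) :
      ∃ᶠ t in atTop, b ≤ σ * normalizedCount μ T X j t ω := by
    have h1 : Tendsto (fun m => √2 * (1 - e m) - e m) atTop (𝓝 (√2 * (1 - 0) - 0)) :=
      ((tendsto_const_nhds.sub he).const_mul _).sub he
    obtain ⟨m, hm⟩ := (h1.eventually_const_lt (show b < √2 * (1 - 0) - 0 by simpa using hb)).exists
    have h2 := hratio.const_mul (√2 * (1 - e m) - e m)
    rw [mul_one] at h2
    refine ((w m).and_eventually ((h2.eventually_const_lt hm).and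
      (hscale.eventually_gt_atTop 0))).mono fun t ht => ?_
    obtain ⟨h3, h4, h5⟩ := ht
    refine h4.le.trans ?_
    rw [hN t h5, ← mul_assoc]
    refine mul_le_mul_of_nonneg_right ?_ (div_nonneg h5.le (Real.sqrt_nonneg _))
    rwa [← mul_div_assoc, le_div_iff₀ h5]
  refine ⟨fun b hb => ?_, fun b hb => ?_, fun b hb => ?_⟩
  · have h1 : Tendsto (fun m => √2 * (1 + e m) + 8 * e m) atTop
        (𝓝 (√2 * (1 + 0) + 8 * 0)) :=
      ((tendsto_const_nhds.add he).const_mul _).add (he.const_mul _)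
    obtain ⟨m, hm⟩ :=
      (h1.eventually_lt_const (show √2 * (1 + 0) + 8 * 0 < b by
        rwa [add_zero, mul_one, mul_zero, add_zero])).exists
    have h2 := hratio.const_mul (√2 * (1 + e m) + 8 * e m)
    rw [mul_one] at h2
    filter_upwards [w1 m, h2.eventually_lt_const hm, hscale.eventually_gt_atTop 0] with t h3 h4 h5
    refine le_trans ?_ h4.le
    rw [hN t h5, abs_mul, abs_div, abs_of_pos h5]
    have h6 : 0 ≤ lilScale p c t / √(variance (smallCount T X j t) μ *
        Real.log (Real.log (variance (smallCount T X j t) μ))) := by positivity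
    rw [abs_of_nonneg h6]
    refine mul_le_mul_of_nonneg_right ?_ h6
    rw [div_le_iff₀ h5]
    exact h3.le
  · simpa using hlower 1 w2 b hb
  · simpa using hlower (-1) w3 b hb

end Karlin

theorem theorem1p4 {Ω : Type*} [MeasurableSpace Ω] (μ : Measure Ω) [IsProbabilityMeasure μ]
    (p : ℕ → ℝ) (hp : Karlin.IsBoxDistribution p)
    (T : ℕ → Ω → ℝ) (X : ℕ → Ω → ℕ) (hTX : Karlin.IsPoissonizedScheme p μ T X)
    (α : ℝ) (hα0 : 0 < α) (hα1 : α < 1) (L : ℝ → ℝ) (hL : Karlin.IsSlowlyVarying L)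
    (hρ : Karlin.rho p ~[atTop] fun t => t ^ α * L t)
    (j : ℕ) (hj : 1 ≤ j) :
    -- the counts are square integrable, so that their means and variances are genuine
    (∀ t : ℝ, MemLp (Karlin.smallCount T X j t) 2 μ) ∧
    (∀ᵐ ω ∂μ, limsup (fun t : ℝ => (Karlin.normalizedCount μ T X j t ω : EReal)) atTop
      = ((√2 : ℝ) : EReal)) ∧
    (∀ᵐ ω ∂μ, liminf (fun t : ℝ => (Karlin.normalizedCount μ T X j t ω : EReal)) atTop
      = ((-√2 : ℝ) : EReal)) ∧
    ((fun t : ℝ => ∫ ω, Karlin.smallCount T X j t ω ∂μ) ~[atTop]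
      fun t => α * (Real.Gamma (j - α) / (j ! : ℝ)) * t ^ α * L t) ∧
    ((fun t : ℝ => variance (Karlin.smallCount T X j t) μ) ~[atTop]
      fun t => Karlin.varConst j α * t ^ α * L t) ∧
    0 < Karlin.varConst j α := by
  have hlil := hTX.ae_normalizedCount hp hα0 hα1 hL hρ hj
  refine ⟨hTX.memLp_smallCount hp hj, ?_, ?_, ?_, ?_, Karlin.varConst_pos hj hα0 hα1⟩
  · filter_upwards [hlil] with ω h
    exact Karlin.limsup_coe_eq (fun b hb => (h.1 b hb).mono fun t ht => (le_abs_self _).trans ht)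
      h.2.1
  · filter_upwards [hlil] with ω h
    refine Karlin.liminf_coe_eq (fun b hb => ?_) fun b hb => ?_
    · exact (h.1 (-b) (by linarith)).mono fun t ht => by linarith [(abs_le.1 ht).1]
    · exact (h.2.2 (-b) (by linarith)).mono fun t ht => by linarith
  · refine (Karlin.isEquivalent_of_tendsto_div_rho hp hρ (Karlin.meanConst_pos hj hα0 hα1)
      (hTX.tendsto_integral_smallCount_div_rho hp hα0 hα1 hL hρ hj)).congr_right ?_
    exact Eventually.of_forall fun t => by simp only [Karlin.meanConst]; ring
  · refine (Karlin.isEquivalent_of_tendsto_div_rho hp hρ (Karlin.varConst_pos hj hα0 hα1)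
      (hTX.tendsto_variance_smallCount_div_rho hp hα0 hα1 hL hρ hj)).congr_right ?_
    exact Eventually.of_forall fun t => by ring
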